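/- Let $\mathbb N=\{1,2,\dots\}$. For finite sets $E,F\subset\mathbb N$ write $E<F$ if $a<b$ for all $a\in E$, $b\in F$, and $n\le E$ if $n\le a$ for all $a\in E$. The Schreier families are $\mathcal S_0=\{\varnothing\}\cup\{\{n\}:n\in\mathbb N\}$, $\mathcal S_1=\{E:|E|\le\min E\}\cup\{\varnothing\}$, $\mathcal S_{\xi+1}=\mathcal S_1[\mathcal S_\xi]$, the family of all unions $E_1\cup\dots\cup E_n$ of nonempty sets $E_1<\dots<E_n$ in $\mathcal S_\xi$ with $\{\min E_1,\dots,\min E_n\}\in\mathcal S_1$, and, for a countable limit ordinal $\xi$, $\mathcal S_\xi=\{E:\exists n\le E,\ E\in\mathcal S_{\xi_n}\}$, where $\xi_n\uparrow\xi$ is a fixed strictly increasing sequence with supremum $\xi$ (any choice of these sequences is allowed). Let $X$ be a real Banach space with norm $\|\cdot\|$ and Schauder basis $(e_i)$. For $t\ge 1$ and a family $\mathcal F$ of finite subsets of $\mathbb N$, $X$ is $t$-$\mathcal F$ distortable if there is an equivalent norm $|\cdot|$ on $X$ such that for every normalized block sequence $(x_i)$ of $(e_i)$ there are $E\in\mathcal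 F$ and $x,y\in\operatorname{span}\{x_i:i\in E\}$ with $\|x\|=\|y\|=1$ and $|x|/|y|>t$; $X$ is $\mathcal F$ arbitrarily distortable if it is $t$-$\mathcal F$ distortable for every $t\ge1$. Let $D_t(X)$ be the least $\xi<\omega_1$ such that $X$ is $t$-$\mathcal S_\xi$ distortable, and let $AD(X)$ be the least $\xi<\omega_1$ such that $X$ is $\mathcal S_\xi$ arbitrarily distortable (with value $\omega_1$ if there is no such $\xi$). Schlumprecht's space $S$ and the Figiel--Johnson Tsirelson space $T$ are the completions of the space $c_{00}$ of finitely supported real sequences under the norms satisfying, respectively, $$\|x\|_S=\max\Bigl\{\|x\|_\infty,\ \sup\Bigl\{\tfrac1{\log_2(n+1)}\sum_{i=1}^n\|E_ix\|_S:\ n\ge2,\ E_1<\dots<E_n\Bigr\}\Bigr\},$$ $$\|x\|_T=\max\Bigl\{\|x\|_\infty,\ \tfrac12\sup\Bigl\{\sum_{i=1}^n\|E_ix\|_T:\ n\in\mathbb N,\ n\le E_1<\dots<E_n\Bigr\}\Bigr\},$$ where the $E_i$ are finite subsets of $\mathbb N$ and $Ex$ is the restriction of $x$ to $E$. Both carry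 the unit vector basis. Then, with respect to these bases: 1. $AD(S)=2$; 2. $D_t(T)=2$ for every real $t$ with $1<t<2$. -/

import Mathlib

open scoped Ordinal

namespace DistortionIndex

/-! ### Finite sets and Schreier families

The set of natural numbers is `{1, 2, 3, …}`, that is, `ℕ+`. -/

/-- A (finite or infinite) sequence of finite sets with `E i < E j` whenever `i < j`. The empty set
may occur; it precedes and follows every set. -/
def Successive {ι : Type*} [LT ι] (E : ι → Finset ℕ+) : Prop :=
  ∀ i j, i < j → ∀ a ∈ E i, ∀ b ∈ E j, a < b

/-- The family `𝓕[𝓖]` of all unions `E₁ ∪ ⋯ ∪ Eₙ`, where `E₁ < ⋯ < Eₙ` are non-empty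
members of `𝓖` and `{min E₁, …, min Eₙ} ∈ 𝓕`. -/
def compFamily (F G : Set (Finset ℕ+)) : Set (Finset ℕ+) :=
  {A | ∃ (n : ℕ) (E : Fin n → Finset ℕ+) (hE : ∀ i, (E i).Nonempty),
    Successive E ∧ (∀ i, E i ∈ G) ∧
    Finset.univ.image (fun i => (E i).min' (hE i)) ∈ F ∧ A = Finset.univ.biUnion E}

/-- `𝓢₀`: the empty set and the singletons. -/
def schreierZero : Set (Finset ℕ+) := {E | E = ∅ ∨ ∃ n, E = {n}}

/-- `𝓢₁ = {E : |E| ≤ min E}` (which contains the empty set). -/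
def schreierOne : Set (Finset ℕ+) := {E | ∀ m ∈ E, E.card ≤ (m : ℕ)}

/-- A choice, for every countable limit ordinal `ξ`, of a sequence `ξ₁ < ξ₂ < ⋯` with
supremum `ξ`. -/
structure LimitApproximation where
  seq : Ordinal.{0} → ℕ+ → Ordinal.{0}
  strictMono : ∀ ξ, Order.IsSuccLimit ξ → ξ < ω₁ → StrictMono (seq ξ)
  isLUB : ∀ ξ, Order.IsSuccLimit ξ → ξ < ω₁ → IsLUB (Set.range (seq ξ)) ξ

/-- The Schreier families `𝓢_ξ`, `ξ < ω₁`, built with the approximating sequences `c`: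
`𝓢_{ξ+1} = 𝓢₁[𝓢_ξ]`, and for a limit ordinal `ξ`, `E ∈ 𝓢_ξ` iff `E ∈ 𝓢_{ξₙ}`
for some `n ≤ E`. -/
noncomputable def schreier (c : LimitApproximation) (ξ : Ordinal.{0}) : Set (Finset ℕ+) :=
  Ordinal.limitRecOn ξ schreierZero
    (fun _ S => compFamily schreierOne S)
    (fun ξ _ S => {E | ∃ n : ℕ+, (∀ m ∈ E, n ≤ m) ∧ ∃ h : c.seq ξ n < ξ, E ∈ S (c.seq ξ n) h})

/-- The recursion gives `𝓢₁` its usual value. -/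
theorem schreier_one (c : LimitApproximation) : schreier c 1 = schreierOne := by
  have h : schreier c 1 = compFamily schreierOne schreierZero := by
    have := Ordinal.limitRecOn_add_one (motive := fun _ => Set (Finset ℕ+)) 0 schreierZero
      (fun _ S => compFamily schreierOne S)
      (fun ξ _ S => {E | ∃ n : ℕ+, (∀ m ∈ E, n ≤ m) ∧ ∃ h : c.seq ξ n < ξ, E ∈ S (c.seq ξ n) h})
    rw [Ordinal.limitRecOn_zero, zero_add] at this
    exact this
  rw [h]
  ext A
  constructor
  · rintro ⟨n, E, hE, -, hG, hF, rfl⟩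
    have : Finset.univ.biUnion E = Finset.univ.image (fun i => (E i).min' (hE i)) := by
      ext a
      simp only [Finset.mem_biUnion, Finset.mem_univ, true_and, Finset.mem_image]
      refine exists_congr fun i => ?_
      rcases hG i with h0 | ⟨k, hk⟩
      · exact absurd h0 (hE i).ne_empty
      · simp [hk, eq_comm (a := a)]
    rw [this]; exact hF
  · intro hA
    have hU : Finset.univ.biUnion (fun i => ({A.orderEmbOfFin rfl i} : Finset ℕ+)) = A := by
      ext a
      have h1 : a ∈ A ↔ a ∈ Set.range (A.orderEmbOfFin rfl) := by
        rw [Finset.range_orderEmbOfFin, Finset.mem_coe]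
      refine Iff.trans ?_ h1.symm
      simp only [Finset.mem_biUnion, Finset.mem_univ, true_and, Finset.mem_singleton, Set.mem_range]
      exact exists_congr fun i => eq_comm
    refine ⟨A.card, fun i => {A.orderEmbOfFin rfl i}, fun i => by simp, ?_, ?_, ?_, hU.symm⟩
    · intro i j hij a ha b hb
      rw [Finset.mem_singleton] at ha hb
      subst ha hb
      exact (A.orderEmbOfFin rfl).strictMono hij
    · intro i; exact Or.inr ⟨_, rfl⟩
    · have : Finset.univ.image (fun i => ({A.orderEmbOfFin rfl i} : Finset ℕ+).min' (by simp))
          = A := by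
        refine Eq.trans ?_ hU
        ext a
        simp only [Finset.mem_biUnion, Finset.mem_univ, true_and, Finset.mem_singleton,
          Finset.mem_image, Finset.min'_singleton]
        exact exists_congr fun i => eq_comm
      rw [this]; exact hA

/-- Approximating sequences exist. -/
theorem LimitApproximation.nonempty : Nonempty LimitApproximation := by
  have key : ∀ ξ : Ordinal.{0}, ∃ f : ℕ+ → Ordinal.{0}, Order.IsSuccLimit ξ → ξ < ω₁ →
      StrictMono f ∧ IsLUB (Set.range f) ξ := by
    intro ξ
    by_cases h : Order.IsSuccLimit ξ ∧ ξ < ω₁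
    swap
    · exact ⟨fun _ => 0, fun h1 h2 => absurd ⟨h1, h2⟩ h⟩
    obtain ⟨h1, h2⟩ := h
    have hc : Countable (Set.Iio ξ) := by
      rw [← Cardinal.mk_le_aleph0_iff, Cardinal.mk_Iio_ordinal]
      have : ξ.card < Cardinal.aleph 1 := by
        rwa [← Cardinal.lt_ord, Cardinal.ord_aleph]
      rw [← Cardinal.succ_aleph0, Order.lt_succ_iff] at this
      exact Cardinal.lift_le_aleph0.2 this
    have hne : Nonempty (Set.Iio ξ) := ⟨⟨0, h1.bot_lt⟩⟩
    have hnm : NoMaxOrder (Set.Iio ξ) :=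
      ⟨fun a => ⟨⟨Order.succ a.1, h1.succ_lt a.2⟩, Order.lt_succ a.1⟩⟩
    obtain ⟨g, hg⟩ := exists_surjective_nat (Set.Iio ξ)
    have hs : ∀ a b : Set.Iio ξ, ∃ d : Set.Iio ξ, a < d ∧ b < d := fun a b => by
      obtain ⟨d, hd⟩ := exists_gt (max a b)
      exact ⟨d, (le_max_left _ _).trans_lt hd, (le_max_right _ _).trans_lt hd⟩
    choose s hs1 hs2 using hs
    let f : ℕ → Set.Iio ξ := fun n => Nat.rec (g 0) (fun k a => s a (g k)) n
    have hf : StrictMono f := strictMono_nat_of_lt_succ fun n => hs1 (f n) (g n)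
    have hfg : ∀ n, g n < f (n + 1) := fun n => hs2 (f n) (g n)
    refine ⟨fun n : ℕ+ => (f (n : ℕ)).1, fun _ _ => ⟨fun a b hab => hf hab, ?_, ?_⟩⟩
    · rintro _ ⟨n, rfl⟩; exact le_of_lt (f n).2
    · intro u hu
      by_contra hlt
      obtain ⟨n, hn⟩ := hg ⟨u, not_le.1 hlt⟩
      have h3 := hfg n
      rw [hn] at h3
      exact absurd (hu ⟨n.succPNat, rfl⟩) (not_le.2 h3)
  choose f hf using key
  exact ⟨⟨f, fun ξ h1 h2 => (hf ξ h1 h2).1, fun ξ h1 h2 => (hf ξ h1 h2).2⟩⟩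

/-! ### Distortion indices of a Banach space with a Schauder basis -/

/-- A Schauder basis `e₁, e₂, …` of a real normed space. -/
abbrev Basis (X : Type*) [NormedAddCommGroup X] [NormedSpace ℝ X] :=
  GeneralSchauderBasis ℕ+ ℝ X (SummationFilter.conditional ℕ+)

section Indices

variable {X : Type*} [NormedAddCommGroup X] [NormedSpace ℝ X]

/-- `x₁ < x₂ < ⋯` is a normalized block sequence of the basis `e`. -/
def IsNormalizedBlock (e : Basis X) (x : ℕ+ → X) : Prop :=
  ∃ a : ℕ+ → ℕ+ →₀ ℝ, Successive (fun i => (a i).support) ∧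
    ∀ i, x i = (a i).sum (fun j r => r • e j) ∧ ‖x i‖ = 1

/-- `p` is an equivalent norm on `X`. -/
def IsEquivalentNorm (p : Seminorm ℝ X) : Prop :=
  ∃ m M : ℝ, 0 < m ∧ 0 < M ∧ ∀ x, m * ‖x‖ ≤ p x ∧ p x ≤ M * ‖x‖

/-- `p` is a `t`-`𝓕` distortion of `X` (with basis `e`). -/
def IsDistortion (e : Basis X) (F : Set (Finset ℕ+)) (t : ℝ) (p : Seminorm ℝ X) : Prop :=
  IsEquivalentNorm p ∧ ∀ x : ℕ+ → X, IsNormalizedBlock e x →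
    ∃ E ∈ F, ∃ u ∈ Submodule.span ℝ (x '' (E : Set ℕ+)), ∃ v ∈ Submodule.span ℝ (x '' (E : Set ℕ+)),
      ‖u‖ = 1 ∧ ‖v‖ = 1 ∧ t < p u / p v

/-- `X` is `t`-`𝓕` distortable. -/
def Distortable (e : Basis X) (F : Set (Finset ℕ+)) (t : ℝ) : Prop :=
  ∃ p : Seminorm ℝ X, IsDistortion e F t p

/-- `X` is `𝓕` arbitrarily distortable. -/
def ArbitrarilyDistortable (e : Basis X) (F : Set (Finset ℕ+)) : Prop :=
  ∀ t : ℝ, 1 ≤ t → Distortable e F t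

open Classical in
/-- The least countable ordinal with property `P` if there is one, and `ω₁` otherwise. -/
noncomputable def leastCountable (P : Ordinal.{0} → Prop) : Ordinal.{0} :=
  if ∃ ξ < ω₁, P ξ then sInf {ξ | ξ < ω₁ ∧ P ξ} else ω₁

/-- The index `D_t(X)`. -/
noncomputable def indexD (c : LimitApproximation) (t : ℝ) (e : Basis X) : Ordinal.{0} :=
  leastCountable fun ξ => Distortable e (schreier c ξ) t

/-- The index `AD(X)`. -/
noncomputable def indexAD (c : LimitApproximation) (e : Basis X) : Ordinal.{0} :=
  leastCountable fun ξ => ArbitrarilyDistortable e (schreier c ξ)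

end Indices

/-! ### Tsirelson type spaces -/

/-- The restriction `E x` of `x ∈ c₀₀` to the set `E`. -/
noncomputable def restrict (E : Finset ℕ+) (x : ℕ+ →₀ ℝ) : ℕ+ →₀ ℝ := x.filter (· ∈ E)

/-- The data of an implicitly defined norm
`‖x‖ = max {‖x‖_∞, sup {θ n * ∑ i < n, ‖E i x‖ : E 0 < ⋯ < E (n-1) admissible}}`. -/
structure TsirelsonData where
  /-- which successive sequences of `n` finite sets are admissible -/
  adm : ∀ n : ℕ, (Fin n → Finset ℕ+) → Prop
  /-- the weight `θ n` -/
  weight : ℕ → ℝ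
  weight_nonneg : ∀ n, 0 ≤ weight n
  weight_le_one : ∀ n, weight n ≤ 1

/-- The admissible successive sequences of finite sets. -/
structure AdmissibleFamily (D : TsirelsonData) where
  n : ℕ
  set : Fin n → Finset ℕ+
  successive : Successive set
  adm : D.adm n set

/-- The increasing sequence of norms
`‖x‖₀ = max |x i|`, `‖x‖_{m+1} = max {‖x‖_m, sup θ n * ∑ i < n, ‖E i x‖_m}`
(the supremum over the admissible families `E 0 < ⋯ < E (n-1)`) on `c₀₀`. -/
noncomputable def iterNorm (D : TsirelsonData) : ℕ → (ℕ+ →₀ ℝ) → ℝ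
  | 0, x => ⨆ i, |x i|
  | m + 1, x => max (iterNorm D m x)
      (⨆ F : AdmissibleFamily D, D.weight F.n * ∑ i, iterNorm D m (restrict (F.set i) x))

/-- The norm `sup_m ‖x‖_m` on `c₀₀`. -/
noncomputable def tsirelsonNorm (D : TsirelsonData) (x : ℕ+ →₀ ℝ) : ℝ := ⨆ m, iterNorm D m x

section NormAxioms

variable (D : TsirelsonData)

theorem restrict_add (E : Finset ℕ+) (x y : ℕ+ →₀ ℝ) :
    restrict E (x + y) = restrict E x + restrict E y := Finsupp.filter_add

theorem restrict_smul (E : Finset ℕ+) (r : ℝ) (x : ℕ+ →₀ ℝ) :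
    restrict E (r • x) = r • restrict E x := Finsupp.filter_smul

theorem restrict_apply (E : Finset ℕ+) (x : ℕ+ →₀ ℝ) (i : ℕ+) :
    restrict E x i = if i ∈ E then x i else 0 := Finsupp.filter_apply ..

theorem restrict_comm (E F : Finset ℕ+) (x : ℕ+ →₀ ℝ) :
    restrict E (restrict F x) = restrict F (restrict E x) := by
  ext i; simp only [restrict_apply]; split_ifs <;> rfl

/-- The `ℓ₁` norm, the upper bound that makes the suprema finite. -/
noncomputable def ellOne (x : ℕ+ →₀ ℝ) : ℝ := ∑ i ∈ x.support, |x i|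

theorem ellOne_nonneg (x : ℕ+ →₀ ℝ) : 0 ≤ ellOne x := Finset.sum_nonneg fun _ _ => abs_nonneg _

theorem ellOne_restrict (E : Finset ℕ+) (x : ℕ+ →₀ ℝ) :
    ellOne (restrict E x) = ∑ i ∈ x.support, if i ∈ E then |x i| else 0 := by
  unfold ellOne
  rw [Finset.sum_subset (s₂ := x.support)]
  · refine Finset.sum_congr rfl fun i _ => ?_
    rw [restrict_apply]; split_ifs <;> simp
  · exact Finsupp.support_filter (· ∈ E) x ▸ Finset.filter_subset _ _
  · intro i _ hi; simpa using hi

theorem sum_ellOne_restrict_le {n : ℕ} (E : Fin n → Finset ℕ+) (hE : Successive E)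
    (x : ℕ+ →₀ ℝ) : ∑ i, ellOne (restrict (E i) x) ≤ ellOne x := by
  simp only [ellOne_restrict]
  rw [Finset.sum_comm]
  refine Finset.sum_le_sum fun k _ => ?_
  by_cases h : ∃ i, k ∈ E i
  · obtain ⟨i, hi⟩ := h
    rw [Finset.sum_eq_single i]
    · simp [hi]
    · intro j _ hji
      rw [if_neg]
      intro hj
      rcases lt_or_gt_of_ne hji with h | h
      · exact lt_irrefl _ (hE j i h k hj k hi)
      · exact lt_irrefl _ (hE i j h k hi k hj)
    · simp
  · push Not at h
    simp [h]

theorem iterNorm_bounds (m : ℕ) : ∀ x, 0 ≤ iterNorm D m x ∧ iterNorm D m x ≤ ellOne x := by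
  induction m with
  | zero =>
    intro x
    refine ⟨Real.iSup_nonneg fun _ => abs_nonneg _, Real.iSup_le (fun i => ?_) (ellOne_nonneg x)⟩
    by_cases hi : i ∈ x.support
    · exact Finset.single_le_sum (f := fun i => |x i|) (fun _ _ => abs_nonneg _) hi
    · rw [Finsupp.notMem_support_iff.1 hi, abs_zero]; exact ellOne_nonneg x
  | succ m ih =>
    intro x
    refine ⟨le_max_of_le_left (ih x).1, max_le (ih x).2 (Real.iSup_le (fun F => ?_)
      (ellOne_nonneg x))⟩
    have h0 : 0 ≤ ∑ i, iterNorm D m (restrict (F.set i) x) :=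
      Finset.sum_nonneg fun i _ => (ih _).1
    calc _ ≤ 1 * ∑ i, iterNorm D m (restrict (F.set i) x) :=
          mul_le_mul_of_nonneg_right (D.weight_le_one _) h0
      _ ≤ ∑ i, ellOne (restrict (F.set i) x) := by
          rw [one_mul]; exact Finset.sum_le_sum fun i _ => (ih _).2
      _ ≤ _ := sum_ellOne_restrict_le _ F.successive x

theorem bddAbove_abs (x : ℕ+ →₀ ℝ) : BddAbove (Set.range fun i => |x i|) := by
  refine ⟨ellOne x, ?_⟩
  rintro _ ⟨i, rfl⟩
  by_cases hi : i ∈ x.support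
  · exact Finset.single_le_sum (f := fun i => |x i|) (fun _ _ => abs_nonneg _) hi
  · simp only [Finsupp.notMem_support_iff.1 hi, abs_zero]; exact ellOne_nonneg x

theorem bddAbove_step (m : ℕ) (x : ℕ+ →₀ ℝ) : BddAbove (Set.range fun F : AdmissibleFamily D =>
    D.weight F.n * ∑ i, iterNorm D m (restrict (F.set i) x)) := by
  refine ⟨ellOne x, ?_⟩
  rintro _ ⟨F, rfl⟩
  have h0 : 0 ≤ ∑ i, iterNorm D m (restrict (F.set i) x) :=
    Finset.sum_nonneg fun i _ => (iterNorm_bounds D m _).1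
  calc _ ≤ 1 * ∑ i, iterNorm D m (restrict (F.set i) x) :=
        mul_le_mul_of_nonneg_right (D.weight_le_one _) h0
    _ ≤ ∑ i, ellOne (restrict (F.set i) x) := by
        rw [one_mul]; exact Finset.sum_le_sum fun i _ => (iterNorm_bounds D m _).2
    _ ≤ _ := sum_ellOne_restrict_le _ F.successive x

theorem step_le (m : ℕ) (x : ℕ+ →₀ ℝ) (F : AdmissibleFamily D) :
    D.weight F.n * ∑ i, iterNorm D m (restrict (F.set i) x) ≤ iterNorm D (m + 1) x :=
  le_max_of_le_right (le_ciSup (bddAbove_step D m x) F)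

theorem bddAbove_iterNorm (x : ℕ+ →₀ ℝ) : BddAbove (Set.range fun m => iterNorm D m x) :=
  ⟨ellOne x, by rintro _ ⟨m, rfl⟩; exact (iterNorm_bounds D m x).2⟩

theorem iterNorm_le (m : ℕ) (x : ℕ+ →₀ ℝ) : iterNorm D m x ≤ tsirelsonNorm D x :=
  le_ciSup (bddAbove_iterNorm D x) m

theorem tsirelsonNorm_nonneg (x : ℕ+ →₀ ℝ) : 0 ≤ tsirelsonNorm D x :=
  (iterNorm_bounds D 0 x).1.trans (iterNorm_le D 0 x)

theorem abs_le_tsirelsonNorm (x : ℕ+ →₀ ℝ) (i : ℕ+) : |x i| ≤ tsirelsonNorm D x :=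
  (le_ciSup (bddAbove_abs x) i).trans (iterNorm_le D 0 x)

theorem iterNorm_add_le (m : ℕ) : ∀ x y,
    iterNorm D m (x + y) ≤ iterNorm D m x + iterNorm D m y := by
  induction m with
  | zero =>
    intro x y
    refine Real.iSup_le (fun i => ?_)
      (add_nonneg (iterNorm_bounds D 0 x).1 (iterNorm_bounds D 0 y).1)
    exact (abs_add_le _ _).trans (add_le_add (le_ciSup (bddAbove_abs x) i)
      (le_ciSup (bddAbove_abs y) i))
  | succ m ih =>
    intro x y
    refine max_le ((ih x y).trans (add_le_add (le_max_left _ _) (le_max_left _ _)))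
      (Real.iSup_le (fun F => ?_)
        (add_nonneg (iterNorm_bounds D (m + 1) x).1 (iterNorm_bounds D (m + 1) y).1))
    refine le_trans ?_ (add_le_add (step_le D m x F) (step_le D m y F))
    rw [← mul_add, ← Finset.sum_add_distrib]
    refine mul_le_mul_of_nonneg_left (Finset.sum_le_sum fun i _ => ?_) (D.weight_nonneg _)
    rw [restrict_add]; exact ih _ _

theorem iterNorm_smul_le (r : ℝ) (m : ℕ) : ∀ x,
    iterNorm D m (r • x) ≤ |r| * iterNorm D m x := by
  induction m with
  | zero =>
    intro x
    refine Real.iSup_le (fun i => ?_) (mul_nonneg (abs_nonneg r) (iterNorm_bounds D 0 x).1)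
    rw [Finsupp.smul_apply, smul_eq_mul, abs_mul]
    exact mul_le_mul_of_nonneg_left (le_ciSup (bddAbove_abs x) i) (abs_nonneg r)
  | succ m ih =>
    intro x
    refine max_le ((ih x).trans (mul_le_mul_of_nonneg_left (le_max_left _ _) (abs_nonneg r)))
      (Real.iSup_le (fun F => ?_) (mul_nonneg (abs_nonneg r) (iterNorm_bounds D (m + 1) x).1))
    refine le_trans ?_ (mul_le_mul_of_nonneg_left (step_le D m x F) (abs_nonneg r))
    rw [mul_left_comm]
    refine mul_le_mul_of_nonneg_left ?_ (D.weight_nonneg _)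
    rw [Finset.mul_sum]
    refine Finset.sum_le_sum fun i _ => ?_
    rw [restrict_smul]; exact ih _

theorem iterNorm_restrict_le (E : Finset ℕ+) (m : ℕ) : ∀ x,
    iterNorm D m (restrict E x) ≤ iterNorm D m x := by
  induction m with
  | zero =>
    intro x
    refine Real.iSup_le (fun i => ?_) (iterNorm_bounds D 0 x).1
    refine le_trans ?_ (le_ciSup (bddAbove_abs x) i)
    rw [restrict_apply]; split_ifs <;> simp
  | succ m ih =>
    intro x
    refine max_le ((ih x).trans (le_max_left _ _))
      (Real.iSup_le (fun F => ?_) (iterNorm_bounds D (m + 1) x).1)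
    refine le_trans ?_ (step_le D m x F)
    refine mul_le_mul_of_nonneg_left (Finset.sum_le_sum fun i _ => ?_) (D.weight_nonneg _)
    rw [restrict_comm]; exact ih _

theorem tsirelsonNorm_add_le (x y : ℕ+ →₀ ℝ) :
    tsirelsonNorm D (x + y) ≤ tsirelsonNorm D x + tsirelsonNorm D y :=
  ciSup_le fun m => (iterNorm_add_le D m x y).trans
    (add_le_add (iterNorm_le D m x) (iterNorm_le D m y))

theorem tsirelsonNorm_smul_le (r : ℝ) (x : ℕ+ →₀ ℝ) :
    tsirelsonNorm D (r • x) ≤ |r| * tsirelsonNorm D x :=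
  ciSup_le fun m => (iterNorm_smul_le D r m x).trans
    (mul_le_mul_of_nonneg_left (iterNorm_le D m x) (abs_nonneg r))

theorem tsirelsonNorm_restrict_le (E : Finset ℕ+) (x : ℕ+ →₀ ℝ) :
    tsirelsonNorm D (restrict E x) ≤ tsirelsonNorm D x :=
  ciSup_le fun m => (iterNorm_restrict_le D E m x).trans (iterNorm_le D m x)

theorem tsirelsonNorm_smul (r : ℝ) (x : ℕ+ →₀ ℝ) :
    tsirelsonNorm D (r • x) = |r| * tsirelsonNorm D x := by
  refine le_antisymm (tsirelsonNorm_smul_le D r x) ?_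
  rcases eq_or_ne r 0 with rfl | hr
  · simpa using tsirelsonNorm_nonneg D _
  · have h := tsirelsonNorm_smul_le D r⁻¹ (r • x)
    rw [inv_smul_smul₀ hr, abs_inv] at h
    have h' := mul_le_mul_of_nonneg_left h (abs_nonneg r)
    rwa [mul_inv_cancel_left₀ (abs_ne_zero.2 hr)] at h'

/-- The norm satisfies the implicit equation that determines it. -/
theorem tsirelsonNorm_eq (x : ℕ+ →₀ ℝ) :
    tsirelsonNorm D x = max (⨆ i, |x i|)
      (⨆ F : AdmissibleFamily D, D.weight F.n * ∑ i, tsirelsonNorm D (restrict (F.set i) x)) := by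
  have hm : ∀ m, iterNorm D m x ≤ iterNorm D (m + 1) x := fun m => le_max_left _ _
  have hbd : BddAbove (Set.range fun F : AdmissibleFamily D =>
      D.weight F.n * ∑ i, tsirelsonNorm D (restrict (F.set i) x)) := by
    refine ⟨ellOne x, ?_⟩
    rintro _ ⟨F, rfl⟩
    have hle : ∀ y, tsirelsonNorm D y ≤ ellOne y := fun y => ciSup_le fun m =>
      (iterNorm_bounds D m y).2
    have h0 : 0 ≤ ∑ i, tsirelsonNorm D (restrict (F.set i) x) :=
      Finset.sum_nonneg fun i _ => tsirelsonNorm_nonneg D _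
    calc _ ≤ 1 * ∑ i, tsirelsonNorm D (restrict (F.set i) x) :=
          mul_le_mul_of_nonneg_right (D.weight_le_one _) h0
      _ ≤ ∑ i, ellOne (restrict (F.set i) x) := by
          rw [one_mul]; exact Finset.sum_le_sum fun i _ => hle _
      _ ≤ _ := sum_ellOne_restrict_le _ F.successive x
  apply le_antisymm
  · refine ciSup_le fun m => ?_
    induction m with
    | zero => exact le_max_left _ _
    | succ m ih =>
      refine max_le ih (Real.iSup_le (fun F => ?_)
        (le_max_of_le_left (Real.iSup_nonneg fun _ => abs_nonneg _)))
      refine le_max_of_le_right (le_trans ?_ (le_ciSup hbd F))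
      exact mul_le_mul_of_nonneg_left (Finset.sum_le_sum fun i _ => iterNorm_le D m _)
        (D.weight_nonneg _)
  · refine max_le (iterNorm_le D 0 x) (Real.iSup_le (fun F => ?_) (tsirelsonNorm_nonneg D x))
    have ht : ∀ y, Filter.Tendsto (fun m => iterNorm D m y) Filter.atTop
        (nhds (tsirelsonNorm D y)) := fun y =>
      tendsto_atTop_ciSup (monotone_nat_of_le_succ fun m => le_max_left _ _) (bddAbove_iterNorm D y)
    refine le_of_tendsto ((tendsto_finsetSum Finset.univ fun i _ =>
      ht (restrict (F.set i) x)).const_mul (D.weight F.n)) (Filter.Eventually.of_forall fun m => ?_)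
    exact (step_le D m x F).trans (iterNorm_le D (m + 1) x)

end NormAxioms

/-- The vector space `c₀₀` with the norm `tsirelsonNorm D`. -/
def PreSpace (_ : TsirelsonData) : Type := ℕ+ →₀ ℝ

noncomputable instance (D : TsirelsonData) : AddCommGroup (PreSpace D) :=
  inferInstanceAs (AddCommGroup (ℕ+ →₀ ℝ))

noncomputable instance (D : TsirelsonData) : Module ℝ (PreSpace D) :=
  inferInstanceAs (Module ℝ (ℕ+ →₀ ℝ))

noncomputable instance (D : TsirelsonData) : Norm (PreSpace D) := ⟨tsirelsonNorm D⟩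

theorem preSpace_core (D : TsirelsonData) : NormedSpace.Core ℝ (PreSpace D) where
  norm_nonneg := tsirelsonNorm_nonneg D
  norm_smul := tsirelsonNorm_smul D
  norm_triangle := tsirelsonNorm_add_le D
  norm_eq_zero_iff x := by
    constructor
    · intro h
      refine Finsupp.ext fun i => ?_
      have h1 := abs_le_tsirelsonNorm D x i
      have h2 : tsirelsonNorm D x = 0 := h
      rw [h2] at h1
      exact abs_nonpos_iff.1 h1
    · rintro rfl
      have := tsirelsonNorm_smul D 0 0
      rw [zero_smul, abs_zero, zero_mul] at this
      exact this

noncomputable instance (D : TsirelsonData) : NormedAddCommGroup (PreSpace D) :=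
  NormedAddCommGroup.ofCore (preSpace_core D)

noncomputable instance (D : TsirelsonData) : NormedSpace ℝ (PreSpace D) :=
  NormedSpace.ofCore (preSpace_core D)

/-- The Banach space determined by `D`: the completion of `(c₀₀, tsirelsonNorm D)`. -/
abbrev TsirelsonSpace (D : TsirelsonData) : Type := UniformSpace.Completion (PreSpace D)

/-- An element of `c₀₀`, seen as an element of `PreSpace D`. -/
def toPre (D : TsirelsonData) (x : ℕ+ →₀ ℝ) : PreSpace D := x

/-- An element of `PreSpace D`, seen as an element of `c₀₀`. -/
def ofPre (D : TsirelsonData) (x : PreSpace D) : ℕ+ →₀ ℝ := x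

/-- The unit vectors of `c₀₀`. -/
noncomputable def unitVector (D : TsirelsonData) (i : ℕ+) : PreSpace D :=
  toPre D (Finsupp.single i 1)

/-- The coordinate functionals on `c₀₀`. -/
noncomputable def preCoord (D : TsirelsonData) (i : ℕ+) : PreSpace D →L[ℝ] ℝ :=
  LinearMap.mkContinuous (Finsupp.lapply i : (ℕ+ →₀ ℝ) →ₗ[ℝ] ℝ) 1
    (fun x => by rw [one_mul]; exact abs_le_tsirelsonNorm D x i)

/-- The coordinate functionals on the completion. -/
noncomputable def coordFunctional (D : TsirelsonData) (i : ℕ+) : StrongDual ℝ (TsirelsonSpace D) :=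
  (preCoord D i).extend UniformSpace.Completion.toComplL

theorem coordFunctional_coe (D : TsirelsonData) (i : ℕ+) (x : PreSpace D) :
    coordFunctional D i (x : TsirelsonSpace D) = preCoord D i x :=
  ContinuousLinearMap.extend_eq (preCoord D i) UniformSpace.Completion.denseRange_coe
    (UniformSpace.Completion.isUniformInducing_coe _) x

theorem sum_preCoord (D : TsirelsonData) (A : Finset ℕ+) (x : PreSpace D) :
    ∑ i ∈ A, preCoord D i x • unitVector D i = toPre D (restrict A (ofPre D x)) := by
  have h : ∑ i ∈ A, (ofPre D x) i • (Finsupp.single i 1 : ℕ+ →₀ ℝ)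
      = restrict A (ofPre D x) := by
    ext k
    rw [Finsupp.finsetSum_apply, restrict_apply]
    simp [Finsupp.single_apply]
  exact h

/-- The unit vectors form a Schauder basis of the completion. -/
noncomputable def unitBasis (D : TsirelsonData) : Basis (TsirelsonSpace D) where
  basis i := (unitVector D i : PreSpace D)
  coord i := coordFunctional D i
  ortho i j := by
    rw [coordFunctional_coe]
    change (Finsupp.single j 1 : ℕ+ →₀ ℝ) i = _
    simp [Finsupp.single_apply, Pi.single_apply, eq_comm]
  expansion x := by
    have hsum : ∀ (A : Finset ℕ+) (y : PreSpace D),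
        ∑ i ∈ A, coordFunctional D i (y : TsirelsonSpace D) • (unitVector D i : TsirelsonSpace D)
          = toPre D (restrict A (ofPre D y)) := by
      intro A y
      rw [← sum_preCoord, ← UniformSpace.Completion.coe_toComplL (𝕜 := ℝ), map_sum]
      refine Finset.sum_congr rfl fun i _ => ?_
      rw [map_smul, UniformSpace.Completion.coe_toComplL, coordFunctional_coe]
    have hproj : ∀ (A : Finset ℕ+) (z : TsirelsonSpace D),
        ‖∑ i ∈ A, coordFunctional D i z • (unitVector D i : TsirelsonSpace D)‖ ≤ ‖z‖ := by
      intro A z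
      induction z using UniformSpace.Completion.induction_on with
      | hp => exact isClosed_le (by fun_prop) continuous_norm
      | ih y =>
        rw [hsum, UniformSpace.Completion.norm_coe, UniformSpace.Completion.norm_coe]
        exact tsirelsonNorm_restrict_le D A y
    have hun : HasSum (fun i => coordFunctional D i x • (unitVector D i : TsirelsonSpace D)) x := by
      rw [HasSum, SummationFilter.unconditional_filter, Metric.tendsto_atTop]
      intro ε hε
      obtain ⟨y, hy⟩ := UniformSpace.Completion.denseRange_coe.exists_dist_lt x (half_pos hε)
      refine ⟨(ofPre D y).support, fun A hA => ?_⟩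
      have hAy : toPre D (restrict A (ofPre D y)) = y := by
        refine Finsupp.ext fun i => ?_
        refine (restrict_apply A (ofPre D y) i).trans ?_
        split_ifs with h
        · rfl
        · exact (Finsupp.notMem_support_iff.1 fun h' => h (hA h')).symm
      have h1 := hproj A (x - y)
      simp only [map_sub, sub_smul, Finset.sum_sub_distrib, hsum, hAy] at h1
      rw [dist_eq_norm] at hy ⊢
      calc _ = ‖(∑ i ∈ A, coordFunctional D i x • (unitVector D i : TsirelsonSpace D) - y)
                - (x - y)‖ := by rw [sub_sub_sub_cancel_right]
        _ ≤ _ := norm_sub_le _ _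
        _ < ε := by linarith
    exact hun.mono_left SummationFilter.LeAtTop.le_atTop

/-! ### Schlumprecht's space and Tsirelson's space -/

/-- `‖x‖ = max {‖x‖_∞, sup (1 / log₂ (n + 1)) ∑ i < n, ‖E i x‖}`, the supremum over all `n ≥ 2`
and all finite sets `E 0 < ⋯ < E (n-1)`. -/
noncomputable def schlumprechtData : TsirelsonData where
  adm n _ := 2 ≤ n
  weight n := 1 / Real.logb 2 (n + 1)
  weight_nonneg n := div_nonneg zero_le_one
    (Real.logb_nonneg one_lt_two (by linarith [Nat.cast_nonneg (α := ℝ) n]))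
  weight_le_one n := by
    rcases Nat.eq_zero_or_pos n with rfl | hn
    · simp
    · have h1 : (1 : ℝ) ≤ n := by exact_mod_cast hn
      have h2 : (1 : ℝ) ≤ Real.logb 2 (n + 1) := by
        rw [Real.le_logb_iff_rpow_le one_lt_two (by linarith), Real.rpow_one]; linarith
      exact (div_le_one (by linarith)).2 h2

/-- `‖x‖ = max {‖x‖_∞, (1 / 2) sup ∑ i < n, ‖E i x‖}`, the supremum over all `n` and all
finite sets `n ≤ E 0 < ⋯ < E (n-1)`. -/
noncomputable def tsirelsonData : TsirelsonData where
  adm n E := ∀ i, ∀ k ∈ E i, n ≤ (k : ℕ)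
  weight _ := 1 / 2
  weight_nonneg _ := by norm_num
  weight_le_one _ := by norm_num

/-- Schlumprecht's space `S`. -/
abbrev SpaceS : Type := TsirelsonSpace schlumprechtData

/-- The unit vector basis of `S`. -/
noncomputable abbrev basisS : Basis SpaceS := unitBasis schlumprechtData

/-- The Figiel–Johnson Tsirelson space `T`. -/
abbrev SpaceT : Type := TsirelsonSpace tsirelsonData

/-- The unit vector basis of `T`. -/
noncomputable abbrev basisT : Basis SpaceT := unitBasis tsirelsonData

end DistortionIndex

/-! Both indices equal 2 for the same two reasons.

Index at least 2. Suppose a block sequence has an `ℓ₁` spreading model: on Schreier sets its norm is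
equivalent to the sum of the absolute values of the coefficients. James' argument for the
non-distortability of `ℓ₁`, applied to the norm and then to any equivalent norm, passes to further
blocks on which both norms are almost constant multiples of that sum over all Schreier sets. Hence
no equivalent norm is a `t`-`𝓢₁` distortion with `t > 1` (`exists_almost_isometric_blocks`,
`not_distortable_of_ellOneSpreading`). In `T` the unit vectors are such a sequence. In `S` it has to
be built: the `k`-th vector superposes normalised sums over equidistant grids of `m 0 ∣ m 1 ∣ ⋯ ∣ m
k` points. If the scales are sparse, a family of `n` sets can exploit essentially one scale, so the
norms on the different scales do not add up and the superposition stays bounded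
(`schlumprechtNorm_add_le_of_scales`). On the other hand `n ≤ m i` such vectors contain together `n
* m i` points of scale `i`, and `log₂ (n * m i + 1)` is at most twice `log₂ (m i + 1)`; this gives
the lower `ℓ₁` estimate (`schlumprecht_ellOneSpreading`).

Index at most 2. Every normalised block sequence has, on sufficiently long intervals, averages of
`N` successive vectors of norm at most one that still have norm at least `1 - ε` (`exists_average`).
Take `n` such averages with rapidly increasing `N`, and let `|z|` be the larger of `‖z‖` and the
supremum of `∑ i < n, ‖E i z‖` over successive `E` (`splittingNorm`). On one average with `N` much
larger than `n` this norm is at most `1 + ε`; on the sum `v` of the `n` averages it is at least `n *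
(1 - ε)`. A rapidly increasing sum behaves in the original norm as if a family of sets could act
fully on only one summand: `‖v‖` is about `n / 2` in `T` and `o(n)` in `S`. The quotients obtained
come arbitrarily close to 2 in `T` and are unbounded in `S`. The vectors used are supported on `n`
Schreier intervals lying beyond `n`, that is, on a set of `𝓢₂`. -/

namespace DistortionIndex

/-! ### Restrictions and the implicit norm equation -/

section Basics

variable (D : TsirelsonData)

theorem restrict_restrict (E F : Finset ℕ+) (x : ℕ+ →₀ ℝ) :
    restrict E (restrict F x) = restrict (E ∩ F) x := by
  ext i
  simp only [restrict_apply, Finset.mem_inter]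
  split_ifs <;> simp_all

theorem restrict_eq_self {E : Finset ℕ+} {x : ℕ+ →₀ ℝ} (h : x.support ⊆ E) :
    restrict E x = x := by
  ext i
  rw [restrict_apply]
  split_ifs with hi
  · rfl
  · exact (Finsupp.notMem_support_iff.1 fun h' => hi (h h')).symm

theorem restrict_eq_zero {E : Finset ℕ+} {x : ℕ+ →₀ ℝ} (h : Disjoint E x.support) :
    restrict E x = 0 := by
  ext i
  rw [restrict_apply]
  split_ifs with hi
  · exact Finsupp.notMem_support_iff.1 (Finset.disjoint_left.1 h hi)
  · rfl

theorem restrict_sum {ι : Type*} (E : Finset ℕ+) (s : Finset ι) (x : ι → ℕ+ →₀ ℝ) :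
    restrict E (∑ i ∈ s, x i) = ∑ i ∈ s, restrict E (x i) := by
  classical
  induction s using Finset.induction_on with
  | empty => ext i; simp [restrict_apply]
  | insert a s ha ih => rw [Finset.sum_insert ha, restrict_add, ih, Finset.sum_insert ha]

theorem tsirelsonNorm_le_ellOne (x : ℕ+ →₀ ℝ) : tsirelsonNorm D x ≤ ellOne x :=
  ciSup_le fun m => (iterNorm_bounds D m x).2

/-- The Tsirelson norm as a seminorm on `c₀₀`. -/
noncomputable def tsirelsonSeminorm : Seminorm ℝ (ℕ+ →₀ ℝ) :=
  Seminorm.of (tsirelsonNorm D) (tsirelsonNorm_add_le D) (fun r x => tsirelsonNorm_smul D r x)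

theorem tsirelsonSeminorm_apply (x : ℕ+ →₀ ℝ) : tsirelsonSeminorm D x = tsirelsonNorm D x := rfl

theorem seminorm_sum_le {V ι : Type*} [AddCommGroup V] [Module ℝ V] (p : Seminorm ℝ V)
    (s : Finset ι) (x : ι → V) : p (∑ i ∈ s, x i) ≤ ∑ i ∈ s, p (x i) := by
  classical
  induction s using Finset.induction_on with
  | empty => simp
  | insert a s ha ih =>
    rw [Finset.sum_insert ha, Finset.sum_insert ha]
    exact (map_add_le_add p _ _).trans (add_le_add le_rfl ih)

theorem tsirelsonNorm_sum_le {ι : Type*} (s : Finset ι) (x : ι → ℕ+ →₀ ℝ) :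
    tsirelsonNorm D (∑ i ∈ s, x i) ≤ ∑ i ∈ s, tsirelsonNorm D (x i) :=
  seminorm_sum_le (tsirelsonSeminorm D) s x

theorem tsirelsonNorm_zero : tsirelsonNorm D 0 = 0 := map_zero (tsirelsonSeminorm D)

theorem sum_tsirelsonNorm_restrict_le_ellOne {n : ℕ} (E : Fin n → Finset ℕ+) (hE : Successive E)
    (x : ℕ+ →₀ ℝ) :
    ∑ i, tsirelsonNorm D (restrict (E i) x) ≤ ellOne x :=
  (Finset.sum_le_sum fun _ _ => tsirelsonNorm_le_ellOne D _).trans (sum_ellOne_restrict_le E hE x)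

/-- An admissible family gives a lower bound for the norm. -/
theorem le_tsirelsonNorm {n : ℕ} (E : Fin n → Finset ℕ+) (hE : Successive E) (h : D.adm n E)
    (x : ℕ+ →₀ ℝ) :
    D.weight n * ∑ i, tsirelsonNorm D (restrict (E i) x) ≤ tsirelsonNorm D x := by
  rw [tsirelsonNorm_eq D x]
  refine le_max_of_le_right (le_ciSup (f := fun F : AdmissibleFamily D =>
    D.weight F.n * ∑ i, tsirelsonNorm D (restrict (F.set i) x)) ?_ ⟨n, E, hE, h⟩)
  refine ⟨ellOne x, ?_⟩
  rintro _ ⟨F, rfl⟩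
  calc _ ≤ 1 * ∑ i, tsirelsonNorm D (restrict (F.set i) x) :=
        mul_le_mul_of_nonneg_right (D.weight_le_one _)
          (Finset.sum_nonneg fun i _ => tsirelsonNorm_nonneg D _)
    _ ≤ _ := by rw [one_mul]; exact sum_tsirelsonNorm_restrict_le_ellOne D F.set F.successive x

/-- An upper bound for all admissible families bounds the norm. -/
theorem tsirelsonNorm_le_of {x : ℕ+ →₀ ℝ} {b : ℝ} (h0 : ∀ i, |x i| ≤ b)
    (h : ∀ (n : ℕ) (E : Fin n → Finset ℕ+), Successive E → D.adm n E →
      D.weight n * ∑ i, tsirelsonNorm D (restrict (E i) x) ≤ b) :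
    tsirelsonNorm D x ≤ b := by
  have hb : 0 ≤ b := (abs_nonneg _).trans (h0 1)
  rw [tsirelsonNorm_eq D x]
  exact max_le (Real.iSup_le h0 hb) (Real.iSup_le (fun F => h F.n F.set F.successive F.adm) hb)

/-- A bound compatible with the implicit equation bounds the norm. -/
theorem tsirelsonNorm_restrict_le_of_step (x : ℕ+ →₀ ℝ) (g : Finset ℕ+ → ℝ)
    (h0 : ∀ E i, |restrict E x i| ≤ g E)
    (h : ∀ (A : Finset ℕ+) (n : ℕ) (E : Fin n → Finset ℕ+), Successive E → D.adm n E →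
      D.weight n * ∑ i, g (E i ∩ A) ≤ g A) (A : Finset ℕ+) :
    tsirelsonNorm D (restrict A x) ≤ g A := by
  refine ciSup_le fun m => ?_
  have hg : ∀ A, 0 ≤ g A := fun A => (abs_nonneg _).trans (h0 A 1)
  induction m generalizing A with
  | zero => exact Real.iSup_le (h0 A) (hg A)
  | succ m ih =>
    refine max_le (ih A) (Real.iSup_le (fun F => ?_) (hg A))
    refine le_trans (mul_le_mul_of_nonneg_left (Finset.sum_le_sum fun i _ => ?_)
      (D.weight_nonneg _)) (h A F.n F.set F.successive F.adm)
    rw [restrict_restrict]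
    exact ih _

/-- This allows a family of sets to be tested on each summand separately. -/
theorem sum_family_sum_le {ι : Type*} (s : Finset ι) (x : ι → ℕ+ →₀ ℝ) {n : ℕ}
    (E : Fin n → Finset ℕ+) :
    ∑ r, tsirelsonNorm D (restrict (E r) (∑ i ∈ s, x i))
      ≤ ∑ i ∈ s, ∑ r, tsirelsonNorm D (restrict (E r) (x i)) := by
  rw [Finset.sum_comm]
  refine Finset.sum_le_sum fun r _ => ?_
  rw [restrict_sum]
  exact tsirelsonNorm_sum_le D s _

theorem successive_eq_of_mem {ι : Type*} [LinearOrder ι] {E : ι → Finset ℕ+} (hE : Successive E)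
    {i j : ι} {a : ℕ+} (hi : a ∈ E i) (hj : a ∈ E j) : i = j := by
  rcases lt_trichotomy i j with h | h | h
  · exact absurd (hE i j h a hi a hj) (lt_irrefl _)
  · exact h
  · exact absurd (hE j i h a hj a hi) (lt_irrefl _)

/-- On a sum of successive vectors each coordinate comes from one of them. -/
theorem abs_sum_apply_le {ι : Type*} [LinearOrder ι] {x : ι → ℕ+ →₀ ℝ}
    (hx : Successive fun i => (x i).support) (s : Finset ι) {b : ℝ} (hb : 0 ≤ b)
    (h : ∀ i ∈ s, ∀ k, |x i k| ≤ b) (k : ℕ+) : |(∑ i ∈ s, x i) k| ≤ b := by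
  rw [Finsupp.finsetSum_apply]
  by_cases hk : ∃ i ∈ s, x i k ≠ 0
  · obtain ⟨i, hi, hik⟩ := hk
    rw [Finset.sum_eq_single_of_mem i hi]
    · exact h i hi k
    · intro j _ hji
      by_contra hjk
      exact hji (successive_eq_of_mem hx (Finsupp.mem_support_iff.2 hjk)
        (Finsupp.mem_support_iff.2 hik))
  · push Not at hk
    rw [Finset.sum_eq_zero hk, abs_zero]
    exact hb

/-- Restricting a sum of successive vectors to the support of one of them. -/
theorem restrict_support_sum {ι : Type*} [LinearOrder ι] {x : ι → ℕ+ →₀ ℝ}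
    (hx : Successive fun i => (x i).support) {s : Finset ι} {i : ι} (hi : i ∈ s) :
    restrict (x i).support (∑ j ∈ s, x j) = x i := by
  rw [restrict_sum, Finset.sum_eq_single_of_mem i hi]
  · exact restrict_eq_self subset_rfl
  · intro j _ hji
    refine restrict_eq_zero (Finset.disjoint_left.2 fun a hai haj => hji ?_)
    exact successive_eq_of_mem hx haj hai

/-- A lower bound from an admissible family of singletons. -/
theorem weight_mul_sum_abs_le (A : Finset ℕ+)
    (hA : D.adm A.card fun i => {A.orderEmbOfFin rfl i}) (x : ℕ+ →₀ ℝ) :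
    D.weight A.card * ∑ j ∈ A, |x j| ≤ tsirelsonNorm D x := by
  have h := le_tsirelsonNorm D (fun i => ({A.orderEmbOfFin rfl i} : Finset ℕ+))
    (by
      intro i j hij a ha b hb
      rw [Finset.mem_singleton] at ha hb
      subst ha hb
      exact (A.orderEmbOfFin rfl).strictMono hij) hA x
  refine le_trans (mul_le_mul_of_nonneg_left ?_ (D.weight_nonneg _)) h
  have hs : ∑ j ∈ A, |x j| = ∑ i : Fin A.card, |x (A.orderEmbOfFin rfl i)| := by
    rw [← Finset.sum_coe_sort A]
    exact (Equiv.sum_comp (A.orderIsoOfFin rfl).toEquiv (fun j => |x j|)).symm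
  rw [hs]
  refine Finset.sum_le_sum fun i _ => ?_
  refine le_trans ?_ (abs_le_tsirelsonNorm D _ (A.orderEmbOfFin rfl i))
  rw [restrict_apply, if_pos (Finset.mem_singleton_self _)]

end Basics

/-! ### The weight function of Schlumprecht's space -/

section Schlumprecht

/-- The function `log₂ (n + 1)`. -/
noncomputable def logWeight (n : ℕ) : ℝ := Real.logb 2 (n + 1)

theorem schlumprecht_weight (n : ℕ) : schlumprechtData.weight n = 1 / logWeight n := rfl

theorem logWeight_mono {m n : ℕ} (h : m ≤ n) : logWeight m ≤ logWeight n := by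
  unfold logWeight
  refine Real.logb_le_logb_of_le one_lt_two (by positivity) ?_
  have : (m : ℝ) ≤ n := by exact_mod_cast h
  linarith

theorem logWeight_one : logWeight 1 = 1 := by
  unfold logWeight
  norm_num

theorem one_le_logWeight {n : ℕ} (h : 1 ≤ n) : 1 ≤ logWeight n :=
  logWeight_one ▸ logWeight_mono h

theorem one_lt_logWeight_two : 1 < logWeight 2 := by
  unfold logWeight
  rw [Real.lt_logb_iff_rpow_lt one_lt_two (by norm_num)]
  norm_num

theorem logWeight_nonneg (n : ℕ) : 0 ≤ logWeight n :=
  Real.logb_nonneg one_lt_two (by linarith [Nat.cast_nonneg (α := ℝ) n])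

theorem tendsto_logWeight : Filter.Tendsto logWeight Filter.atTop Filter.atTop :=
  (Real.tendsto_logb_atTop one_lt_two).comp
    (Filter.tendsto_atTop_add_const_right _ _ tendsto_natCast_atTop_atTop)

/-- Since `m * n + 1 ≤ (m + 1) * (n + 1)`. This slow growth of the weight gives both the lower `ℓ₁`
estimate in `S` and the linear bound on the weight of `N ^ k`. -/
theorem logWeight_mul_le {m n : ℕ} : logWeight (m * n) ≤ logWeight m + logWeight n := by
  unfold logWeight
  rw [← Real.logb_mul (by positivity) (by positivity)]
  refine Real.logb_le_logb_of_le one_lt_two (by positivity) ?_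
  push_cast
  nlinarith [Nat.cast_nonneg (α := ℝ) n, Nat.cast_nonneg (α := ℝ) m]

theorem logWeight_lt_iff {n k : ℕ} : logWeight n < k ↔ n + 1 < 2 ^ k := by
  unfold logWeight
  rw [Real.logb_lt_iff_lt_rpow one_lt_two (by positivity), Real.rpow_natCast]
  exact_mod_cast Iff.rfl

/-- Any coordinates in a finite set of at least two elements form an admissible family. -/
theorem sum_abs_le_logWeight_mul (A : Finset ℕ+) (hA : 2 ≤ A.card) (x : ℕ+ →₀ ℝ) :
    ∑ j ∈ A, |x j| ≤ logWeight A.card * tsirelsonNorm schlumprechtData x := by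
  have hpos : 0 < logWeight A.card := one_pos.trans_le (one_le_logWeight (one_le_two.trans hA))
  have h := weight_mul_sum_abs_le schlumprechtData A hA x
  rwa [schlumprecht_weight, one_div, inv_mul_le_iff₀ hpos] at h

end Schlumprecht

/-! ### James' blocking argument for `ℓ₁` spreading sequences -/

section James

/-- Successive choices of finite sets, each starting beyond a prescribed bound. -/
theorem exists_successive_choice {α : Type*} (S : α → Finset ℕ) (P : α → Prop)
    (h : ∀ N : ℕ, ∃ s, P s ∧ ∀ m ∈ S s, N ≤ m) (N : ℕ → ℕ) :
    ∃ s : ℕ → α, (∀ j, P (s j) ∧ ∀ m ∈ S (s j), N j ≤ m) ∧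
      ∀ i j, i < j → ∀ a ∈ S (s i), ∀ b ∈ S (s j), a < b := by
  choose g hg1 hg2 using h
  let t : ℕ → ℕ := fun j => Nat.rec (N 0)
    (fun j t => max (max (N (j + 1)) t) ((S (g t)).sup id + 1)) j
  have ht : ∀ j, t (j + 1) = max (max (N (j + 1)) (t j)) ((S (g (t j))).sup id + 1) :=
    fun j => rfl
  have htN : ∀ j, N j ≤ t j := by
    intro j
    cases j with
    | zero => exact le_rfl
    | succ j => rw [ht]; exact (le_max_left _ _).trans (le_max_left _ _)
  have hmono : Monotone t := monotone_nat_of_le_succ fun j => by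
    rw [ht]; exact (le_max_right _ _).trans (le_max_left _ _)
  refine ⟨fun j => g (t j), fun j => ⟨hg1 _, fun m hm => (htN j).trans (hg2 _ m hm)⟩, ?_⟩
  intro i j hij a ha b hb
  have h1 : a ≤ (S (g (t i))).sup id := Finset.le_sup (f := id) ha
  have h2 : (S (g (t i))).sup id + 1 ≤ t (i + 1) := by rw [ht]; exact le_max_right _ _
  have h3 : t (i + 1) ≤ t j := hmono hij
  have h4 := hg2 _ b hb
  omega

variable {V : Type*} [AddCommGroup V] [Module ℝ V]

/-- On Schreier sets the sequence is equivalent to the unit vector basis of `ℓ₁`, with the given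
lower and upper constants. -/
def EllOneSpreading (p : Seminorm ℝ V) (A B : ℝ) (x : ℕ → V) : Prop :=
  -- Sequences are indexed from 0 here; `m + 1` is the index in `ℕ+`, so `F` runs over the shifted
  -- members of `𝓢₁`.
  ∀ F : Finset ℕ, (∀ m ∈ F, F.card ≤ m + 1) → ∀ a : ℕ → ℝ,
    A * ∑ i ∈ F, |a i| ≤ p (∑ i ∈ F, a i • x i) ∧ p (∑ i ∈ F, a i • x i) ≤ B * ∑ i ∈ F, |a i|

/-- A linear combination of successive blocks, written in terms of the original sequence. -/
theorem exists_block_coefficients (x : ℕ → V) (F : ℕ → Finset ℕ) (c : ℕ → ℕ → ℝ)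
    (hF : ∀ i j, i < j → ∀ a ∈ F i, ∀ b ∈ F j, a < b) (hc : ∀ j, ∑ i ∈ F j, |c j i| = 1)
    (G : Finset ℕ) (a : ℕ → ℝ) :
    ∃ b : ℕ → ℝ, ∑ j ∈ G, a j • ∑ i ∈ F j, c j i • x i = ∑ i ∈ G.biUnion F, b i • x i ∧
      ∑ i ∈ G.biUnion F, |b i| = ∑ j ∈ G, |a j| := by
  have hdisj : ∀ i j, ∀ k ∈ F i, k ∈ F j → i = j := by
    intro i j k hi hj
    rcases lt_trichotomy i j with h | h | h
    · exact absurd (hF i j h k hi k hj) (lt_irrefl _)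
    · exact h
    · exact absurd (hF j i h k hj k hi) (lt_irrefl _)
  have hpd : (G : Set ℕ).PairwiseDisjoint F := fun i _ j _ hij =>
    Finset.disjoint_left.2 fun k hi hj => hij (hdisj i j k hi hj)
  have hb : ∀ j ∈ G, ∀ i ∈ F j, (∑ k ∈ G, if i ∈ F k then a k * c k i else 0) = a j * c j i := by
    intro j hj i hi
    rw [Finset.sum_eq_single_of_mem j hj, if_pos hi]
    intro k _ hkj
    exact if_neg fun hik => hkj (hdisj k j i hik hi)
  -- The sets `F k` are disjoint, so at most one term of this sum is non-zero.
  refine ⟨fun i => ∑ k ∈ G, if i ∈ F k then a k * c k i else 0, ?_, ?_⟩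
  · rw [Finset.sum_biUnion hpd]
    refine Finset.sum_congr rfl fun j hj => ?_
    rw [Finset.smul_sum]
    refine Finset.sum_congr rfl fun i hi => ?_
    beta_reduce
    rw [hb j hj i hi, mul_smul]
  · rw [Finset.sum_biUnion hpd]
    refine Finset.sum_congr rfl fun j hj => ?_
    rw [Finset.sum_congr rfl fun i hi => by beta_reduce; rw [hb j hj i hi, abs_mul], ← Finset.mul_sum, hc,
      mul_one]

/-- James' argument: an `ℓ₁` spreading sequence has a block sequence that is almost isometrically
`ℓ₁` spreading, without loss in the constants of any other seminorm. -/
theorem exists_almost_isometric_blocks {p : Seminorm ℝ V} {A B : ℝ} {x : ℕ → V} (hA : 0 < A)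
    (hx : EllOneSpreading p A B x) {ε : ℝ} (hε : 0 < ε) :
    ∃ (δ : ℝ) (F : ℕ → Finset ℕ) (c : ℕ → ℕ → ℝ), 0 < δ ∧
      (∀ i j, i < j → ∀ a ∈ F i, ∀ b ∈ F j, a < b) ∧
      EllOneSpreading p (δ * (1 - ε)) (δ * (1 + ε)) (fun j => ∑ i ∈ F j, c j i • x i) ∧
      ∀ (q : Seminorm ℝ V) (A' B' : ℝ), EllOneSpreading q A' B' x →
        EllOneSpreading q A' B' (fun j => ∑ i ∈ F j, c j i • x i) := by
  -- The lower `ℓ₁` constants valid on sets of bounded size, provided these lie far enough out. The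
  -- supremum `δ` is the asymptotic constant: slightly below it the estimate holds, and slightly
  -- above it fails arbitrarily far out on sets of one fixed size `k`.
  let P : Set ℝ := {d | ∀ k : ℕ, ∃ N : ℕ, ∀ F : Finset ℕ, F.card ≤ k → (∀ m ∈ F, N ≤ m) →
    ∀ a : ℕ → ℝ, d * ∑ i ∈ F, |a i| ≤ p (∑ i ∈ F, a i • x i)}
  have hAP : A ∈ P := fun k => ⟨k, fun F hk hF a =>
    (hx F (fun m hm => (hk.trans (hF m hm)).trans (Nat.le_succ m)) a).1⟩
  have hbdd : BddAbove P := by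
    refine ⟨B, fun d hd => ?_⟩
    obtain ⟨N, hN⟩ := hd 1
    have h1 := hN {N} (by simp) (by simp) (fun _ => 1)
    have h2 := (hx {N} (by simp) (fun _ => 1)).2
    simp only [Finset.sum_singleton, abs_one, mul_one] at h1 h2
    exact h1.trans h2
  set δ := sSup P with hδ
  have hδA : A ≤ δ := le_csSup hbdd hAP
  have hδ0 : 0 < δ := hA.trans_le hδA
  obtain ⟨d, hdP, hd⟩ : ∃ d ∈ P, δ * (1 - ε) < d :=
    exists_lt_of_lt_csSup ⟨A, hAP⟩ (by rw [← hδ]; nlinarith)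
  have hnot : δ * (1 + ε) ∉ P := fun h => by
    have := le_csSup hbdd h
    rw [← hδ] at this
    nlinarith
  have hnot' : ∃ k : ℕ, ∀ N : ℕ, ∃ F : Finset ℕ, F.card ≤ k ∧ (∀ m ∈ F, N ≤ m) ∧
      ∃ a : ℕ → ℝ, p (∑ i ∈ F, a i • x i) < δ * (1 + ε) * ∑ i ∈ F, |a i| := by
    by_contra hcon
    push Not at hcon
    exact hnot hcon
  obtain ⟨k, hk⟩ := hnot'
  choose N hN using hdP
  obtain ⟨s, hs1, hs2⟩ := exists_successive_choice (α := Finset ℕ × (ℕ → ℝ)) (fun s => s.1)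
    (fun s => s.1.card ≤ k ∧ ∑ i ∈ s.1, |s.2 i| = 1 ∧
      p (∑ i ∈ s.1, s.2 i • x i) ≤ δ * (1 + ε)) (by
      intro M
      obtain ⟨F, hFk, hFM, a, ha⟩ := hk M
      have hpos : 0 < ∑ i ∈ F, |a i| := by
        by_contra h0
        have : ∑ i ∈ F, |a i| = 0 :=
          le_antisymm (not_lt.1 h0) (Finset.sum_nonneg fun _ _ => abs_nonneg _)
        rw [this, mul_zero] at ha
        exact absurd ha (not_lt.2 (apply_nonneg p _))
      refine ⟨⟨F, fun i => (∑ i ∈ F, |a i|)⁻¹ * a i⟩, ⟨hFk, ?_, ?_⟩, hFM⟩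
      · simp only [abs_mul, ← Finset.mul_sum, abs_inv, abs_of_pos hpos]
        exact inv_mul_cancel₀ hpos.ne'
      · simp only [mul_smul, ← Finset.smul_sum]
        rw [map_smul_eq_mul, Real.norm_eq_abs, abs_inv, abs_of_pos hpos,
          inv_mul_le_iff₀ hpos, mul_comm]
        exact ha.le)
    -- The first bound makes a Schreier union of blocks a Schreier set again, as each block has at
    -- most `k` elements. The second makes the estimate for `d` available for every union of at most
    -- `(i + 1) * k` elements with `i ≤ j`.
    (fun j => max ((j + 1) * k) ((Finset.range (j + 1)).sup fun i => N ((i + 1) * k)))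
  have hc : ∀ j, ∑ i ∈ (s j).1, |(s j).2 i| = 1 := fun j => (hs1 j).1.2.1
  refine ⟨δ, fun j => (s j).1, fun j => (s j).2, hδ0, hs2, ?_, ?_⟩
  · intro G hG a
    constructor
    · rcases G.eq_empty_or_nonempty with rfl | hne
      · simp
      obtain ⟨b, hb1, hb2⟩ := exists_block_coefficients x (fun j => (s j).1) (fun j => (s j).2)
        hs2 hc G a
      dsimp only at hb1 hb2 ⊢
      rw [hb1, ← hb2]
      refine le_trans (mul_le_mul_of_nonneg_right hd.le
        (Finset.sum_nonneg fun _ _ => abs_nonneg _)) ?_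
      have hmin := G.min'_mem hne
      refine hN ((G.min' hne + 1) * k) _ ?_ ?_ b
      · refine (Finset.card_biUnion_le_card_mul G _ k fun j _ => (hs1 j).1.1).trans ?_
        exact Nat.mul_le_mul_right k (hG _ hmin)
      · intro m hm
        obtain ⟨j, hj, hmj⟩ := Finset.mem_biUnion.1 hm
        refine le_trans ?_ ((hs1 j).2 m hmj)
        refine le_max_of_le_right (Finset.le_sup (f := fun i => N ((i + 1) * k)) ?_)
        exact Finset.mem_range.2 (Nat.lt_succ_of_le (G.min'_le j hj))
    · refine (seminorm_sum_le p G _).trans ?_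
      rw [Finset.mul_sum]
      refine Finset.sum_le_sum fun j _ => ?_
      rw [map_smul_eq_mul, Real.norm_eq_abs, mul_comm]
      exact mul_le_mul_of_nonneg_right (hs1 j).1.2.2 (abs_nonneg _)
  · intro q A' B' hq G hG a
    obtain ⟨b, hb1, hb2⟩ := exists_block_coefficients x (fun j => (s j).1) (fun j => (s j).2)
      hs2 hc G a
    dsimp only at hb1 hb2 ⊢
    rw [hb1, ← hb2]
    refine hq _ ?_ b
    intro m hm
    obtain ⟨j, hj, hmj⟩ := Finset.mem_biUnion.1 hm
    refine (Finset.card_biUnion_le_card_mul G _ k fun j _ => (hs1 j).1.1).trans ?_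
    calc G.card * k ≤ (j + 1) * k := Nat.mul_le_mul_right k (hG j hj)
      _ ≤ m := (le_max_left _ _).trans ((hs1 j).2 m hmj)
      _ ≤ m + 1 := Nat.le_succ m

end James

/-! ### `ℓ₁` spreading models exclude `𝓢₁` distortion -/

section Embedding

variable (D : TsirelsonData)

/-- The inclusion of `c₀₀` in the completion. -/
noncomputable def embed : (ℕ+ →₀ ℝ) →ₗ[ℝ] TsirelsonSpace D :=
  (UniformSpace.Completion.toComplL : PreSpace D →L[ℝ] TsirelsonSpace D).toLinearMap ∘ₗ
    (LinearMap.id : PreSpace D →ₗ[ℝ] PreSpace D)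

theorem embed_apply (x : ℕ+ →₀ ℝ) : embed D x = (toPre D x : TsirelsonSpace D) := rfl

theorem norm_embed (x : ℕ+ →₀ ℝ) : ‖embed D x‖ = tsirelsonNorm D x :=
  UniformSpace.Completion.norm_coe _

theorem sum_smul_unitBasis (a : ℕ+ →₀ ℝ) :
    a.sum (fun j r => r • unitBasis D j) = embed D a := by
  conv_rhs => rw [← a.sum_single]
  rw [Finsupp.sum, Finsupp.sum, map_sum]
  refine Finset.sum_congr rfl fun j _ => ?_
  have : (Finsupp.single j (a j) : ℕ+ →₀ ℝ) = a j • Finsupp.single j 1 := by simp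
  rw [this, map_smul]
  rfl

/-- This moves every question about block sequences from the completion to `c₀₀`. -/
theorem isNormalizedBlock_iff {x : ℕ+ → TsirelsonSpace D} :
    IsNormalizedBlock (unitBasis D) x ↔ ∃ a : ℕ+ → ℕ+ →₀ ℝ, Successive (fun i => (a i).support) ∧
      ∀ i, x i = embed D (a i) ∧ tsirelsonNorm D (a i) = 1 := by
  refine exists_congr fun a => and_congr_right fun _ => forall_congr' fun i => ?_
  rw [sum_smul_unitBasis]
  refine and_congr_right fun h => ?_
  rw [h, norm_embed]

/-- Blocks of successive vectors are successive. -/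
theorem successive_blocks {x : ℕ → ℕ+ →₀ ℝ} (hx : Successive fun i => (x i).support)
    {F : ℕ → Finset ℕ} (hF : ∀ i j, i < j → ∀ a ∈ F i, ∀ b ∈ F j, a < b) (c : ℕ → ℕ → ℝ) :
    Successive fun j => (∑ i ∈ F j, c j i • x i).support := by
  have key : ∀ j, ∀ k ∈ (∑ i ∈ F j, c j i • x i).support, ∃ i ∈ F j, k ∈ (x i).support := by
    intro j k hk
    rw [Finsupp.mem_support_iff, Finsupp.finsetSum_apply] at hk
    obtain ⟨i, hi, hik⟩ := Finset.exists_ne_zero_of_sum_ne_zero hk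
    refine ⟨i, hi, Finsupp.mem_support_iff.2 fun h => hik ?_⟩
    rw [Finsupp.smul_apply, h, smul_zero]
  intro i j hij a ha b hb
  obtain ⟨i', hi', ha'⟩ := key i a ha
  obtain ⟨j', hj', hb'⟩ := key j b hb
  exact hx i' j' (hF i j hij i' hi' j' hj') a ha' b hb'

/-- If some block sequence generates an `ℓ₁` spreading model then the space is not `t`-`𝓢₁`
distortable. -/
theorem not_distortable_of_ellOneSpreading {A B : ℝ} {x : ℕ → ℕ+ →₀ ℝ} (hA : 0 < A)
    (hx : Successive fun i => (x i).support) (hS : EllOneSpreading (tsirelsonSeminorm D) A B x)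
    {F : Set (Finset ℕ+)} (hF : F ⊆ schreierOne) {t : ℝ} (ht : 1 < t) :
    ¬ Distortable (unitBasis D) F t := by
  rintro ⟨p, ⟨m, M, hm, hM, hmM⟩, hp⟩
  -- One factor `(1 + ε) / (1 - ε)` is lost for each of the two norms.
  obtain ⟨ε, hε0, hε1, hεt⟩ : ∃ ε : ℝ, 0 < ε ∧ ε < 1 ∧ ((1 + ε) / (1 - ε)) ^ 2 < t := by
    have hc : ContinuousAt (fun ε : ℝ => ((1 + ε) / (1 - ε)) ^ 2) 0 := by
      refine ContinuousAt.pow (ContinuousAt.div (by fun_prop) (by fun_prop) (by norm_num)) 2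
    have h1 : ∀ᶠ ε : ℝ in nhds 0, ((1 + ε) / (1 - ε)) ^ 2 < t :=
      hc.eventually_lt continuousAt_const (by simpa using ht)
    have h2 : ∀ᶠ ε : ℝ in nhdsWithin 0 (Set.Ioi 0), ((1 + ε) / (1 - ε)) ^ 2 < t ∧ 0 < ε ∧ ε < 1 :=
      (h1.filter_mono nhdsWithin_le_nhds).and
        ((eventually_nhdsWithin_of_forall fun _ h => h).and
          (((gt_mem_nhds one_pos).filter_mono nhdsWithin_le_nhds)))
    obtain ⟨ε, h⟩ := h2.exists
    exact ⟨ε, h.2.1, h.2.2, h.1⟩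
  set N := tsirelsonSeminorm D with hN
  set q : Seminorm ℝ (ℕ+ →₀ ℝ) := p.comp (embed D) with hq
  have hqN : ∀ x, m * N x ≤ q x ∧ q x ≤ M * N x := fun x => by
    have := hmM (embed D x)
    rwa [norm_embed] at this
  have hSq : EllOneSpreading q (m * A) (M * B) x := fun G hG a => by
    obtain ⟨h1, h2⟩ := hS G hG a
    obtain ⟨h3, h4⟩ := hqN (∑ i ∈ G, a i • x i)
    constructor
    · refine le_trans ?_ h3
      rw [mul_assoc]
      exact mul_le_mul_of_nonneg_left h1 hm.le
    · refine h4.trans ?_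
      rw [mul_assoc]
      exact mul_le_mul_of_nonneg_left h2 hM.le
  -- The blocks `y` stabilise the norm `N`; the further blocks `z` stabilise `q` and, by `hz'`, keep
  -- the constants already obtained for `N`.
  obtain ⟨δ, F₁, c₁, hδ, hF₁, hy, hy'⟩ := exists_almost_isometric_blocks hA hS hε0
  have hyq := hy' q _ _ hSq
  have hys := successive_blocks hx hF₁ c₁
  set y : ℕ → ℕ+ →₀ ℝ := fun j => ∑ i ∈ F₁ j, c₁ j i • x i
  obtain ⟨γ, F₂, c₂, hγ, hF₂, hz, hz'⟩ :=
    exists_almost_isometric_blocks (mul_pos hm hA) hyq hε0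
  have hzN := hz' N _ _ hy
  have hzs := successive_blocks hys hF₂ c₂
  set z : ℕ → ℕ+ →₀ ℝ := fun j => ∑ i ∈ F₂ j, c₂ j i • y i
  have h1ε : 0 < 1 - ε := by linarith
  have h1ε' : 0 < 1 + ε := by linarith
  have hzpos : ∀ j, 0 < N (z j) := fun j => by
    have h := (hzN {j} (by simp) (fun _ => 1)).1
    simp only [Finset.sum_singleton, abs_one, mul_one, one_smul] at h
    exact (mul_pos hδ h1ε).trans_le h
  obtain ⟨E, hE, u, hu, v, hv, hu1, hv1, huv⟩ :=
    hp (fun i => embed D ((N (z i.natPred))⁻¹ • z i.natPred)) (by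
      rw [isNormalizedBlock_iff]
      refine ⟨fun i => (N (z i.natPred))⁻¹ • z i.natPred, ?_, fun i => ⟨rfl, ?_⟩⟩
      · intro i j hij a ha b hb
        exact hzs i.natPred j.natPred (PNat.natPred_lt_natPred.2 hij)
          a (Finsupp.support_smul ha) b (Finsupp.support_smul hb)
      · rw [tsirelsonNorm_smul, abs_inv, abs_of_pos (hzpos _)]
        exact inv_mul_cancel₀ (hzpos _).ne')
  have key : ∀ w ∈ Submodule.span ℝ ((fun i : ℕ+ => embed D ((N (z i.natPred))⁻¹ • z i.natPred)) ''
      (E : Set ℕ+)), ‖w‖ = 1 →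
      γ * (1 - ε) / (δ * (1 + ε)) ≤ p w ∧ p w ≤ γ * (1 + ε) / (δ * (1 - ε)) := by
    intro w hw hw1
    obtain ⟨b, hb⟩ := (Submodule.mem_span_image_finset_iff_exists_fun' (R := ℝ)).1 hw
    have hrep : w = embed D (∑ j ∈ E.map ⟨PNat.natPred, PNat.natPred_injective⟩,
        (b j.succPNat * (N (z j))⁻¹) • z j) := by
      rw [← hb, Finset.sum_map, map_sum]
      refine Finset.sum_congr rfl fun i _ => ?_
      rw [← map_smul]
      simp only [Function.Embedding.coeFn_mk, PNat.succPNat_natPred, mul_smul]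
    have hG : ∀ k ∈ E.map ⟨PNat.natPred, PNat.natPred_injective⟩,
        (E.map ⟨PNat.natPred, PNat.natPred_injective⟩).card ≤ k + 1 := by
      intro k hk
      obtain ⟨i, hi, rfl⟩ := Finset.mem_map.1 hk
      rw [Finset.card_map]
      simp only [Function.Embedding.coeFn_mk, PNat.natPred_add_one]
      exact hF hE i hi
    obtain ⟨h1, h2⟩ := hz _ hG (fun j => b j.succPNat * (N (z j))⁻¹)
    obtain ⟨h3, h4⟩ := hzN _ hG (fun j => b j.succPNat * (N (z j))⁻¹)
    have hNw : N (∑ j ∈ E.map ⟨PNat.natPred, PNat.natPred_injective⟩,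
        (b j.succPNat * (N (z j))⁻¹) • z j) = 1 := by
      rw [hN, tsirelsonSeminorm_apply, ← norm_embed, ← hrep, hw1]
    have hqw : q (∑ j ∈ E.map ⟨PNat.natPred, PNat.natPred_injective⟩,
        (b j.succPNat * (N (z j))⁻¹) • z j) = p w := by
      rw [hrep]; rfl
    rw [hNw] at h3 h4
    rw [hqw] at h1 h2
    -- `N = 1` forces `δ * (1 - ε) * s ≤ 1 ≤ δ * (1 + ε) * s`, while the value of `q` lies between
    -- `γ * (1 - ε) * s` and `γ * (1 + ε) * s`. Eliminating `s` gives bounds independent of `w`.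
    set s := ∑ j ∈ E.map ⟨PNat.natPred, PNat.natPred_injective⟩, |b j.succPNat * (N (z j))⁻¹|
    constructor
    · rw [div_le_iff₀ (mul_pos hδ h1ε')]
      nlinarith [mul_le_mul_of_nonneg_right h1 (mul_pos hδ h1ε').le,
        mul_le_mul_of_nonneg_left h4 (mul_pos hγ h1ε).le]
    · rw [le_div_iff₀ (mul_pos hδ h1ε)]
      nlinarith [mul_le_mul_of_nonneg_right h2 (mul_pos hδ h1ε).le,
        mul_le_mul_of_nonneg_left h3 (mul_pos hγ h1ε').le]
  obtain ⟨-, h2⟩ := key u hu hu1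
  obtain ⟨h3, -⟩ := key v hv hv1
  have hpos : 0 < γ * (1 - ε) / (δ * (1 + ε)) := by positivity
  have h5 : p u / p v ≤ (γ * (1 + ε) / (δ * (1 - ε))) / (γ * (1 - ε) / (δ * (1 + ε))) :=
    div_le_div₀ (by positivity) h2 hpos h3
  have h6 : (γ * (1 + ε) / (δ * (1 - ε))) / (γ * (1 - ε) / (δ * (1 + ε)))
      = ((1 + ε) / (1 - ε)) ^ 2 := by
    field_simp
  rw [h6] at h5
  exact absurd (huv.trans_le h5) (not_lt.2 hεt.le)

end Embedding

/-! ### The unit vectors of Tsirelson's space -/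

section TsirelsonBasis

/-- The unit vector basis of `T` generates an `ℓ₁` spreading model. -/
theorem tsirelson_ellOneSpreading : EllOneSpreading (tsirelsonSeminorm tsirelsonData) (1 / 2) 1
    (fun i => Finsupp.single i.succPNat 1) := by
  intro F hF a
  constructor
  · set A : Finset ℕ+ := F.map ⟨Nat.succPNat, Nat.succPNat_injective⟩ with hA
    have h := weight_mul_sum_abs_le tsirelsonData A (by
      intro i k hk
      rw [Finset.mem_singleton] at hk
      have hkA : k ∈ A := hk ▸ A.orderEmbOfFin_mem rfl i
      obtain ⟨m, hm, rfl⟩ := Finset.mem_map.1 hkA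
      rw [hA, Finset.card_map]
      exact hF m hm) (∑ i ∈ F, a i • Finsupp.single i.succPNat 1)
    refine le_trans (le_of_eq ?_) h
    rw [hA, Finset.sum_map]
    change 1 / 2 * _ = 1 / 2 * _
    congr 1
    refine Finset.sum_congr rfl fun i hi => ?_
    rw [Finsupp.finsetSum_apply, Finset.sum_eq_single_of_mem i hi]
    · simp
    · intro j _ hji
      have : (j.succPNat : ℕ+) ≠ i.succPNat := fun h => hji (Nat.succPNat_injective h)
      simp [this]
  · refine (seminorm_sum_le _ F _).trans ?_
    rw [one_mul]
    refine Finset.sum_le_sum fun i _ => ?_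
    rw [map_smul_eq_mul, Real.norm_eq_abs]
    refine mul_le_of_le_one_right (abs_nonneg _) ?_
    refine (tsirelsonNorm_le_ellOne _ _).trans ?_
    refine (Finset.sum_le_sum_of_subset_of_nonneg Finsupp.support_single_subset
      fun _ _ _ => abs_nonneg _).trans ?_
    simp

theorem successive_unitVectors :
    Successive fun i : ℕ => (Finsupp.single i.succPNat (1 : ℝ)).support := by
  intro i j hij a ha b hb
  obtain rfl := Finset.mem_singleton.1 (Finsupp.support_single_subset ha)
  obtain rfl := Finset.mem_singleton.1 (Finsupp.support_single_subset hb)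
  exact Nat.succPNat_lt_succPNat.2 hij

end TsirelsonBasis

/-! ### Norms of sums of unit vectors in Schlumprecht's space -/

section UnitSums

theorem sum_card_inter_le {n : ℕ} {E : Fin n → Finset ℕ+} (hE : Successive E) (A : Finset ℕ+) :
    ∑ i, (E i ∩ A).card ≤ A.card := by
  rw [← Finset.card_biUnion]
  · refine Finset.card_le_card fun a ha => ?_
    obtain ⟨i, -, hi⟩ := Finset.mem_biUnion.1 ha
    exact (Finset.mem_inter.1 hi).2
  · intro i _ j _ hij
    refine Finset.disjoint_left.2 fun a hi hj => hij ?_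
    exact successive_eq_of_mem hE (Finset.mem_inter.1 hi).1 (Finset.mem_inter.1 hj).1

/-- An upper bound for the norm in `S` of the sum of `c` unit vectors. -/
noncomputable def unitSumBound (c : ℕ) : ℝ := 2 * c / (Real.logb 2 c + 2)

theorem logb_natCast_nonneg (c : ℕ) : 0 ≤ Real.logb 2 c := by
  rcases Nat.eq_zero_or_pos c with rfl | h
  · simp
  · exact Real.logb_nonneg one_lt_two (by exact_mod_cast h)

theorem unitSumBound_nonneg (c : ℕ) : 0 ≤ unitSumBound c :=
  div_nonneg (by positivity) (by linarith [logb_natCast_nonneg c])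

theorem one_le_unitSumBound {c : ℕ} (hc : 1 ≤ c) : 1 ≤ unitSumBound c := by
  have h0 := logb_natCast_nonneg c
  have hc' : (1 : ℝ) ≤ c := by exact_mod_cast hc
  rw [unitSumBound, le_div_iff₀ (by linarith), one_mul]
  -- From `log c ≤ c - 1` and `log 2 > 1 / 2`.
  have h1 : Real.logb 2 c ≤ 2 * (c - 1) := by
    rw [Real.logb, div_le_iff₀ (Real.log_pos one_lt_two)]
    have := Real.log_le_sub_one_of_pos (x := c) (by linarith)
    nlinarith [Real.log_two_gt_d9]
  linarith

/-- The entropy estimate behind the norm of a sum of unit vectors in `S`. -/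
theorem sum_unitSumBound_le {n : ℕ} (hn : 2 ≤ n) (c : Fin n → ℕ) {C : ℕ} (hC : ∑ i, c i ≤ C) :
    ∑ i, unitSumBound (c i) ≤ logWeight n * unitSumBound C := by
  rcases Nat.eq_zero_or_pos C with rfl | hpos
  · have h0 : ∀ i, c i = 0 := fun i =>
      Nat.le_zero.1 ((Finset.single_le_sum (fun _ _ => Nat.zero_le _) (Finset.mem_univ i)).trans hC)
    simp [h0, unitSumBound]
  have hn' : (2 : ℝ) ≤ n := by exact_mod_cast hn
  have hC1 : (1 : ℝ) ≤ C := by exact_mod_cast hpos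
  set l := Real.log 2 with hl
  have hl0 : 1 / 2 < l := by have := Real.log_two_gt_d9; linarith
  set X := Real.logb 2 C with hX
  have hX0 : 0 ≤ X := logb_natCast_nonneg C
  have hlogn : 0 ≤ Real.log n := Real.log_nonneg (by linarith)
  -- The right-hand side is affine in `c i`, so that it can be summed. It replaces the entropy term
  -- `c log (C / c)` by its tangent at `c = C / n`, through `log x ≤ x - 1` with `x = C / (n * c)`.
  have hterm : ∀ i, unitSumBound (c i)
      ≤ 2 / (X + 2) * (c i + (C / n - c i + c i * Real.log n) / (2 * l)) := by
    intro i
    rcases Nat.eq_zero_or_pos (c i) with h0 | hi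
    · rw [h0]
      simp only [unitSumBound, Nat.cast_zero, mul_zero, zero_div, zero_mul, sub_zero, add_zero,
        zero_add]
      positivity
    have hi1 : (1 : ℝ) ≤ c i := by exact_mod_cast hi
    have hiC : (c i : ℝ) ≤ C := by
      exact_mod_cast (Finset.single_le_sum (f := c) (fun _ _ => Nat.zero_le _)
        (Finset.mem_univ i)).trans hC
    set x := Real.logb 2 (c i) with hx
    have hx0 : 0 ≤ x := logb_natCast_nonneg _
    have hxX : x ≤ X := Real.logb_le_logb_of_le one_lt_two (by linarith) hiC
    have h1 : (c i : ℝ) * (X - x) ≤ (C / n - c i + c i * Real.log n) / l := by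
      rw [le_div_iff₀ (by linarith)]
      have h2 : (X - x) * l = Real.log (C / (n * c i)) + Real.log n := by
        rw [hX, hx, Real.logb, Real.logb, ← hl, Real.log_div (by positivity) (by positivity),
          Real.log_mul (by positivity) (by positivity)]
        have hl1 : l ≠ 0 := by linarith
        field_simp
        ring
      have h3 := Real.log_le_sub_one_of_pos (x := C / (n * c i)) (by positivity)
      have h4 : (c i : ℝ) * (C / (n * c i)) = C / n := by field_simp
      rw [mul_assoc, h2]
      nlinarith
    -- After clearing denominators the excess of the right-hand side is a positive multiple of `c *
    -- x * (X - x)`, which is non-negative.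
    have h5 : unitSumBound (c i) ≤ 2 / (X + 2) * (c i + (c i * (X - x)) / 2) := by
      rw [unitSumBound, ← hx, div_mul_eq_mul_div, div_le_div_iff₀ (by linarith) (by linarith)]
      nlinarith [mul_nonneg (mul_nonneg (sub_nonneg.2 hxX) hx0) (by linarith : (0 : ℝ) ≤ c i)]
    refine h5.trans (mul_le_mul_of_nonneg_left ?_ (by positivity))
    have h6 : (C / n - c i + c i * Real.log n) / (2 * l)
        = (C / n - c i + c i * Real.log n) / l / 2 := by
      rw [div_div, mul_comm l 2]
    rw [h6]
    linarith
  refine (Finset.sum_le_sum fun i _ => hterm i).trans ?_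
  rw [← Finset.mul_sum, Finset.sum_add_distrib, ← Finset.sum_div, Finset.sum_add_distrib,
    Finset.sum_sub_distrib, ← Finset.sum_mul, Finset.sum_const, Finset.card_univ,
    Fintype.card_fin, nsmul_eq_mul, mul_div_cancel₀ _ (by positivity : (n : ℝ) ≠ 0)]
  have hS : (∑ i, (c i : ℝ)) ≤ C := by exact_mod_cast hC
  set s : ℝ := ∑ i, (c i : ℝ)
  -- This is `4 * n ≤ (n + 1) ^ 2` in logarithmic form.
  have hlog : 1 + Real.log n / (2 * l) ≤ logWeight n := by
    have h1 : Real.logb 2 (4 * n) ≤ Real.logb 2 ((n + 1) ^ 2) :=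
      Real.logb_le_logb_of_le one_lt_two (by positivity) (by nlinarith [sq_nonneg ((n : ℝ) - 1)])
    rw [Real.logb_mul (by norm_num) (by positivity), Real.logb_pow] at h1
    have h2 : Real.logb 2 4 = 2 := by
      rw [show (4 : ℝ) = 2 ^ (2 : ℝ) by norm_num, Real.logb_rpow (by norm_num) (by norm_num)]
    have h3 : Real.log n / (2 * l) = Real.logb 2 n / 2 := by
      rw [Real.logb, ← hl, div_div, mul_comm]
    unfold logWeight
    rw [h3]
    push_cast at h1
    linarith
  have h7 : s + (C - s + s * Real.log n) / (2 * l) ≤ C * (1 + Real.log n / (2 * l)) := by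
    have : C * (1 + Real.log n / (2 * l)) - (s + (C - s + s * Real.log n) / (2 * l))
        = (C - s) * ((2 * l - 1 + Real.log n) / (2 * l)) := by
      have hl1 : l ≠ 0 := by linarith
      field_simp
      ring
    have h8 : 0 ≤ (C - s) * ((2 * l - 1 + Real.log n) / (2 * l)) :=
      mul_nonneg (by linarith) (div_nonneg (by linarith) (by linarith))
    linarith
  calc 2 / (X + 2) * (s + (C - s + s * Real.log n) / (2 * l))
      ≤ 2 / (X + 2) * (C * logWeight n) := by
        refine mul_le_mul_of_nonneg_left (h7.trans ?_) (by positivity)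
        exact mul_le_mul_of_nonneg_left hlog (by linarith)
    _ = logWeight n * unitSumBound C := by
        rw [unitSumBound, ← hX]
        ring

/-- The indicator of a finite set. -/
noncomputable def unitSum (B : Finset ℕ+) : ℕ+ →₀ ℝ := Finsupp.indicator B fun _ _ => 1

theorem unitSum_apply (B : Finset ℕ+) (i : ℕ+) : unitSum B i = if i ∈ B then 1 else 0 := by
  rw [unitSum, Finsupp.indicator_apply]
  split_ifs <;> rfl

theorem support_unitSum (B : Finset ℕ+) : (unitSum B).support = B := by
  ext i
  rw [Finsupp.mem_support_iff, unitSum_apply]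
  split_ifs <;> simp_all

theorem restrict_unitSum (E B : Finset ℕ+) : restrict E (unitSum B) = unitSum (E ∩ B) := by
  ext i
  simp only [restrict_apply, unitSum_apply, Finset.mem_inter]
  split_ifs <;> simp_all

theorem ellOne_smul_unitSum {r : ℝ} (hr : 0 < r) (B : Finset ℕ+) :
    ellOne (r • unitSum B) = r * B.card := by
  rw [ellOne, Finsupp.support_smul_eq hr.ne', support_unitSum,
    Finset.sum_congr rfl (g := fun _ => r)]
  · rw [Finset.sum_const, nsmul_eq_mul, mul_comm]
  · intro i hi
    rw [Finsupp.smul_apply, unitSum_apply, if_pos hi, smul_eq_mul, mul_one, abs_of_pos hr]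

/-- The entropy estimate says that `unitSumBound`, evaluated at the number of points left by a
restriction, is a supersolution of the implicit norm equation. -/
theorem schlumprechtNorm_unitSum_le (B : Finset ℕ+) :
    tsirelsonNorm schlumprechtData (unitSum B) ≤ unitSumBound B.card := by
  have h := tsirelsonNorm_restrict_le_of_step schlumprechtData (unitSum B)
    (fun E => unitSumBound (E ∩ B).card) ?_ ?_ B
  · rwa [restrict_unitSum, Finset.inter_self] at h
  · intro E i
    rw [restrict_unitSum, unitSum_apply]
    split_ifs with hi
    · rw [abs_one]
      exact one_le_unitSumBound (Finset.card_pos.2 ⟨i, hi⟩)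
    · rw [abs_zero]
      exact unitSumBound_nonneg _
  · intro A n E hE hn
    have hn2 : 2 ≤ n := hn
    rw [schlumprecht_weight, one_div, inv_mul_le_iff₀
      (one_pos.trans_le (one_le_logWeight (one_le_two.trans hn2)))]
    refine sum_unitSumBound_le hn2 _ ?_
    simp only [Finset.inter_assoc]
    exact sum_card_inter_le hE _

end UnitSums

/-! ### Superposition of a coarse and a fine scale -/

section OneScale

/-- A non-negative set function that is superadditive on successive sets. -/
def Superadditive (μ : Finset ℕ+ → ℝ) : Prop :=
  (∀ A, 0 ≤ μ A) ∧ ∀ (A : Finset ℕ+) (n : ℕ) (E : Fin n → Finset ℕ+), Successive E →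
    ∑ i, μ (E i ∩ A) ≤ μ A

theorem schlumprechtNorm_family_le {n : ℕ} (hn : 2 ≤ n) {E : Fin n → Finset ℕ+}
    (hE : Successive E) (x : ℕ+ →₀ ℝ) :
    (logWeight n)⁻¹ * ∑ i, tsirelsonNorm schlumprechtData (restrict (E i) x)
      ≤ tsirelsonNorm schlumprechtData x := by
  have h := le_tsirelsonNorm schlumprechtData E hE hn x
  rwa [schlumprecht_weight, one_div] at h

theorem tsirelsonNorm_restrict_add_le (D : TsirelsonData) (E : Finset ℕ+) (v z : ℕ+ →₀ ℝ) :
    tsirelsonNorm D (restrict E (v + z))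
      ≤ tsirelsonNorm D (restrict E v) + tsirelsonNorm D (restrict E z) := by
  rw [restrict_add]
  exact tsirelsonNorm_add_le D _ _

/-- Adding a vector `v` living on one scale to a vector `z` living on much finer scales hardly
increases the norm. -/
theorem schlumprechtNorm_add_le_of_scales {v z : ℕ+ →₀ ℝ} {μ μ' : Finset ℕ+ → ℝ}
    {ε C L α τ η : ℝ} {M d s : ℕ} (hμ : Superadditive μ) (hμ' : Superadditive μ')
    (hC : 4 ≤ C) (hC8 : C ≤ 8) (hα : 0 ≤ α) (hτ : 0 ≤ τ) (hη : 0 ≤ η) (hε : 0 < ε)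
    (hM : 1 ≤ M) (hMε : 8 ≤ ε / 2 * logWeight M) (hd : 16 * (logWeight 2)⁻¹ ^ d ≤ ε / 2)
    (hs : 1 ≤ s) (hsL : L ≤ ε / 2 * logWeight s) (hsη : s * η ≤ τ)
    (hv : ∀ E, tsirelsonNorm schlumprechtData (restrict E v) ≤ 4 * μ E + α)
    (hv0 : ∀ i, |v i| ≤ α) (hv1 : ∀ E, ellOne (restrict E v) ≤ L * μ E)
    (hz : ∀ E, tsirelsonNorm schlumprechtData (restrict E z) ≤ C * μ' E + η)
    (hμμ : ∀ E, μ' E ≤ μ E + τ) (E : Finset ℕ+) :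
    tsirelsonNorm schlumprechtData (restrict E (v + z))
      ≤ (C + ε) * μ E + M ^ d * (α + 10 * τ) := by
  set N := tsirelsonNorm schlumprechtData with hN
  set ρ := (logWeight 2)⁻¹ with hρ
  have hρ0 : 0 < ρ := inv_pos.2 (one_pos.trans one_lt_logWeight_two)
  have hρ1 : ρ ≤ 1 := inv_le_one_of_one_le₀ one_lt_logWeight_two.le
  have hM1 : (1 : ℝ) ≤ M := by exact_mod_cast hM
  have hητ : η ≤ τ := le_trans (le_mul_of_one_le_left hη (by exact_mod_cast hs)) hsη
  -- The constant 9 comes from `C ≤ 8`, which multiplies `τ`, and from `η ≤ τ`.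
  have hzτ : ∀ E, N (restrict E z) ≤ C * μ E + 9 * τ := fun E => by
    have h1 := hz E
    have h2 := mul_le_mul_of_nonneg_left (hμμ E) (by linarith : (0 : ℝ) ≤ C)
    nlinarith
  set a := α + 10 * τ with ha
  have ha0 : 0 ≤ a := by positivity
  -- Each use of the implicit equation improves the excess 16 by the factor `ρ < 1` and worsens the
  -- additive error by at most the factor `M`. After `d` rounds the excess is at most `ε / 2`.
  have key : ∀ k : ℕ, ∀ E, N (restrict E (v + z))
      ≤ (C + ε / 2 + 16 * ρ ^ k) * μ E + M ^ k * a := by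
    intro k
    induction k with
    | zero =>
      intro E
      have h1 := tsirelsonNorm_restrict_add_le schlumprechtData E v z
      have h2 := hv E
      have h3 := hzτ E
      have h4 := hμ.1 E
      rw [← hN] at h1
      rw [pow_zero, pow_zero, mul_one, one_mul]
      nlinarith [mul_nonneg hε.le h4]
    | succ k ih =>
      intro E
      have hμE := hμ.1 E
      have hMk : a ≤ M ^ (k + 1) * a :=
        le_mul_of_one_le_left ha0 (one_le_pow₀ hM1)
      have hbase : ∀ b : ℝ, b ≤ (C + ε / 2) * μ E + a →
          b ≤ (C + ε / 2 + 16 * ρ ^ (k + 1)) * μ E + M ^ (k + 1) * a := fun b hb => by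
        have : 0 ≤ 16 * ρ ^ (k + 1) * μ E := by positivity
        linarith
      refine tsirelsonNorm_le_of schlumprechtData (fun i => hbase _ ?_) fun n F hF hn => ?_
      · rw [restrict_add, Finsupp.add_apply]
        have h1 : |restrict E v i| ≤ α := by
          rw [restrict_apply]
          split_ifs
          · exact hv0 i
          · rwa [abs_zero]
        have h2 := (abs_le_tsirelsonNorm schlumprechtData (restrict E z) i).trans (hzτ E)
        have h3 := abs_add_le (restrict E v i) (restrict E z i)
        nlinarith [mul_nonneg hε.le hμE]
      have hn2 : 2 ≤ n := hn
      have hw1 : 1 ≤ logWeight n := one_le_logWeight (one_le_two.trans hn2)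
      have hw0 : 0 < logWeight n := one_pos.trans_le hw1
      rw [schlumprecht_weight, one_div]
      rcases lt_or_ge n M with hnM | hMn
      -- Few sets: the induction hypothesis is applied to every piece. Superadditivity of `μ`
      -- controls the main term and the weight supplies the factor `ρ`.
      · have hwρ : (logWeight n)⁻¹ ≤ ρ :=
          inv_anti₀ (one_pos.trans one_lt_logWeight_two) (logWeight_mono hn2)
        have hcoef : 0 ≤ C + ε / 2 + 16 * ρ ^ k := by positivity
        have h1 : ∑ i, N (restrict (F i) (restrict E (v + z)))
            ≤ (C + ε / 2 + 16 * ρ ^ k) * μ E + n * (M ^ k * a) := by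
          calc _ ≤ ∑ i, ((C + ε / 2 + 16 * ρ ^ k) * μ (F i ∩ E) + M ^ k * a) := by
                refine Finset.sum_le_sum fun i _ => ?_
                rw [restrict_restrict]
                exact ih _
            _ = (C + ε / 2 + 16 * ρ ^ k) * ∑ i, μ (F i ∩ E) + n * (M ^ k * a) := by
                rw [Finset.sum_add_distrib, Finset.mul_sum, Finset.sum_const, Finset.card_univ,
                  Fintype.card_fin, nsmul_eq_mul]
            _ ≤ _ := by
                gcongr
                exact hμ.2 E n F hF
        have hnM' : (n : ℝ) ≤ M := by exact_mod_cast hnM.le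
        have h2 : (n : ℝ) * (M ^ k * a) ≤ M ^ (k + 1) * a := by
          rw [pow_succ, mul_comm _ (M : ℝ), mul_assoc]
          gcongr
        have h3 : 0 ≤ M ^ (k + 1) * a := by positivity
        calc (logWeight n)⁻¹ * ∑ i, N (restrict (F i) (restrict E (v + z)))
            ≤ ρ * ((C + ε / 2 + 16 * ρ ^ k) * μ E + M ^ (k + 1) * a) := by
              refine mul_le_mul hwρ (h1.trans (by linarith))
                (Finset.sum_nonneg fun i _ => tsirelsonNorm_nonneg _ _) hρ0.le
          _ = ρ * ((C + ε / 2) * μ E) + 16 * ρ ^ (k + 1) * μ E + ρ * (M ^ (k + 1) * a) := by ring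
          _ ≤ 1 * ((C + ε / 2) * μ E) + 16 * ρ ^ (k + 1) * μ E + 1 * (M ^ (k + 1) * a) := by
              have h4 : 0 ≤ (C + ε / 2) * μ E := by positivity
              gcongr
          _ = _ := by ring
      -- Many sets: no induction is needed, because the weight makes the contribution of one of the
      -- two vectors negligible.
      · refine hbase _ ?_
        have hsplit : ∑ i, N (restrict (F i) (restrict E (v + z)))
            ≤ ∑ i, N (restrict (F i) (restrict E v)) + ∑ i, N (restrict (F i) (restrict E z)) := by
          rw [← Finset.sum_add_distrib]
          refine Finset.sum_le_sum fun i _ => ?_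
          rw [restrict_add]
          exact tsirelsonNorm_restrict_add_le _ _ _ _
        refine (mul_le_mul_of_nonneg_left hsplit (inv_nonneg.2 hw0.le)).trans ?_
        rw [mul_add]
        have hv2 := schlumprechtNorm_family_le hn2 hF (restrict E v)
        have hz2 := schlumprechtNorm_family_le hn2 hF (restrict E z)
        rw [← hN] at hv2 hz2
        rcases lt_or_ge n s with hns | hsn
        -- For `M ≤ n < s` the fine vector `z` still looks additive, so its sum is bounded and the
        -- weight of at least `M` sets makes it small; `v` contributes at most its norm.
        · have h1 : ∑ i, N (restrict (F i) (restrict E z)) ≤ 8 * μ E + 9 * τ := by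
            calc _ ≤ ∑ i, (C * μ' (F i ∩ E) + η) := by
                  refine Finset.sum_le_sum fun i _ => ?_
                  rw [restrict_restrict]
                  exact hz _
              _ = C * ∑ i, μ' (F i ∩ E) + n * η := by
                  rw [Finset.sum_add_distrib, Finset.mul_sum, Finset.sum_const, Finset.card_univ,
                    Fintype.card_fin, nsmul_eq_mul]
              _ ≤ 8 * (μ E + τ) + τ := by
                  have hns' : (n : ℝ) * η ≤ s * η :=
                    mul_le_mul_of_nonneg_right (by exact_mod_cast hns.le) hη
                  have h2 := (hμ'.2 E n F hF).trans (hμμ E)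
                  have h3 : 0 ≤ μ E + τ := by positivity
                  nlinarith
              _ = _ := by ring
          have h2 : (logWeight n)⁻¹ * ∑ i, N (restrict (F i) (restrict E z))
              ≤ ε / 2 * μ E + 9 * τ := by
            rw [inv_mul_le_iff₀ hw0]
            refine h1.trans ?_
            have h3 : 8 ≤ ε / 2 * logWeight n :=
              hMε.trans (mul_le_mul_of_nonneg_left (logWeight_mono hMn) (by positivity))
            nlinarith [mul_le_mul_of_nonneg_right h3 hμE]
          have h3 := hv E
          nlinarith
        -- For `n ≥ s` the weight beats even the `ℓ₁` norm of `v`; now `z` contributes at most its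
        -- norm.
        · have h1 : (logWeight n)⁻¹ * ∑ i, N (restrict (F i) (restrict E v)) ≤ ε / 2 * μ E := by
            rw [inv_mul_le_iff₀ hw0]
            refine ((sum_tsirelsonNorm_restrict_le_ellOne _ F hF _).trans (hv1 E)).trans ?_
            have h3 : L ≤ ε / 2 * logWeight n :=
              hsL.trans (mul_le_mul_of_nonneg_left (logWeight_mono hsn) (by positivity))
            nlinarith [mul_le_mul_of_nonneg_right h3 hμE]
          have h2 := hzτ E
          linarith
  refine (key d E).trans ?_
  have := mul_le_mul_of_nonneg_right hd (hμ.1 E)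
  nlinarith

end OneScale

/-! ### Counting points in the span of a set -/

section HullCount

/-- The number of elements of `B` in the interval spanned by `E`. -/
noncomputable def hullCount (B E : Finset ℕ+) : ℕ :=
  (B.filter fun b => (∃ e ∈ E, e ≤ b) ∧ ∃ e ∈ E, b ≤ e).card

theorem card_inter_le_hullCount (B E : Finset ℕ+) : (E ∩ B).card ≤ hullCount B E := by
  refine Finset.card_le_card fun b hb => ?_
  obtain ⟨h1, h2⟩ := Finset.mem_inter.1 hb
  exact Finset.mem_filter.2 ⟨h2, ⟨b, h1, le_rfl⟩, ⟨b, h1, le_rfl⟩⟩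

theorem hullCount_le_card (B E : Finset ℕ+) : hullCount B E ≤ B.card :=
  Finset.card_le_card (Finset.filter_subset _ _)

/-- The intervals spanned by successive sets are disjoint. -/
theorem sum_hullCount_le (B A : Finset ℕ+) {n : ℕ} {E : Fin n → Finset ℕ+} (hE : Successive E) :
    ∑ i, hullCount B (E i ∩ A) ≤ hullCount B A := by
  unfold hullCount
  rw [← Finset.card_biUnion]
  · refine Finset.card_le_card fun b hb => ?_
    obtain ⟨i, -, hi⟩ := Finset.mem_biUnion.1 hb
    obtain ⟨hbB, ⟨e, he, heb⟩, ⟨e', he', hbe⟩⟩ := Finset.mem_filter.1 hi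
    exact Finset.mem_filter.2 ⟨hbB, ⟨e, (Finset.mem_inter.1 he).2, heb⟩,
      ⟨e', (Finset.mem_inter.1 he').2, hbe⟩⟩
  · have key : ∀ i j, i < j → ∀ b, (∃ e ∈ E i ∩ A, b ≤ e) → (∃ e ∈ E j ∩ A, e ≤ b) → False := by
      rintro i j hij b ⟨e, he, hbe⟩ ⟨e', he', heb⟩
      exact absurd (hE i j hij e (Finset.mem_inter.1 he).1 e' (Finset.mem_inter.1 he').1)
        (not_lt.2 (heb.trans hbe))
    intro i _ j _ hij
    refine Finset.disjoint_left.2 fun b hi hj => ?_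
    have hi' := (Finset.mem_filter.1 hi).2
    have hj' := (Finset.mem_filter.1 hj).2
    rcases lt_or_gt_of_ne hij with h | h
    · exact key i j h b hi'.2 hj'.1
    · exact key j i h b hj'.2 hi'.1

/-- Points are counted in the spanned interval rather than in the set itself, because only on
intervals do the counts for a grid and for a refinement control each other. -/
theorem superadditive_hullCount (B : Finset ℕ+) {r : ℝ} (hr : 0 ≤ r) :
    Superadditive fun E => hullCount B E / r := by
  refine ⟨fun A => by positivity, fun A n E hE => ?_⟩
  rw [← Finset.sum_div]
  refine div_le_div_of_nonneg_right ?_ hr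
  exact_mod_cast sum_hullCount_le B A hE

end HullCount

/-! ### Equidistant grids and their normalised sums -/

section Grid

/-- The `m` equidistant points `o + K / m, …, o + K` (shifted to `ℕ+`). -/
noncomputable def grid (o K m : ℕ) : Finset ℕ+ :=
  (Finset.Icc 1 m).image fun s => (o + K / m * s).succPNat

theorem grid_injective {o K m : ℕ} (hK : 0 < K / m) :
    Function.Injective fun s => (o + K / m * s).succPNat := by
  intro s t hst
  have h := Nat.succPNat_injective hst
  exact Nat.eq_of_mul_eq_mul_left hK (Nat.add_left_cancel h)

theorem div_pos_of_dvd {K m : ℕ} (hK : 0 < K) (hm : m ∣ K) : 0 < K / m :=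
  Nat.div_pos (Nat.le_of_dvd hK hm) (Nat.pos_of_dvd_of_pos hm hK)

theorem card_grid {o K m : ℕ} (hK : 0 < K) (hm : m ∣ K) : (grid o K m).card = m := by
  rw [grid, Finset.card_image_of_injective _ (grid_injective (div_pos_of_dvd hK hm)),
    Nat.card_Icc, Nat.add_sub_cancel]

theorem mem_grid_bounds {o K m : ℕ} (hK : 0 < K) (hm : m ∣ K) {b : ℕ+} (hb : b ∈ grid o K m) :
    o + 2 ≤ (b : ℕ) ∧ (b : ℕ) ≤ o + K + 1 := by
  obtain ⟨s, hs, rfl⟩ := Finset.mem_image.1 hb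
  obtain ⟨h1, h2⟩ := Finset.mem_Icc.1 hs
  have h3 := div_pos_of_dvd hK hm
  have h4 : K / m * s ≤ K / m * m := Nat.mul_le_mul_left _ h2
  rw [Nat.div_mul_cancel hm] at h4
  have h5 : 1 * 1 ≤ K / m * s := Nat.mul_le_mul h3 h1
  rw [Nat.succPNat_coe]
  omega

/-- A refinement of a grid is equidistributed with respect to it. -/
theorem hullCount_grid_le {o K m c : ℕ} (hK : 0 < K) (hc : 0 < c) (hm : m * c ∣ K)
    (E : Finset ℕ+) :
    hullCount (grid o K (m * c)) E ≤ c * (hullCount (grid o K m) E + 1) := by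
  have hm' : m ∣ K := (Dvd.intro _ rfl).trans hm
  set e := K / (m * c) with he
  have he0 : 0 < e := div_pos_of_dvd hK hm
  have hde : K / m = e * c := by
    obtain ⟨r, rfl⟩ := hm
    have hmc : 0 < m * c := Nat.pos_of_ne_zero fun h => by simp [h] at hK
    rw [he, Nat.mul_div_cancel_left _ hmc, mul_assoc,
      Nat.mul_div_cancel_left _ (Nat.pos_of_mul_pos_right hmc), mul_comm]
  let Q : ℕ+ → Prop := fun b => (∃ e ∈ E, e ≤ b) ∧ ∃ e ∈ E, b ≤ e
  classical
  set T' := (Finset.Icc 1 (m * c)).filter fun s => Q (o + e * s).succPNat with hT'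
  set T := (Finset.Icc 1 m).filter fun s => Q (o + K / m * s).succPNat with hT
  have h1 : hullCount (grid o K (m * c)) E ≤ T'.card := by
    unfold hullCount grid
    rw [Finset.filter_image]
    refine Finset.card_image_le.trans (le_of_eq ?_)
    rw [hT']
  have h2 : T.card ≤ hullCount (grid o K m) E := by
    unfold hullCount grid
    rw [Finset.filter_image, Finset.card_image_of_injective _
      (grid_injective (div_pos_of_dvd hK hm'))]
  refine h1.trans (le_trans ?_ (Nat.mul_le_mul_left c (Nat.add_le_add_right h2 1)))
  rcases T'.eq_empty_or_nonempty with h0 | hne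
  · rw [h0]; simp
  -- Fine indices are grouped into cells of `c` consecutive ones; the coarse grid points have the
  -- fine indices `c * t`.
  refine (Finset.card_le_mul_card_image (f := fun s => s / c) T' c fun t _ => ?_).trans
    (Nat.mul_le_mul_left c ?_)
  · refine (Finset.card_le_card (t := Finset.Ico (c * t) (c * t + c)) fun s hs => ?_).trans
      (by simp)
    have hst : s / c = t := (Finset.mem_filter.1 hs).2
    subst hst
    have := Nat.div_add_mod s c
    have := Nat.mod_lt s hc
    rw [Finset.mem_Ico]
    omega
  -- For every cell that is met, except the one of the least index, the left end `c * t` lies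
  -- between two fine indices in the span of `E`, so it is a coarse point in that span. The
  -- exceptional cell is the `+ 1`.
  · refine (Finset.card_le_card (t := insert (T'.min' hne / c) T) fun t ht => ?_).trans
      (Finset.card_insert_le _ _)
    obtain ⟨s, hs, rfl⟩ := Finset.mem_image.1 ht
    obtain ⟨hs1, hsQ⟩ := Finset.mem_filter.1 hs
    obtain ⟨-, hqQ⟩ := Finset.mem_filter.1 (T'.min'_mem hne)
    have hqs := T'.min'_le s hs
    set q := T'.min' hne
    rcases (Nat.div_le_div_right (c := c) hqs).eq_or_lt with heq | hlt
    · exact Finset.mem_insert.2 (Or.inl heq.symm)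
    refine Finset.mem_insert_of_mem (Finset.mem_filter.2 ⟨Finset.mem_Icc.2
      ⟨(Nat.zero_le _).trans_lt hlt, ?_⟩, ?_, ?_⟩)
    · exact Nat.div_le_of_le_mul (by rw [mul_comm]; exact (Finset.mem_Icc.1 hs1).2)
    · obtain ⟨x, hx, hxq⟩ := hqQ.1
      refine ⟨x, hx, hxq.trans (Nat.succPNat_le_succPNat.2 (Nat.add_le_add_left ?_ o))⟩
      rw [hde, mul_assoc]
      refine Nat.mul_le_mul_left e ?_
      have h3 := Nat.div_add_mod q c
      have h4 := Nat.mod_lt q hc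
      have h5 : c * (q / c + 1) ≤ c * (s / c) := Nat.mul_le_mul_left c hlt
      rw [mul_add] at h5
      omega
    · obtain ⟨x, hx, hxq⟩ := hsQ.2
      refine ⟨x, hx, le_trans (Nat.succPNat_le_succPNat.2 (Nat.add_le_add_left ?_ o)) hxq⟩
      rw [hde, mul_assoc]
      exact Nat.mul_le_mul_left e (Nat.mul_div_le s c)

/-- The norm of the normalised sum of `m` unit vectors, restricted to a set. -/
theorem schlumprechtNorm_restrict_unitSum_le {B : Finset ℕ+} {m : ℕ} (hm : 1 ≤ m)
    (E : Finset ℕ+) :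
    tsirelsonNorm schlumprechtData (restrict E ((logWeight m / m) • unitSum B))
      ≤ 4 * (hullCount B E / m) + logWeight m / Real.sqrt m := by
  have hm1 : (1 : ℝ) ≤ m := by exact_mod_cast hm
  have hf := one_le_logWeight hm
  have hsq : 0 < Real.sqrt m := Real.sqrt_pos.2 (by linarith)
  have hss : Real.sqrt m * Real.sqrt m = m := Real.mul_self_sqrt (by linarith)
  rw [restrict_smul, restrict_unitSum, tsirelsonNorm_smul, abs_of_nonneg (by positivity)]
  refine (mul_le_mul_of_nonneg_left (schlumprechtNorm_unitSum_le _) (by positivity)).trans ?_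
  set c := (E ∩ B).card with hc
  have hch : (c : ℝ) ≤ hullCount B E := by exact_mod_cast card_inter_le_hullCount B E
  have hl0 := logb_natCast_nonneg c
  -- Fewer than `√m` points have norm at most their number, which gives the error term. With at
  -- least `√m` points, `log₂ c` is at least half of `log₂ m`, which gives the factor 4.
  rcases lt_or_ge (c : ℝ) (Real.sqrt m) with hlt | hge
  · have h1 : unitSumBound c ≤ Real.sqrt m := by
      refine le_trans ?_ hlt.le
      rw [unitSumBound, div_le_iff₀ (by linarith)]
      nlinarith [Nat.cast_nonneg (α := ℝ) c]
    have h2 : logWeight m / m * Real.sqrt m = logWeight m / Real.sqrt m := by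
      rw [div_mul_eq_mul_div, div_eq_div_iff (by positivity) hsq.ne', mul_assoc, hss]
    have h3 : logWeight m / m * unitSumBound c ≤ logWeight m / m * Real.sqrt m := by gcongr
    have h4 : (0 : ℝ) ≤ 4 * (hullCount B E / m) := by positivity
    linarith
  · have hc0 : (0 : ℝ) < c := hsq.trans_le hge
    have h1 : logWeight m ≤ 2 * (Real.logb 2 c + 2) := by
      have h2 : logWeight m ≤ Real.logb 2 (2 * m) :=
        Real.logb_le_logb_of_le one_lt_two (by positivity) (by linarith)
      have h3 : Real.logb 2 m ≤ Real.logb 2 ((c : ℝ) ^ 2) :=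
        Real.logb_le_logb_of_le one_lt_two (by positivity) (by nlinarith)
      rw [Real.logb_mul (by norm_num) (by positivity), Real.logb_self_eq_one one_lt_two] at h2
      rw [Real.logb_pow] at h3
      push_cast at h3
      linarith
    have h5 : logWeight m / m * unitSumBound c ≤ 4 * (c / m) := by
      rw [unitSumBound, div_mul_div_comm, ← mul_div_assoc, div_le_div_iff₀ (by positivity)
        (by positivity)]
      have h6 : 0 ≤ (m : ℝ) * c := by positivity
      nlinarith [mul_le_mul_of_nonneg_left h1 h6]
    have h6 : 4 * ((c : ℝ) / m) ≤ 4 * (hullCount B E / m) := by gcongr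
    have h7 : 0 ≤ logWeight m / Real.sqrt m := by positivity
    linarith

end Grid

/-! ### Choice of the sparse scales -/

section Scales

/-- The error terms of a scale can be made small. -/
theorem exists_scale (ε : ℝ) (hε : 0 < ε) : ∃ M d : ℕ, 1 ≤ M ∧ 8 ≤ ε / 2 * logWeight M ∧
    16 * (logWeight 2)⁻¹ ^ d ≤ ε / 2 ∧ ∀ (h : ℝ) (m₀ i : ℕ), 0 < h → 0 < m₀ →
      ∃ m s : ℕ, m₀ ∣ m ∧ i ≤ m ∧ 1 ≤ s ∧ logWeight m ≤ ε / 2 * logWeight s ∧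
        M ^ d * (logWeight m / Real.sqrt m + 10 * (1 / m)) ≤ h := by
  obtain ⟨M, hM1, hM2⟩ := ((tendsto_logWeight.eventually_ge_atTop (8 / (ε / 2))).and
    (Filter.eventually_ge_atTop 1)).exists
  rw [div_le_iff₀ (by positivity), mul_comm (logWeight M)] at hM1
  obtain ⟨d, hd⟩ := exists_pow_lt_of_lt_one (y := (logWeight 2)⁻¹) (x := ε / 2 / 16)
    (by positivity) (inv_lt_one_of_one_lt₀ one_lt_logWeight_two)
  -- `M` and `d` depend on `ε` alone, so a large `m` absorbs the factor `M ^ d`.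
  refine ⟨M, d, hM2, hM1, by linarith, fun h m₀ i hh hm₀ => ?_⟩
  have hlim : Filter.Tendsto (fun m : ℕ => (M : ℝ) ^ d * (logWeight m / Real.sqrt m + 10 * (1 / m)))
      Filter.atTop (nhds 0) := by
    have h1 : Filter.Tendsto (fun m : ℕ => (1 : ℝ) / m) Filter.atTop (nhds 0) :=
      tendsto_one_div_atTop_nhds_zero_nat
    have h2 : Filter.Tendsto (fun x : ℝ => Real.log x / x ^ (1 / 2 : ℝ)) Filter.atTop (nhds 0) :=
      (isLittleO_log_rpow_atTop (by norm_num : (0 : ℝ) < 1 / 2)).tendsto_div_nhds_zero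
    have h3 : Filter.Tendsto (fun m : ℕ => (1 : ℝ) / Real.sqrt m) Filter.atTop (nhds 0) := by
      simp only [one_div]
      exact (Real.tendsto_sqrt_atTop.comp tendsto_natCast_atTop_atTop).inv_tendsto_atTop
    have h4 : Filter.Tendsto (fun m : ℕ => (1 : ℝ) / Real.sqrt m
        + (Real.log m / (m : ℝ) ^ (1 / 2 : ℝ)) / Real.log 2) Filter.atTop (nhds 0) := by
      have := h3.add ((h2.comp tendsto_natCast_atTop_atTop).div_const (Real.log 2))
      simpa using this
    have h5 : Filter.Tendsto (fun m : ℕ => logWeight m / Real.sqrt m) Filter.atTop (nhds 0) := by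
      refine tendsto_of_tendsto_of_tendsto_of_le_of_le' tendsto_const_nhds h4
        (Filter.Eventually.of_forall fun m => div_nonneg (logWeight_nonneg m) (Real.sqrt_nonneg _)) ?_
      filter_upwards [Filter.eventually_ge_atTop 1] with m hm
      have hm1 : (1 : ℝ) ≤ m := by exact_mod_cast hm
      have h6 : logWeight m ≤ Real.logb 2 (2 * m) :=
        Real.logb_le_logb_of_le one_lt_two (by positivity) (by linarith)
      rw [Real.logb_mul (by norm_num) (by positivity), Real.logb_self_eq_one one_lt_two] at h6
      rw [← Real.sqrt_eq_rpow, div_right_comm, ← add_div]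
      exact div_le_div_of_nonneg_right h6 (Real.sqrt_nonneg _)
    have := (h5.add (h1.const_mul 10)).const_mul ((M : ℝ) ^ d)
    simpa using this
  have hmul : Filter.Tendsto (fun q : ℕ => m₀ * q) Filter.atTop Filter.atTop :=
    Filter.tendsto_id.const_mul_atTop' hm₀
  obtain ⟨q, hq1, hq2⟩ := (((hlim.comp hmul).eventually_le_const hh).and
    (hmul.eventually_ge_atTop i)).exists
  obtain ⟨s, hs1, hs2⟩ := ((tendsto_logWeight.eventually_ge_atTop
    (logWeight (m₀ * q) / (ε / 2))).and (Filter.eventually_ge_atTop 1)).exists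
  rw [div_le_iff₀ (by positivity), mul_comm (logWeight s)] at hs1
  exact ⟨m₀ * q, s, Dvd.intro _ rfl, hq2, hs2, hs1, hq1⟩

/-- A rapidly increasing sequence of scales. -/
theorem exists_scales : ∃ (m s M d : ℕ → ℕ) (h : ℕ → ℝ), h 0 ≤ 1 ∧ ∀ i,
    m i ∣ m (i + 1) ∧ i + 2 ≤ m i ∧ 1 ≤ s i ∧ 1 ≤ M i ∧ 0 < h i ∧
    8 ≤ 2 / 2 ^ i / 2 * logWeight (M i) ∧ 16 * (logWeight 2)⁻¹ ^ d i ≤ 2 / 2 ^ i / 2 ∧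
    logWeight (m i) ≤ 2 / 2 ^ i / 2 * logWeight (s i) ∧
    s i * h (i + 1) ≤ 1 / m i ∧
    M i ^ d i * (logWeight (m i) / Real.sqrt (m i) + 10 * (1 / m i)) ≤ h i := by
  choose M d hM hM8 hd hex using fun i : ℕ => exists_scale (2 / 2 ^ i) (by positivity)
  have hex' : ∀ (i : ℕ) (p : {p : ℝ × ℕ // 0 < p.1 ∧ 0 < p.2}), ∃ m s : ℕ, p.1.2 ∣ m ∧ i + 2 ≤ m ∧
      1 ≤ s ∧ logWeight m ≤ 2 / 2 ^ i / 2 * logWeight s ∧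
      M i ^ d i * (logWeight m / Real.sqrt m + 10 * (1 / m)) ≤ p.1.1 :=
    fun i p => hex i p.1.1 p.1.2 (i + 2) p.2.1 p.2.2
  choose g s hg1 hg2 hs1 hs2 hg3 using hex'
  have hgpos : ∀ i p, 0 < g i p := fun i p => by have := hg2 i p; omega
  -- The state at stage `i` is the tolerance `h i` and the preceding scale, which the new scale must
  -- be a multiple of. The next tolerance `1 / (s i * m i)` is exactly what `s i * h (i + 1) ≤ 1 / m
  -- i` asks for.
  let st : ℕ → {p : ℝ × ℕ // 0 < p.1 ∧ 0 < p.2} := fun i => Nat.rec ⟨(1, 1), one_pos, one_pos⟩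
    (fun i p => ⟨(1 / (s i p * g i p), g i p), by
      have h1 := hgpos i p
      have h2 : 0 < s i p := hs1 i p
      positivity, hgpos i p⟩) i
  refine ⟨fun i => g i (st i), fun i => s i (st i), M, d, fun i => (st i).1.1, le_rfl, fun i =>
    ⟨hg1 (i + 1) (st (i + 1)), hg2 i _, hs1 i _, hM i, (st i).2.1, hM8 i, hd i, hs2 i _, ?_,
      hg3 i _⟩⟩
  have h1 : (0 : ℝ) < g i (st i) := by exact_mod_cast hgpos i (st i)
  have h2 : (0 : ℝ) < s i (st i) := by exact_mod_cast hs1 i (st i)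
  change (s i (st i) : ℝ) * (1 / (s i (st i) * g i (st i))) ≤ _
  refine le_of_eq ?_
  field_simp

end Scales

/-! ### An `ℓ₁` spreading model in Schlumprecht's space -/

section SpreadingModel

/-- The normalised sum over one of the grids of scale `m j` inside an interval of length `m k`. -/
noncomputable def gridVector (m : ℕ → ℕ) (k j : ℕ) : ℕ+ →₀ ℝ :=
  (logWeight (m j) / m j) • unitSum (grid (∑ i ∈ Finset.range k, m i) (m k) (m j))

/-- A vector that has substantial norm on all of the scales `m 0, …, m k`. -/
noncomputable def multiscaleVector (m : ℕ → ℕ) (k : ℕ) : ℕ+ →₀ ℝ :=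
  ∑ j ∈ Finset.Icc 0 k, gridVector m k j

theorem dvd_of_dvd_succ {m : ℕ → ℕ} (h : ∀ i, m i ∣ m (i + 1)) {i k : ℕ} (hik : i ≤ k) :
    m i ∣ m k := by
  induction k, hik using Nat.le_induction with
  | base => exact dvd_rfl
  | succ k _ ih => exact ih.trans (h k)

theorem support_gridVector_subset (m : ℕ → ℕ) (k j : ℕ) :
    (gridVector m k j).support ⊆ grid (∑ i ∈ Finset.range k, m i) (m k) (m j) :=
  Finsupp.support_smul.trans (support_unitSum _).subset

theorem gridVector_nonneg (m : ℕ → ℕ) (k j : ℕ) (b : ℕ+) : 0 ≤ gridVector m k j b := by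
  rw [gridVector, Finsupp.smul_apply, unitSum_apply, smul_eq_mul]
  have := logWeight_nonneg (m j)
  split_ifs <;> positivity

/-- With `o = ∑ i < k, m i`, the `k`-th vector lives on `o + 2, …, o + m k + 1`, and the next window
starts at `o + m k + 2`. -/
theorem successive_multiscaleVector {m : ℕ → ℕ} (hm : ∀ i, m i ∣ m (i + 1))
    (hpos : ∀ i, 0 < m i) : Successive fun k => (multiscaleVector m k).support := by
  have key : ∀ k, ∀ b ∈ (multiscaleVector m k).support,
      ∑ i ∈ Finset.range k, m i + 2 ≤ (b : ℕ) ∧ (b : ℕ) ≤ ∑ i ∈ Finset.range k, m i + m k + 1 := by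
    intro k b hb
    rw [Finsupp.mem_support_iff, multiscaleVector, Finsupp.finsetSum_apply] at hb
    obtain ⟨j, hj, hjb⟩ := Finset.exists_ne_zero_of_sum_ne_zero hb
    exact mem_grid_bounds (hpos k) (dvd_of_dvd_succ hm (Finset.mem_Icc.1 hj).2)
      (support_gridVector_subset m k j (Finsupp.mem_support_iff.2 hjb))
  intro j k hjk a ha b hb
  have h1 := (key j a ha).2
  have h2 := (key k b hb).1
  rw [← Finset.sum_range_succ] at h1
  have h3 : ∑ i ∈ Finset.range (j + 1), m i ≤ ∑ i ∈ Finset.range k, m i :=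
    Finset.sum_le_sum_of_subset (Finset.range_subset_range.2 hjk)
  have h4 : (a : ℕ) < b := by omega
  exact_mod_cast h4

theorem le_multiscaleVector {m : ℕ → ℕ} {j k : ℕ} (hjk : j ≤ k) {b : ℕ+}
    (hb : b ∈ grid (∑ i ∈ Finset.range k, m i) (m k) (m j)) :
    logWeight (m j) / m j ≤ multiscaleVector m k b := by
  rw [multiscaleVector, Finsupp.finsetSum_apply]
  refine le_trans (le_of_eq ?_) (Finset.single_le_sum (f := fun i => gridVector m k i b)
    (fun i _ => gridVector_nonneg m k i b) (Finset.mem_Icc.2 ⟨Nat.zero_le j, hjk⟩))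
  simp only [gridVector, Finsupp.smul_apply, unitSum_apply, if_pos hb, smul_eq_mul, mul_one]

theorem restrict_gridVector (m : ℕ → ℕ) (k j : ℕ) (E : Finset ℕ+) :
    restrict E (gridVector m k j) = (logWeight (m j) / m j) •
      unitSum (E ∩ grid (∑ i ∈ Finset.range k, m i) (m k) (m j)) := by
  rw [gridVector, restrict_smul, restrict_unitSum]

theorem ellOne_restrict_gridVector_le {m : ℕ → ℕ} {k j : ℕ} (hj : 1 ≤ m j) (E : Finset ℕ+) :
    ellOne (restrict E (gridVector m k j)) ≤ logWeight (m j) *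
      (hullCount (grid (∑ i ∈ Finset.range k, m i) (m k) (m j)) E / m j) := by
  have h1 := one_le_logWeight hj
  have h2 : (0 : ℝ) < m j := by exact_mod_cast hj
  rw [restrict_gridVector, ellOne_smul_unitSum (by positivity), div_mul_eq_mul_div,
    mul_div_assoc]
  gcongr
  exact_mod_cast card_inter_le_hullCount _ _

/-- The denominator is weakened from `m j` to its square root so that coordinates and restricted
norms share one error term. -/
theorem abs_gridVector_le {m : ℕ → ℕ} {k j : ℕ} (hj : 1 ≤ m j) (b : ℕ+) :
    |gridVector m k j b| ≤ logWeight (m j) / Real.sqrt (m j) := by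
  have h1 := one_le_logWeight hj
  have h2 : (1 : ℝ) ≤ m j := by exact_mod_cast hj
  rw [abs_of_nonneg (gridVector_nonneg m k j b), gridVector, Finsupp.smul_apply, unitSum_apply,
    smul_eq_mul]
  split_ifs
  · rw [mul_one]
    refine div_le_div_of_nonneg_left (by linarith) (Real.sqrt_pos.2 (by linarith)) ?_
    rw [Real.sqrt_le_left (by linarith)]
    nlinarith
  · rw [mul_zero]
    positivity

/-- Schlumprecht's space has a block sequence generating an `ℓ₁` spreading model. -/
theorem schlumprecht_ellOneSpreading : ∃ x : ℕ → ℕ+ →₀ ℝ,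
    (Successive fun i => (x i).support) ∧
      EllOneSpreading (tsirelsonSeminorm schlumprechtData) (1 / 2) 9 x := by
  obtain ⟨m, s, M, d, h, h01, hall⟩ := exists_scales
  choose hdvd hm hs hM hh hM8 hd hsL hsη hbound using hall
  have hm1 : ∀ i, 1 ≤ m i := fun i => le_trans (by omega) (hm i)
  have hstart : ∀ i, logWeight (m i) / Real.sqrt (m i) ≤ h i := fun i => by
    have hMd : (1 : ℝ) ≤ M i ^ d i := one_le_pow₀ (by exact_mod_cast hM i)
    have h1 : 0 ≤ logWeight (m i) / Real.sqrt (m i) :=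
      div_nonneg (logWeight_nonneg _) (Real.sqrt_nonneg _)
    have h2 : (0 : ℝ) ≤ 10 * (1 / m i) := by positivity
    calc _ ≤ 1 * (logWeight (m i) / Real.sqrt (m i) + 10 * (1 / m i)) := by linarith
      _ ≤ _ := mul_le_mul_of_nonneg_right hMd (by positivity)
      _ ≤ _ := hbound i
  -- Scales are added from the finest, `k`, down to `i`. Adding scale `i` costs `2 / 2 ^ i`, and `4
  -- / 2 ^ (i + 1) + 2 / 2 ^ i = 4 / 2 ^ i`, so the constants never exceed 8.
  have hupper : ∀ k l i, i + l = k → ∀ E, tsirelsonNorm schlumprechtData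
      (restrict E (∑ j ∈ Finset.Icc i k, gridVector m k j)) ≤
        (4 + 4 / 2 ^ i) * (hullCount (grid (∑ i ∈ Finset.range k, m i) (m k) (m i)) E / m i)
          + h i := by
    intro k l
    induction l with
    | zero =>
      intro i hik E
      obtain rfl : i = k := by omega
      rw [Finset.Icc_self, Finset.sum_singleton]
      have h1 := schlumprechtNorm_restrict_unitSum_le (hm1 i) E
        (B := grid (∑ i ∈ Finset.range i, m i) (m i) (m i))
      have h2 : (0 : ℝ) ≤ 4 / 2 ^ i *
        (hullCount (grid (∑ i ∈ Finset.range i, m i) (m i) (m i)) E / m i) := by positivity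
      have h3 := hstart i
      rw [gridVector]
      linarith
    | succ l ih =>
      intro i hik E
      have hik' : i + 1 ≤ k := by omega
      rw [← Finset.insert_Icc_add_one_left_eq_Icc (by omega : i ≤ k), Finset.sum_insert (by simp)]
      have hpi : (0 : ℝ) < m i := by exact_mod_cast hm1 i
      obtain ⟨c, hc⟩ := hdvd i
      have hc0 : 0 < c := Nat.pos_of_ne_zero fun h0 => by
        have := hm1 (i + 1)
        rw [hc, h0] at this
        omega
      have hcomp := fun E => hullCount_grid_le (o := ∑ i ∈ Finset.range k, m i) (hm1 k) hc0
        (by rw [← hc]; exact dvd_of_dvd_succ hdvd hik') E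
      have hstep := schlumprechtNorm_add_le_of_scales
        (superadditive_hullCount (grid (∑ i ∈ Finset.range k, m i) (m k) (m i)) hpi.le)
        (superadditive_hullCount (grid (∑ i ∈ Finset.range k, m i) (m k) (m (i + 1)))
          (Nat.cast_nonneg (m (i + 1))))
        (ε := 2 / 2 ^ i) (C := 4 + 4 / 2 ^ (i + 1)) (τ := 1 / m i) (η := h (i + 1))
        (L := logWeight (m i)) (α := logWeight (m i) / Real.sqrt (m i))
        (by linarith [show (0 : ℝ) ≤ 4 / 2 ^ (i + 1) by positivity])
        (by
          have : (4 : ℝ) / 2 ^ (i + 1) ≤ 4 :=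
            div_le_self (by norm_num) (one_le_pow₀ (by norm_num))
          linarith)
        (div_nonneg (logWeight_nonneg _) (Real.sqrt_nonneg _)) (by positivity) (hh _).le
        (by positivity) (hM i) (hM8 i) (hd i) (hs i) (hsL i) (hsη i)
        (fun E => schlumprechtNorm_restrict_unitSum_le (hm1 i) E)
        (fun b => abs_gridVector_le (hm1 i) b)
        (fun E => ellOne_restrict_gridVector_le (hm1 i) E)
        (ih (i + 1) (by omega))
        (fun E => by
          have h1 := hcomp E
          rw [← hc] at h1
          have h2 : (m (i + 1) : ℝ) = m i * c := by exact_mod_cast hc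
          have hc0' : (0 : ℝ) < c := by exact_mod_cast hc0
          have h3 : (hullCount (grid (∑ i ∈ Finset.range k, m i) (m k) (m (i + 1))) E : ℝ)
              ≤ c * (hullCount (grid (∑ i ∈ Finset.range k, m i) (m k) (m i)) E + 1) := by
            exact_mod_cast h1
          rw [← add_div, h2, div_le_div_iff₀ (by positivity) hpi]
          nlinarith [mul_le_mul_of_nonneg_right h3 hpi.le])
        E
      refine hstep.trans (add_le_add (le_of_eq ?_) (hbound i))
      rw [pow_succ]
      congr 1
      field_simp
      ring
  -- At `i = 0` the bound is `8 * 1 + h 0 ≤ 9`.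
  have hnorm : ∀ k, tsirelsonNorm schlumprechtData (multiscaleVector m k) ≤ 9 := by
    intro k
    have h1 := hupper k k 0 (by omega) (multiscaleVector m k).support
    have hpi : (0 : ℝ) < m 0 := by exact_mod_cast hm1 0
    have h2 : (hullCount (grid (∑ i ∈ Finset.range k, m i) (m k) (m 0))
        (multiscaleVector m k).support : ℝ) / m 0 ≤ 1 := by
      rw [div_le_one hpi]
      have := hullCount_le_card (grid (∑ i ∈ Finset.range k, m i) (m k) (m 0))
        (multiscaleVector m k).support
      rw [card_grid (hm1 k) (dvd_of_dvd_succ hdvd (Nat.zero_le k))] at this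
      exact_mod_cast this
    change tsirelsonNorm schlumprechtData (restrict _ (multiscaleVector m k)) ≤ _ at h1
    rw [restrict_eq_self subset_rfl] at h1
    norm_num at h1
    linarith
  have hsucc := successive_multiscaleVector hdvd (fun i => hm1 i)
  refine ⟨multiscaleVector m, hsucc, fun F hF a => ⟨?_, ?_⟩⟩
  · rcases F.eq_empty_or_nonempty with rfl | hne
    · simp
    set n := F.card with hn
    have hn0 : 0 < n := Finset.card_pos.2 hne
    -- A Schreier set of `n` indices has all its indices at least `n - 1`, so every vector involved
    -- carries a grid of scale `i`, and `n ≤ m i`.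
    set i := n - 1 with hi
    have hiF : ∀ j ∈ F, i ≤ j := fun j hj => by have := hF j hj; omega
    have hnm : n ≤ m i := by have := hm i; omega
    have hgrid : ∀ j ∈ F, (grid (∑ l ∈ Finset.range j, m l) (m j) (m i)).card = m i :=
      fun j hj => card_grid (hm1 j) (dvd_of_dvd_succ hdvd (hiF j hj))
    have hpos : (0 : ℝ) < m i := by exact_mod_cast hm1 i
    have hfpos : 0 < logWeight (m i) := one_pos.trans_le (one_le_logWeight (hm1 i))
    have hsub : ∀ j ∈ F, ∀ b ∈ grid (∑ l ∈ Finset.range j, m l) (m j) (m i),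
        b ∈ (multiscaleVector m j).support := fun j hj b hb =>
      Finsupp.mem_support_iff.2
        ((by positivity : (0 : ℝ) < logWeight (m i) / m i).trans_le
          (le_multiscaleVector (hiF j hj) hb)).ne'
    have hpd : (F : Set ℕ).PairwiseDisjoint fun j =>
        grid (∑ l ∈ Finset.range j, m l) (m j) (m i) := fun j hj l hl hjl =>
      Finset.disjoint_left.2 fun b hb hb' =>
        hjl (successive_eq_of_mem hsucc (hsub j hj b hb) (hsub l hl b hb'))
    set A := F.biUnion fun j => grid (∑ l ∈ Finset.range j, m l) (m j) (m i) with hA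
    have hAcard : A.card = n * m i := by
      rw [hA, Finset.card_biUnion hpd, Finset.sum_congr rfl hgrid, Finset.sum_const, smul_eq_mul]
    have h1 := sum_abs_le_logWeight_mul A (by
      rw [hAcard]
      have := hm i
      nlinarith) (∑ j ∈ F, a j • multiscaleVector m j)
    -- The norm is tested on all `n * m i` points of scale `i` at once; the factor 2 here is the
    -- lower constant `1 / 2`.
    have h2 : logWeight A.card ≤ 2 * logWeight (m i) := by
      rw [hAcard]
      have := logWeight_mono hnm
      have := logWeight_mul_le (m := n) (n := m i)
      linarith
    have h3 : logWeight (m i) * ∑ j ∈ F, |a j|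
        ≤ ∑ b ∈ A, |(∑ j ∈ F, a j • multiscaleVector m j) b| := by
      rw [hA, Finset.sum_biUnion hpd, Finset.mul_sum]
      refine Finset.sum_le_sum fun j hj => ?_
      have h4 : ∀ b ∈ grid (∑ l ∈ Finset.range j, m l) (m j) (m i), |a j| * (logWeight (m i) / m i)
          ≤ |(∑ j ∈ F, a j • multiscaleVector m j) b| := by
        intro b hb
        rw [Finsupp.finsetSum_apply, Finset.sum_eq_single_of_mem j hj]
        · rw [Finsupp.smul_apply, smul_eq_mul, abs_mul]
          exact mul_le_mul_of_nonneg_left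
            ((le_multiscaleVector (hiF j hj) hb).trans (le_abs_self _)) (abs_nonneg _)
        · intro l _ hlj
          rw [Finsupp.smul_apply, smul_eq_mul]
          refine mul_eq_zero_of_right _ ?_
          by_contra hne
          exact hlj (successive_eq_of_mem hsucc (Finsupp.mem_support_iff.2 hne) (hsub j hj b hb))
      refine le_trans (le_of_eq ?_) (Finset.card_nsmul_le_sum _ _ _ h4)
      rw [hgrid j hj, nsmul_eq_mul]
      field_simp
    have h4 := tsirelsonNorm_nonneg schlumprechtData (∑ j ∈ F, a j • multiscaleVector m j)
    rw [tsirelsonSeminorm_apply]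
    have h5 := h3.trans (h1.trans (mul_le_mul_of_nonneg_right h2 h4))
    rw [mul_comm 2, mul_assoc] at h5
    linarith [le_of_mul_le_mul_left h5 hfpos]
  · refine (seminorm_sum_le _ F _).trans ?_
    rw [Finset.mul_sum]
    refine Finset.sum_le_sum fun i _ => ?_
    rw [map_smul_eq_mul, Real.norm_eq_abs, mul_comm]
    exact mul_le_mul_of_nonneg_right (hnorm i) (abs_nonneg _)

end SpreadingModel

/-! ### Averages of successive vectors -/

section Averages

variable (D : TsirelsonData)

/-- `w` is the average of `N` successive vectors of norm at most one. -/
def IsAverage (N : ℕ) (w : ℕ+ →₀ ℝ) : Prop :=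
  ∃ u : Fin N → ℕ+ →₀ ℝ, (Successive fun j => (u j).support) ∧
    (∀ j, tsirelsonNorm D (u j) ≤ 1) ∧ w = (N : ℝ)⁻¹ • ∑ j, u j

/-- Few pairs of sets from two successive families meet. -/
theorem sum_card_meeting_le {n N : ℕ} {E : Fin n → Finset ℕ+} {U : Fin N → Finset ℕ+}
    (hE : Successive E) (hU : Successive U) (A : Finset ℕ+) :
    ∑ i, (Finset.univ.filter fun j => ∃ a ∈ E i ∩ A, a ∈ U j).card
      ≤ (Finset.univ.filter fun j => ∃ a ∈ A, a ∈ U j).card + n := by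
  classical
  set R : Fin n → Finset (Fin N) := fun i =>
    Finset.univ.filter fun j => ∃ a ∈ E i ∩ A, a ∈ U j with hR
  set J : Finset (Fin N) := Finset.univ.filter fun j => ∃ a ∈ A, a ∈ U j
  have hmono : ∀ i i', i < i' → ∀ j ∈ R i, ∀ j' ∈ R i', j ≤ j' := by
    intro i i' hii j hj j' hj'
    obtain ⟨a, ha, haj⟩ := (Finset.mem_filter.1 hj).2
    obtain ⟨a', ha', haj'⟩ := (Finset.mem_filter.1 hj').2
    by_contra hlt
    have h1 := hE i i' hii a (Finset.mem_inter.1 ha).1 a' (Finset.mem_inter.1 ha').1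
    have h2 := hU j' j (not_le.1 hlt) a' haj' a haj
    exact lt_asymm h1 h2
  -- By `hmono` the sets `R i` overlap at most at their ends; deleting the least element of each
  -- makes them disjoint. The deleted elements account for the term `n`.
  have hcard : ∀ i, (R i).card ≤ ((R i).filter fun j => ∃ j' ∈ R i, j' < j).card + 1 := by
    intro i
    rw [← Finset.card_filter_add_card_filter_not (s := R i) (fun j => ∃ j' ∈ R i, j' < j)]
    refine Nat.add_le_add_left (Finset.card_le_one.2 fun j hj j' hj' => ?_) _
    obtain ⟨hj1, hj2⟩ := Finset.mem_filter.1 hj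
    obtain ⟨hj1', hj2'⟩ := Finset.mem_filter.1 hj'
    push Not at hj2 hj2'
    exact le_antisymm (hj2 j' hj1') (hj2' j hj1)
  refine (Finset.sum_le_sum fun i _ => hcard i).trans ?_
  rw [Finset.sum_add_distrib, Finset.sum_const, Finset.card_univ, Fintype.card_fin, smul_eq_mul,
    mul_one, ← Finset.card_biUnion]
  · refine Nat.add_le_add_right (Finset.card_le_card fun j hj => ?_) n
    obtain ⟨i, -, hi⟩ := Finset.mem_biUnion.1 hj
    obtain ⟨a, ha, haj⟩ := (Finset.mem_filter.1 (Finset.mem_filter.1 hi).1).2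
    exact Finset.mem_filter.2 ⟨Finset.mem_univ _, a, (Finset.mem_inter.1 ha).2, haj⟩
  · have key : ∀ i i', i < i' → ∀ j, j ∈ R i → (∃ j' ∈ R i', j' < j) → False := by
      rintro i i' hii j hj ⟨j', hj', hlt⟩
      exact absurd (hmono i i' hii j hj j' hj') (not_le.2 hlt)
    intro i _ i' _ hii
    refine Finset.disjoint_left.2 fun j hj hj' => ?_
    obtain ⟨h1, h2⟩ := Finset.mem_filter.1 hj
    obtain ⟨h1', h2'⟩ := Finset.mem_filter.1 hj'
    rcases lt_or_gt_of_ne hii with h | h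
    · exact key i i' h j h1 h2'
    · exact key i' i h j h1' h2

/-- The norm of the restrictions of an average is controlled by an almost superadditive set
function. -/
theorem IsAverage.exists_measure {N : ℕ} {w : ℕ+ →₀ ℝ} (hw : IsAverage D N w) (hN : 1 ≤ N) :
    ∃ μ : Finset ℕ+ → ℝ, (∀ A, 0 ≤ μ A ∧ μ A ≤ 1) ∧
      (∀ A, tsirelsonNorm D (restrict A w) ≤ μ A) ∧
      ∀ (A : Finset ℕ+) (n : ℕ) (E : Fin n → Finset ℕ+), Successive E →
        ∑ i, μ (E i ∩ A) ≤ μ A + n / N := by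
  classical
  obtain ⟨u, hu, hu1, rfl⟩ := hw
  have hN0 : (0 : ℝ) < N := by exact_mod_cast hN
  -- The set function is the proportion of the vectors `u j` whose support meets `A`.
  refine ⟨fun A => (Finset.univ.filter fun j => ∃ a ∈ A, a ∈ (u j).support).card / N,
    fun A => ⟨by positivity, ?_⟩, fun A => ?_, fun A n E hE => ?_⟩
  · rw [div_le_one hN0]
    exact_mod_cast (Finset.card_filter_le _ _).trans (by simp)
  · rw [restrict_smul, tsirelsonNorm_smul, abs_of_pos (inv_pos.2 hN0), inv_mul_eq_div,
      restrict_sum]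
    refine div_le_div_of_nonneg_right ((tsirelsonNorm_sum_le D _ _).trans ?_) hN0.le
    rw [Finset.card_filter, Nat.cast_sum]
    refine Finset.sum_le_sum fun j _ => ?_
    split_ifs with h
    · rw [Nat.cast_one]
      exact (tsirelsonNorm_restrict_le D A (u j)).trans (hu1 j)
    · rw [restrict_eq_zero, tsirelsonNorm_zero, Nat.cast_zero]
      exact Finset.disjoint_left.2 fun a ha ha' => h ⟨a, ha, ha'⟩
  · rw [← Finset.sum_div, ← add_div]
    refine div_le_div_of_nonneg_right ?_ hN0.le
    exact_mod_cast sum_card_meeting_le hE hu A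

theorem IsAverage.norm_le_one {N : ℕ} {w : ℕ+ →₀ ℝ} (hw : IsAverage D N w) (hN : 1 ≤ N) :
    tsirelsonNorm D w ≤ 1 := by
  obtain ⟨μ, h1, h2, -⟩ := hw.exists_measure D hN
  have := (h2 w.support).trans (h1 _).2
  rwa [restrict_eq_self subset_rfl] at this

/-- An average of many vectors is almost additive under splitting into far fewer pieces: only about
`n` of the `N` summands are cut by the sets. -/
theorem IsAverage.sum_family_le {N : ℕ} {w : ℕ+ →₀ ℝ} (hw : IsAverage D N w) (hN : 1 ≤ N)
    {n : ℕ} {E : Fin n → Finset ℕ+} (hE : Successive E) :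
    ∑ i, tsirelsonNorm D (restrict (E i) w) ≤ 1 + n / N := by
  obtain ⟨μ, h1, h2, h3⟩ := hw.exists_measure D hN
  calc ∑ i, tsirelsonNorm D (restrict (E i) w) ≤ ∑ i, μ (E i ∩ w.support) := by
        refine Finset.sum_le_sum fun i _ => ?_
        refine le_trans (le_of_eq ?_) (h2 _)
        rw [← restrict_restrict, restrict_eq_self subset_rfl]
    _ ≤ μ w.support + n / N := h3 _ n E hE
    _ ≤ 1 + n / N := by linarith [(h1 w.support).2]

theorem sum_range_sum_Ico {M : Type*} [AddCommMonoid M] (f : ℕ → M) (s L n : ℕ) :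
    ∑ j ∈ Finset.range n, ∑ i ∈ Finset.Ico (s + j * L) (s + (j + 1) * L), f i
      = ∑ i ∈ Finset.Ico s (s + n * L), f i := by
  induction n with
  | zero => simp
  | succ n ih =>
    rw [Finset.sum_range_succ, ih]
    exact Finset.sum_Ico_consecutive f (by omega)
      (by rw [add_mul]; omega)

/-- Long sums of a block sequence contain averages of almost maximal norm. -/
theorem exists_average {b : ℕ → ℕ+ →₀ ℝ} (hb : Successive fun i => (b i).support)
    (hb1 : ∀ i, tsirelsonNorm D (b i) ≤ 1) {ε : ℝ} (hε1 : ε < 1) {N k s : ℕ}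
    (hN : 1 ≤ N) (hs : (1 - ε) ^ k * (N ^ k : ℕ)
      < tsirelsonNorm D (∑ i ∈ Finset.Ico s (s + N ^ k), b i)) :
    ∃ (w : ℕ+ →₀ ℝ) (c : ℕ → ℝ), IsAverage D N w ∧ 1 - ε ≤ tsirelsonNorm D w ∧
      w = ∑ i ∈ Finset.Ico s (s + N ^ k), c i • b i := by
  by_contra hcon
  push Not at hcon
  have h1ε : 0 < 1 - ε := by linarith
  have hN0 : (0 : ℝ) < N := by exact_mod_cast hN
  -- If all averages had norm below `1 - ε`, then each `N`-fold blocking would lose a factor `1 -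
  -- ε`, and after `k` blockings the sum of `N ^ k` vectors would violate `hs`.
  have key : ∀ l ≤ k, ∀ s', s ≤ s' → s' + N ^ l ≤ s + N ^ k →
      tsirelsonNorm D (∑ i ∈ Finset.Ico s' (s' + N ^ l), b i) ≤ (1 - ε) ^ l * (N ^ l : ℕ) := by
    intro l
    induction l with
    | zero =>
      intro _ s' _ _
      simpa using hb1 s'
    | succ l ih =>
      intro hl s' hs1 hs2
      set r : ℝ := ((1 - ε) ^ l * (N ^ l : ℕ))⁻¹ with hr
      have hr0 : 0 < r := by rw [hr]; positivity
      set I : ℕ → Finset ℕ := fun j => Finset.Ico (s' + j * N ^ l) (s' + (j + 1) * N ^ l) with hI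
      have hIlen : ∀ j, s' + (j + 1) * N ^ l = s' + j * N ^ l + N ^ l := fun j => by ring
      have hpow : N ^ (l + 1) = N * N ^ l := by rw [pow_succ, mul_comm]
      set w : ℕ+ →₀ ℝ := (N : ℝ)⁻¹ • ∑ j : Fin N, ∑ i ∈ I j, r • b i with hw
      have hwsum : w = ((N : ℝ)⁻¹ * r) • ∑ i ∈ Finset.Ico s' (s' + N ^ (l + 1)), b i := by
        rw [hw, mul_smul, hpow, ← sum_range_sum_Ico, Finset.sum_range]
        congr 1
        simp only [Finset.smul_sum, hI]
      have havg : IsAverage D N w := by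
        refine ⟨fun j => ∑ i ∈ I j, r • b i, ?_, ?_, rfl⟩
        · have := successive_blocks hb (F := I) (fun i j hij a ha a' ha' => by
            have h1 := (Finset.mem_Ico.1 ha).2
            have h2 := (Finset.mem_Ico.1 ha').1
            have h3 : (i + 1) * N ^ l ≤ j * N ^ l := Nat.mul_le_mul_right _ hij
            omega) (fun _ _ => r)
          exact fun i j hij => this i j hij
        · intro j
          beta_reduce
          rw [← Finset.smul_sum, tsirelsonNorm_smul, abs_of_pos hr0, hr,
            inv_mul_le_iff₀ (by positivity), mul_one, hI]
          dsimp only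
          rw [hIlen]
          have h1 : ((j : ℕ) + 1) * N ^ l ≤ N * N ^ l := Nat.mul_le_mul_right _ j.2
          rw [add_mul, one_mul] at h1
          exact ih (by omega) _ (by omega) (by omega)
      have hlt : tsirelsonNorm D w < 1 - ε := by
        by_contra hge
        -- The average lives on a subinterval; its coefficients are extended by zero.
        refine hcon w (fun i => if i ∈ Finset.Ico s' (s' + N ^ (l + 1)) then (N : ℝ)⁻¹ * r else 0)
          havg (not_lt.1 hge) ?_
        rw [hwsum, Finset.smul_sum]
        refine Finset.sum_subset_zero_on_sdiff (Finset.Ico_subset_Ico hs1 hs2) ?_ ?_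
        · intro i hi
          rw [if_neg (Finset.mem_sdiff.1 hi).2, zero_smul]
        · intro i hi
          rw [if_pos hi]
      rw [hwsum, tsirelsonNorm_smul, abs_of_pos (by positivity), hr, ← mul_inv,
        inv_mul_lt_iff₀ (by positivity)] at hlt
      refine hlt.le.trans (le_of_eq ?_)
      push_cast
      ring
  exact absurd (key k le_rfl s le_rfl le_rfl) (not_le.2 hs)

end Averages

/-! ### Rapidly increasing sequences of averages -/

section RapidlyIncreasing

variable (D : TsirelsonData)

/-- Beyond some index, all long intervals of the sequence carry averages of `N` vectors of norm
at least `1 - ε`. -/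
def HasAverages (b : ℕ → ℕ+ →₀ ℝ) (ε : ℝ) : Prop :=
  ∀ N : ℕ, 2 ≤ N → ∃ L : ℕ, 1 ≤ L ∧ ∀ s, L ≤ s → ∃ (w : ℕ+ →₀ ℝ) (c : ℕ → ℝ),
    IsAverage D N w ∧ 1 - ε ≤ tsirelsonNorm D w ∧ w = ∑ i ∈ Finset.Ico s (s + L), c i • b i

/-- `w` is a rapidly increasing sequence of averages: `w j` is an average of `N j` vectors in the
span of `b i`, `s j ≤ i < s j + L j`, supported in `{1, …, B j}`. -/
structure IsRapidlyIncreasing (b : ℕ → ℕ+ →₀ ℝ) (ε : ℝ) (n₀ : ℕ) (Φ : ℕ → ℕ)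
    (N L s B : ℕ → ℕ) (w : ℕ → ℕ+ →₀ ℝ) : Prop where
  le_N : ∀ j, n₀ ≤ N j
  le_s : ∀ j, n₀ ≤ s j
  one_le_L : ∀ j, 1 ≤ L j
  L_le_s : ∀ j, L j ≤ s j
  isAverage : ∀ j, IsAverage D (N j) (w j)
  le_norm : ∀ j, 1 - ε ≤ tsirelsonNorm D (w j)
  eq_sum : ∀ j, ∃ c : ℕ → ℝ, w j = ∑ i ∈ Finset.Ico (s j) (s j + L j), c i • b i
  support_le : ∀ j, ∀ k ∈ (w j).support, (k : ℕ) ≤ B j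
  N_growth : ∀ i j, i < j → Φ (B i) ≤ N j
  s_growth : ∀ i j, i < j → s i + L i ≤ s j

/-- Each stage is encoded by the finite set of its parameters `N`, `s`, `s + L` and `Φ B + B`;
choosing these sets successively yields both growth conditions at once. The summand `B`, taken at
least the prescribed bound, only pushes the last parameter beyond that bound. -/
theorem exists_isRapidlyIncreasing {b : ℕ → ℕ+ →₀ ℝ} {ε : ℝ} (h : HasAverages D b ε)
    (n₀ : ℕ) (Φ : ℕ → ℕ) :
    ∃ (N L s B : ℕ → ℕ) (w : ℕ → ℕ+ →₀ ℝ), IsRapidlyIncreasing D b ε n₀ Φ N L s B w := by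
  obtain ⟨p, hp1, hp2⟩ := exists_successive_choice (α := (ℕ × ℕ × ℕ × ℕ) × (ℕ+ →₀ ℝ))
    (fun p => {p.1.1, p.1.2.2.1, p.1.2.2.1 + p.1.2.1, Φ p.1.2.2.2 + p.1.2.2.2})
    (fun p => 1 ≤ p.1.2.1 ∧ p.1.2.1 ≤ p.1.2.2.1 ∧ IsAverage D p.1.1 p.2 ∧
      1 - ε ≤ tsirelsonNorm D p.2 ∧
      (∃ c : ℕ → ℝ, p.2 = ∑ i ∈ Finset.Ico p.1.2.2.1 (p.1.2.2.1 + p.1.2.1), c i • b i) ∧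
      ∀ k ∈ p.2.support, (k : ℕ) ≤ p.1.2.2.2) (by
      intro M
      obtain ⟨L, hL, hL2⟩ := h (max M 2) (le_max_right _ _)
      obtain ⟨w, c, hw1, hw2, hw3⟩ := hL2 (max L M) (le_max_left _ _)
      refine ⟨((max M 2, L, max L M, max M (w.support.sup fun k => (k : ℕ))), w),
        ⟨hL, le_max_left _ _, hw1, hw2, ⟨c, hw3⟩, fun k hk => ?_⟩, ?_⟩
      · exact le_max_of_le_right (Finset.le_sup (f := fun k : ℕ+ => (k : ℕ)) hk)
      · intro m hm
        simp only [Finset.mem_insert, Finset.mem_singleton] at hm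
        have h1 := le_max_left M 2
        have h2 := le_max_right L M
        have h3 := le_max_left M (w.support.sup fun k => (k : ℕ))
        rcases hm with rfl | rfl | rfl | rfl <;> omega)
    (fun _ => n₀)
  refine ⟨fun j => (p j).1.1, fun j => (p j).1.2.1, fun j => (p j).1.2.2.1,
    fun j => (p j).1.2.2.2, fun j => (p j).2, ?_⟩
  refine ⟨fun j => (hp1 j).2 _ (by simp), fun j => (hp1 j).2 _ (by simp), fun j => (hp1 j).1.1,
    fun j => (hp1 j).1.2.1, fun j => (hp1 j).1.2.2.1, fun j => (hp1 j).1.2.2.2.1,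
    fun j => (hp1 j).1.2.2.2.2.1, fun j => (hp1 j).1.2.2.2.2.2, fun i j hij => ?_,
    fun i j hij => ?_⟩
  · have := hp2 i j hij (Φ (p i).1.2.2.2 + (p i).1.2.2.2) (by simp) (p j).1.1 (by simp)
    omega
  · exact (hp2 i j hij ((p i).1.2.2.1 + (p i).1.2.1) (by simp) (p j).1.2.2.1 (by simp)).le

variable {D} {b : ℕ → ℕ+ →₀ ℝ} {ε : ℝ} {n₀ : ℕ} {Φ : ℕ → ℕ} {N L s B : ℕ → ℕ}
  {w : ℕ → ℕ+ →₀ ℝ}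

theorem IsRapidlyIncreasing.successive (hw : IsRapidlyIncreasing D b ε n₀ Φ N L s B w)
    (hb : Successive fun i => (b i).support) : Successive fun j => (w j).support := by
  choose c hc using hw.eq_sum
  have := successive_blocks hb (F := fun j => Finset.Ico (s j) (s j + L j))
    (fun i j hij a ha a' ha' => by
      have h1 := (Finset.mem_Ico.1 ha).2
      have h2 := (Finset.mem_Ico.1 ha').1
      have h3 := hw.s_growth i j hij
      omega) c
  simpa only [← hc] using this

/-- The index set of the first `n` vectors of a rapidly increasing sequence. -/
def indexSet (L s : ℕ → ℕ) (n : ℕ) : Finset ℕ+ :=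
  Finset.univ.biUnion fun j : Fin n =>
    (Finset.Ico (s j) (s j + L j)).map ⟨Nat.succPNat, Nat.succPNat_injective⟩

/-- Each interval has `L j ≤ s j` elements and starts at `s j + 1`, so it is in `𝓢₁`; there are `n ≤
n₀ ≤ s j` of them, so their minima form a set of `𝓢₁` too. -/
theorem IsRapidlyIncreasing.indexSet_mem (hw : IsRapidlyIncreasing D b ε n₀ Φ N L s B w) {n : ℕ}
    (hn : n ≤ n₀) : indexSet L s n ∈ compFamily schreierOne schreierOne := by
  have hmem : ∀ (j : ℕ) (k : ℕ+), k ∈ (Finset.Ico (s j) (s j + L j)).map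
      ⟨Nat.succPNat, Nat.succPNat_injective⟩ → s j + 1 ≤ (k : ℕ) ∧ (k : ℕ) ≤ s j + L j := by
    intro j k hk
    obtain ⟨i, hi, rfl⟩ := Finset.mem_map.1 hk
    obtain ⟨h1, h2⟩ := Finset.mem_Ico.1 hi
    simp only [Function.Embedding.coeFn_mk, Nat.succPNat_coe]
    omega
  have hne : ∀ j : Fin n, ((Finset.Ico (s j) (s j + L j)).map
      ⟨Nat.succPNat, Nat.succPNat_injective⟩).Nonempty := fun j => by
    rw [Finset.map_nonempty, Finset.nonempty_Ico]
    have := hw.one_le_L j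
    omega
  refine ⟨n, fun j => (Finset.Ico (s j) (s j + L j)).map ⟨Nat.succPNat, Nat.succPNat_injective⟩,
    hne, ?_, ?_, ?_, rfl⟩
  · intro i j hij a ha a' ha'
    have h1 := (hmem i a ha).2
    have h2 := (hmem j a' ha').1
    have h3 := hw.s_growth i j hij
    have : (a : ℕ) < a' := by omega
    exact_mod_cast this
  · intro j k hk
    rw [Finset.card_map, Nat.card_Ico]
    have h1 := (hmem j k hk).1
    have h2 := hw.L_le_s j
    omega
  · intro k hk
    refine Finset.card_image_le.trans ?_
    rw [Finset.card_univ, Fintype.card_fin]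
    obtain ⟨j, -, rfl⟩ := Finset.mem_image.1 hk
    have h1 := (hmem j _ (Finset.min'_mem _ (hne j))).1
    have h2 := hw.le_s j
    exact le_trans (by omega) h1

end RapidlyIncreasing

/-! ### The distorting norm -/

section DistortingNorm

variable (D : TsirelsonData)

/-- The coordinate projection onto a finite set. -/
noncomputable def coordProj (E : Finset ℕ+) : TsirelsonSpace D →ₗ[ℝ] TsirelsonSpace D :=
  ∑ i ∈ E, ((coordFunctional D i).toLinearMap.smulRight (unitVector D i : TsirelsonSpace D))

theorem coordProj_apply (E : Finset ℕ+) (z : TsirelsonSpace D) :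
    coordProj D E z = ∑ i ∈ E, coordFunctional D i z • (unitVector D i : TsirelsonSpace D) := by
  simp [coordProj, LinearMap.sum_apply]

theorem coordProj_embed (E : Finset ℕ+) (x : ℕ+ →₀ ℝ) :
    coordProj D E (embed D x) = embed D (restrict E x) := by
  have h := sum_preCoord D E (toPre D x)
  rw [coordProj_apply, embed_apply, embed_apply]
  change _ = ((toPre D (restrict E (ofPre D (toPre D x))) : PreSpace D) : TsirelsonSpace D)
  rw [← h, ← UniformSpace.Completion.coe_toComplL (𝕜 := ℝ), map_sum]
  refine Finset.sum_congr rfl fun i _ => ?_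
  rw [map_smul, UniformSpace.Completion.coe_toComplL, coordFunctional_coe]

theorem norm_coordProj_le (E : Finset ℕ+) (z : TsirelsonSpace D) : ‖coordProj D E z‖ ≤ ‖z‖ := by
  simp only [coordProj_apply]
  induction z using UniformSpace.Completion.induction_on with
  | hp => exact isClosed_le (by fun_prop) continuous_norm
  | ih y =>
    rw [← coordProj_apply, show (y : TsirelsonSpace D) = embed D (ofPre D y) from rfl,
      coordProj_embed, norm_embed, norm_embed]
    exact tsirelsonNorm_restrict_le D E _

/-- The seminorm `z ↦ ∑ i, ‖E i z‖`. -/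
noncomputable def familySeminorm {n : ℕ} (E : Fin n → Finset ℕ+) :
    Seminorm ℝ (TsirelsonSpace D) :=
  Seminorm.of (fun z => ∑ i, ‖coordProj D (E i) z‖)
    (fun x y => by
      rw [← Finset.sum_add_distrib]
      exact Finset.sum_le_sum fun i _ => by rw [map_add]; exact norm_add_le _ _)
    (fun r x => by
      rw [Finset.mul_sum]
      exact Finset.sum_congr rfl fun i _ => by rw [map_smul, norm_smul])

theorem familySeminorm_apply {n : ℕ} (E : Fin n → Finset ℕ+) (z : TsirelsonSpace D) :
    familySeminorm D E z = ∑ i, ‖coordProj D (E i) z‖ := rfl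

theorem familySeminorm_le {n : ℕ} (E : Fin n → Finset ℕ+) (z : TsirelsonSpace D) :
    familySeminorm D E z ≤ n * ‖z‖ := by
  rw [familySeminorm_apply]
  refine (Finset.sum_le_card_nsmul _ _ ‖z‖ fun i _ => norm_coordProj_le D _ z).trans ?_
  rw [Finset.card_univ, Fintype.card_fin, nsmul_eq_mul]

/-- The equivalent norm `max {‖z‖, sup ∑ i < n, ‖E i z‖}`, the supremum over `E 0 < ⋯ < E (n-1)`. -/
noncomputable def splittingNorm (n : ℕ) : Seminorm ℝ (TsirelsonSpace D) :=
  normSeminorm ℝ (TsirelsonSpace D) ⊔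
    ⨆ E : {E : Fin n → Finset ℕ+ // Successive E}, familySeminorm D E.1

/-- Needed to evaluate the supremum of seminorms pointwise. -/
theorem bddAbove_familySeminorm (n : ℕ) : BddAbove
    (Set.range fun E : {E : Fin n → Finset ℕ+ // Successive E} => familySeminorm D E.1) := by
  rw [Seminorm.bddAbove_range_iff]
  refine fun z => ⟨n * ‖z‖, ?_⟩
  rintro _ ⟨E, rfl⟩
  exact familySeminorm_le D E.1 z

theorem splittingNorm_le {n : ℕ} {z : TsirelsonSpace D} {r : ℝ} (h : ‖z‖ ≤ r)
    (hE : ∀ E : Fin n → Finset ℕ+, Successive E → familySeminorm D E z ≤ r) :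
    splittingNorm D n z ≤ r := by
  rw [splittingNorm, Seminorm.sup_apply, Seminorm.iSup_apply (bddAbove_familySeminorm D n)]
  exact max_le h (Real.iSup_le (fun E => hE E.1 E.2) ((norm_nonneg z).trans h))

theorem norm_le_splittingNorm (n : ℕ) (z : TsirelsonSpace D) : ‖z‖ ≤ splittingNorm D n z := by
  rw [splittingNorm, Seminorm.sup_apply]
  exact le_max_left _ _

theorem familySeminorm_le_splittingNorm {n : ℕ} {E : Fin n → Finset ℕ+} (hE : Successive E)
    (z : TsirelsonSpace D) : familySeminorm D E z ≤ splittingNorm D n z := by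
  rw [splittingNorm, Seminorm.sup_apply, Seminorm.iSup_apply (bddAbove_familySeminorm D n)]
  refine le_max_of_le_right (le_ciSup (f := fun E : {E : Fin n → Finset ℕ+ // Successive E} =>
    familySeminorm D E.1 z) ⟨n * ‖z‖, ?_⟩ ⟨E, hE⟩)
  rintro _ ⟨E, rfl⟩
  exact familySeminorm_le D E.1 z

theorem isEquivalentNorm_splittingNorm {n : ℕ} (hn : 1 ≤ n) :
    IsEquivalentNorm (splittingNorm D n) := by
  have hn1 : (1 : ℝ) ≤ n := by exact_mod_cast hn
  refine ⟨1, n, one_pos, by linarith, fun z => ⟨?_, ?_⟩⟩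
  · rw [one_mul]
    exact norm_le_splittingNorm D n z
  · exact splittingNorm_le D (le_mul_of_one_le_left (norm_nonneg z) hn1)
      fun E _ => familySeminorm_le D E z

/-- Rapidly increasing sequences of averages whose sum has small norm yield a distortion. -/
theorem distortable_of_rapidlyIncreasing {n n₀ : ℕ} {Φ : ℕ → ℕ} {ε β t : ℝ} (hn : 1 ≤ n)
    (hn₀ : n ≤ n₀) (hε0 : 0 < ε) (hε1 : ε < 1) (hnε : n ≤ ε * n₀)
    (hav : ∀ b : ℕ → ℕ+ →₀ ℝ, (Successive fun i => (b i).support) →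
      (∀ i, tsirelsonNorm D (b i) = 1) → HasAverages D b ε)
    (hβ : ∀ (b : ℕ → ℕ+ →₀ ℝ) (N L s B : ℕ → ℕ) (w : ℕ → ℕ+ →₀ ℝ),
      (Successive fun i => (b i).support) → IsRapidlyIncreasing D b ε n₀ Φ N L s B w →
        tsirelsonNorm D (∑ j ∈ Finset.range n, w j) ≤ β)
    (ht : t * (β * (1 + ε)) < n * (1 - ε) ^ 2) (ht0 : 0 ≤ t) :
    Distortable (unitBasis D) (compFamily schreierOne schreierOne) t := by
  refine ⟨splittingNorm D n, isEquivalentNorm_splittingNorm D hn, fun x hx => ?_⟩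
  obtain ⟨a, ha1, ha2⟩ := (isNormalizedBlock_iff D).1 hx
  have hb : Successive fun i : ℕ => (a i.succPNat).support := fun i j hij =>
    ha1 _ _ (Nat.succPNat_lt_succPNat.2 hij)
  obtain ⟨N, L, s, B, w, hw⟩ := exists_isRapidlyIncreasing D
    (hav (fun i => a i.succPNat) hb fun i => (ha2 _).2) n₀ Φ
  have hn1 : (1 : ℝ) ≤ n := by exact_mod_cast hn
  have h1ε : 0 < 1 - ε := by linarith
  have hws := hw.successive hb
  have hβ' := hβ _ N L s B w hb hw
  set v := ∑ j ∈ Finset.range n, w j with hv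
  have hspan : ∀ j < n, embed D (w j) ∈ Submodule.span ℝ (x '' (indexSet L s n : Set ℕ+)) := by
    intro j hj
    obtain ⟨c, hc⟩ := hw.eq_sum j
    rw [hc, map_sum]
    refine Submodule.sum_mem _ fun i hi => ?_
    rw [map_smul, ← (ha2 _).1]
    refine Submodule.smul_mem _ _ (Submodule.subset_span ⟨_, ?_, rfl⟩)
    exact Finset.mem_biUnion.2 ⟨⟨j, hj⟩, Finset.mem_univ _, Finset.mem_map.2 ⟨i, hi, rfl⟩⟩
  have hvspan : embed D v ∈ Submodule.span ℝ (x '' (indexSet L s n : Set ℕ+)) := by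
    rw [hv, map_sum]
    exact Submodule.sum_mem _ fun j hj => hspan j (Finset.mem_range.1 hj)
  have hNpos : 1 ≤ N 0 := hn.trans (hn₀.trans (hw.le_N 0))
  have hw0 : 0 < tsirelsonNorm D (w 0) := h1ε.trans_le (hw.le_norm 0)
  have hv0 : 0 < tsirelsonNorm D v := by
    refine hw0.trans_le ?_
    rw [← restrict_support_sum hws (s := Finset.range n) (Finset.mem_range.2 hn)]
    exact tsirelsonNorm_restrict_le D _ _
  -- `n` sets are few compared with the `N 0 ≥ n₀ ≥ n / ε` summands of `w 0`.
  have hpw : splittingNorm D n (embed D (w 0)) ≤ 1 + ε := by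
    refine splittingNorm_le D ?_ fun E hE => ?_
    · rw [norm_embed]
      linarith [(hw.isAverage 0).norm_le_one D hNpos]
    · rw [familySeminorm_apply]
      simp only [coordProj_embed, norm_embed]
      refine ((hw.isAverage 0).sum_family_le D hNpos hE).trans ?_
      have hN0 : (0 : ℝ) < N 0 := by exact_mod_cast hNpos
      have h1 : (n₀ : ℝ) ≤ N 0 := by exact_mod_cast hw.le_N 0
      have h2 : (n : ℝ) / N 0 ≤ ε := by
        rw [div_le_iff₀ hN0]
        exact hnε.trans (mul_le_mul_of_nonneg_left h1 hε0.le)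
      linarith
  -- Tested on the supports of the `n` averages.
  have hpv : n * (1 - ε) ≤ splittingNorm D n (embed D v) := by
    refine le_trans ?_ (familySeminorm_le_splittingNorm D
      (E := fun j : Fin n => (w j).support) (fun i j hij => hws i j hij) _)
    rw [familySeminorm_apply]
    simp only [coordProj_embed, norm_embed]
    refine le_trans (le_of_eq ?_) (Finset.card_nsmul_le_sum Finset.univ _ (1 - ε) fun j _ => ?_)
    · rw [Finset.card_univ, Fintype.card_fin, nsmul_eq_mul]
    · rw [hv, restrict_support_sum hws (Finset.mem_range.2 j.2)]
      exact hw.le_norm j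
  have hpw0 : 0 < splittingNorm D n (embed D (w 0)) :=
    hw0.trans_le (by rw [← norm_embed]; exact norm_le_splittingNorm D n _)
  -- The two unit vectors are the normalised sum and the normalised first average; their quotient is
  -- at least `n * (1 - ε) ^ 2 / (β * (1 + ε))`.
  refine ⟨indexSet L s n, hw.indexSet_mem hn₀, (tsirelsonNorm D v)⁻¹ • embed D v,
    Submodule.smul_mem _ _ hvspan, (tsirelsonNorm D (w 0))⁻¹ • embed D (w 0),
    Submodule.smul_mem _ _ (hspan 0 hn), ?_, ?_, ?_⟩
  · rw [norm_smul, norm_embed, Real.norm_eq_abs, abs_of_pos (inv_pos.2 hv0)]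
    exact inv_mul_cancel₀ hv0.ne'
  · rw [norm_smul, norm_embed, Real.norm_eq_abs, abs_of_pos (inv_pos.2 hw0)]
    exact inv_mul_cancel₀ hw0.ne'
  · rw [map_smul_eq_mul, map_smul_eq_mul, Real.norm_eq_abs, Real.norm_eq_abs,
      abs_of_pos (inv_pos.2 hv0), abs_of_pos (inv_pos.2 hw0), lt_div_iff₀ (by positivity),
      inv_mul_eq_div, inv_mul_eq_div, ← mul_div_assoc, div_lt_div_iff₀ hw0 hv0]
    have hw1 := hw.le_norm 0
    calc t * splittingNorm D n (embed D (w 0)) * tsirelsonNorm D v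
        ≤ t * (1 + ε) * β := by gcongr
      _ = t * (β * (1 + ε)) := by ring
      _ < n * (1 - ε) ^ 2 := ht
      _ = n * (1 - ε) * (1 - ε) := by ring
      _ ≤ splittingNorm D n (embed D v) * tsirelsonNorm D (w 0) := by gcongr

end DistortingNorm

/-! ### Existence of averages and norms of rapidly increasing sums -/

section UpperEstimates

/-- In Tsirelson's space this makes `M` consecutive blocks with indices at least `M` admissible. -/
theorem index_lt_of_mem_support {b : ℕ → ℕ+ →₀ ℝ} (hb : Successive fun i => (b i).support)
    (hne : ∀ i, (b i).support.Nonempty) : ∀ i, ∀ k ∈ (b i).support, i < (k : ℕ) := by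
  intro i
  induction i with
  | zero => exact fun k _ => k.pos
  | succ i ih =>
    intro k hk
    obtain ⟨l, hl⟩ := hne i
    have h1 := ih l hl
    have h2 : (l : ℕ) < k := by exact_mod_cast hb i (i + 1) (Nat.lt_succ_self i) l hl k hk
    omega

/-- A sum of admissible normalised blocks has large norm. -/
theorem weight_mul_le_norm_sum (D : TsirelsonData) {b : ℕ → ℕ+ →₀ ℝ}
    (hb : Successive fun i => (b i).support) (hb1 : ∀ i, tsirelsonNorm D (b i) = 1) (s M : ℕ)
    (hM : D.adm M fun r => (b (s + r)).support) :
    D.weight M * M ≤ tsirelsonNorm D (∑ i ∈ Finset.Ico s (s + M), b i) := by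
  refine le_trans (le_of_eq ?_) (le_tsirelsonNorm D _
    (fun i j hij => hb _ _ (Nat.add_lt_add_left hij s)) hM _)
  congr 1
  rw [Finset.sum_congr rfl (g := fun _ => 1)]
  · simp
  · intro r _
    rw [restrict_support_sum hb (Finset.mem_Ico.2 ⟨Nat.le_add_right _ _, by omega⟩), hb1]

theorem support_nonempty_of_norm_eq_one {D : TsirelsonData} {x : ℕ+ →₀ ℝ}
    (h : tsirelsonNorm D x = 1) : x.support.Nonempty := by
  rw [Finsupp.support_nonempty_iff]
  rintro rfl
  rw [tsirelsonNorm_zero] at h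
  exact zero_ne_one h

/-- The sum of `N ^ k` blocks beyond the index `N ^ k` has norm at least `N ^ k / 2`, and `(1 - ε) ^
k < 1 / 2` for large `k`. -/
theorem hasAverages_tsirelson {b : ℕ → ℕ+ →₀ ℝ} (hb : Successive fun i => (b i).support)
    (hb1 : ∀ i, tsirelsonNorm tsirelsonData (b i) = 1) {ε : ℝ} (hε0 : 0 < ε) (hε1 : ε < 1) :
    HasAverages tsirelsonData b ε := by
  intro N hN
  obtain ⟨k, hk⟩ := exists_pow_lt_of_lt_one (x := (1 / 2 : ℝ)) (y := 1 - ε) (by norm_num)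
    (by linarith)
  refine ⟨N ^ k, Nat.one_le_pow _ _ (by omega), fun s hs => ?_⟩
  refine exists_average tsirelsonData hb (fun i => (hb1 i).le) hε1 (by omega) ?_
  have hpos : (0 : ℝ) < (N ^ k : ℕ) := by exact_mod_cast Nat.pow_pos (by omega)
  refine lt_of_lt_of_le (mul_lt_mul_of_pos_right hk hpos) ?_
  refine weight_mul_le_norm_sum tsirelsonData hb hb1 s (N ^ k) fun r l hl => ?_
  have := index_lt_of_mem_support hb (fun i => support_nonempty_of_norm_eq_one (hb1 i)) _ l hl
  omega

theorem logWeight_pow_le (N k : ℕ) : logWeight (N ^ k) ≤ k * logWeight N + 1 := by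
  induction k with
  | zero => simp [logWeight_one]
  | succ k ih =>
    rw [pow_succ]
    refine logWeight_mul_le.trans ?_
    push_cast
    linarith

/-- The sum of `N ^ k` blocks has norm at least `N ^ k` divided by the weight of `N ^ k`. That
weight grows at most linearly in `k`, so it is beaten by the geometric factor `(1 - ε) ^ k`. -/
theorem hasAverages_schlumprecht {b : ℕ → ℕ+ →₀ ℝ} (hb : Successive fun i => (b i).support)
    (hb1 : ∀ i, tsirelsonNorm schlumprechtData (b i) = 1) {ε : ℝ} (hε0 : 0 < ε) (hε1 : ε < 1) :
    HasAverages schlumprechtData b ε := by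
  intro N hN
  have hlim : Filter.Tendsto (fun k : ℕ => (k * (1 - ε) ^ k) * logWeight N + (1 - ε) ^ k)
      Filter.atTop (nhds 0) := by
    have := ((tendsto_self_mul_const_pow_of_lt_one (r := 1 - ε) (by linarith)
      (by linarith)).mul_const (logWeight N)).add
      (tendsto_pow_atTop_nhds_zero_of_lt_one (r := 1 - ε) (by linarith) (by linarith))
    simpa using this
  obtain ⟨k, hk, hk1⟩ := ((hlim.eventually_lt_const one_pos).and
    (Filter.eventually_ge_atTop 1)).exists
  have hNk : 2 ≤ N ^ k := hN.trans (Nat.le_self_pow (by omega) N)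
  refine ⟨N ^ k, by omega, fun s hs => ?_⟩
  refine exists_average schlumprechtData hb (fun i => (hb1 i).le) hε1 (by omega) ?_
  have hpos : (0 : ℝ) < (N ^ k : ℕ) := by exact_mod_cast (by omega : 0 < N ^ k)
  refine lt_of_lt_of_le (mul_lt_mul_of_pos_right ?_ hpos)
    (weight_mul_le_norm_sum schlumprechtData hb hb1 s (N ^ k) hNk)
  rw [schlumprecht_weight, lt_div_iff₀ (one_pos.trans_le (one_le_logWeight (by omega)))]
  refine lt_of_le_of_lt ?_ hk
  have h1 := mul_le_mul_of_nonneg_left (logWeight_pow_le N k)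
    (by have : 0 < 1 - ε := by linarith
        positivity : 0 ≤ (1 - ε) ^ k)
  linarith

/-- A sum of numbers at most one, all but one of which obey a better bound. -/
theorem sum_le_of_forall_pair {n : ℕ} {T q : ℕ → ℝ} (hq : ∀ i, 0 ≤ q i) (hT : ∀ i, T i ≤ 1)
    (h : ∀ i j, i < j → T i ≤ q i ∨ T j ≤ q j) :
    ∑ i ∈ Finset.range n, T i ≤ ∑ i ∈ Finset.range n, q i + 1 := by
  classical
  have h1 : ∀ i ∈ Finset.range n, T i ≤ q i + if T i ≤ q i then 0 else 1 := by
    intro i _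
    split_ifs with hi
    · rwa [add_zero]
    · linarith [hq i, hT i]
  refine (Finset.sum_le_sum h1).trans ?_
  rw [Finset.sum_add_distrib]
  refine add_le_add le_rfl ?_
  have h2 : ∑ i ∈ Finset.range n, (if T i ≤ q i then (0 : ℝ) else 1)
      = ((Finset.range n).filter fun i => ¬ T i ≤ q i).card := by
    rw [Finset.card_filter, Nat.cast_sum]
    refine Finset.sum_congr rfl fun i _ => ?_
    split_ifs <;> simp_all
  rw [h2]
  have h3 : ((Finset.range n).filter fun i => ¬ T i ≤ q i).card ≤ 1 := by
    refine Finset.card_le_one.2 fun i hi j hj => ?_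
    have hi' := (Finset.mem_filter.1 hi).2
    have hj' := (Finset.mem_filter.1 hj).2
    rcases lt_trichotomy i j with hij | hij | hij
    · exact absurd (h i j hij) (not_or.2 ⟨hi', hj'⟩)
    · exact hij
    · exact absurd (h j i hij) (not_or.2 ⟨hj', hi'⟩)
  exact_mod_cast h3

/-- In Tsirelson's space the sum of `n` rapidly increasing averages has norm about `n / 2`. -/
theorem tsirelsonNorm_rapidlyIncreasing_le {n n₀ K : ℕ} {ε : ℝ} {b : ℕ → ℕ+ →₀ ℝ}
    {N L s B : ℕ → ℕ} {w : ℕ → ℕ+ →₀ ℝ} (hK : 1 ≤ K) (hn₀ : 1 ≤ n₀)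
    (hb : Successive fun i => (b i).support)
    (hw : IsRapidlyIncreasing tsirelsonData b ε n₀ (fun B => K * B) N L s B w) :
    tsirelsonNorm tsirelsonData (∑ j ∈ Finset.range n, w j) ≤ n * (1 / 2 * (1 + 1 / K)) + 1 := by
  have hN1 : ∀ j, 1 ≤ N j := fun j => hn₀.trans (hw.le_N j)
  have hw1 : ∀ j, tsirelsonNorm tsirelsonData (w j) ≤ 1 := fun j =>
    (hw.isAverage j).norm_le_one _ (hN1 j)
  have hK0 : (0 : ℝ) < K := by exact_mod_cast hK
  refine tsirelsonNorm_le_of _ (fun k => ?_) fun m E hE hm => ?_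
  · refine (abs_sum_apply_le (hw.successive hb) _ zero_le_one (fun i _ k =>
      (abs_le_tsirelsonNorm tsirelsonData _ k).trans (hw1 i)) k).trans ?_
    have : 0 ≤ (n : ℝ) * (1 / 2 * (1 + 1 / K)) := by positivity
    linarith
  · change 1 / 2 * _ ≤ _
    refine (mul_le_mul_of_nonneg_left (sum_family_sum_le _ _ _ _) (by norm_num)).trans ?_
    rw [Finset.mul_sum]
    refine (sum_le_of_forall_pair (q := fun _ => 1 / 2 * (1 + 1 / (K : ℝ)))
      (fun i => by positivity) (fun i => (le_tsirelsonNorm tsirelsonData E hE hm (w i)).trans (hw1 i))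
      fun i j hij => ?_).trans ?_
    -- If the family acts on `w i` at all, admissibility gives `m ≤ B i`. Every later average then
    -- has at least `K * m` summands and is almost additive under the `m` sets. Only the first
    -- average met can exceed the bound.
    · rw [or_iff_not_imp_left]
      intro hbad
      have hex : ∃ r, tsirelsonNorm tsirelsonData (restrict (E r) (w i)) ≠ 0 := by
        by_contra hcon
        push Not at hcon
        refine hbad ?_
        rw [Finset.sum_eq_zero fun r _ => hcon r, mul_zero]
        positivity
      obtain ⟨r, hr⟩ := hex
      have hmeet : ¬ Disjoint (E r) (w i).support := fun hd => hr (by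
        rw [restrict_eq_zero hd, tsirelsonNorm_zero])
      obtain ⟨k, hk1, hk2⟩ := Finset.not_disjoint_iff.1 hmeet
      have h1 : m ≤ (k : ℕ) := hm r k hk1
      have h2 := hw.support_le i k hk2
      have h3 : K * B i ≤ N j := hw.N_growth i j hij
      have h4 : K * m ≤ N j := (Nat.mul_le_mul_left K (h1.trans h2)).trans h3
      refine mul_le_mul_of_nonneg_left (((hw.isAverage j).sum_family_le _ (hN1 j) hE).trans ?_)
        (tsirelsonData.weight_nonneg m)
      have hNj : (0 : ℝ) < N j := by exact_mod_cast hN1 j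
      have h5 : (K : ℝ) * m ≤ N j := by exact_mod_cast h4
      refine add_le_add le_rfl ?_
      rw [div_le_div_iff₀ hNj hK0]
      linarith
    · rw [Finset.sum_const, Finset.card_range, nsmul_eq_mul]

/-- In Schlumprecht's space the sum of `n` rapidly increasing averages has norm `o(n)`. -/
theorem schlumprechtNorm_rapidlyIncreasing_le {n n₀ M d : ℕ} {ε : ℝ} {b : ℕ → ℕ+ →₀ ℝ}
    {N L s B : ℕ → ℕ} {w : ℕ → ℕ+ →₀ ℝ} (hn : 1 ≤ n) (hM : 1 ≤ M) (hn₀ : n * M ≤ n₀)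
    (hb : Successive fun i => (b i).support)
    (hw : IsRapidlyIncreasing schlumprechtData b ε n₀ (fun B => n * 2 ^ (n * B)) N L s B w) :
    tsirelsonNorm schlumprechtData (∑ j ∈ Finset.range n, w j)
      ≤ ((logWeight M)⁻¹ + (logWeight 2)⁻¹ ^ d) * n + 3 * (d + 1) * M ^ d := by
  have hN1 : ∀ j, 1 ≤ N j := fun j =>
    (Nat.mul_le_mul hn hM : 1 * 1 ≤ n * M).trans (hn₀.trans (hw.le_N j))
  have hw1 : ∀ j, tsirelsonNorm schlumprechtData (w j) ≤ 1 := fun j =>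
    (hw.isAverage j).norm_le_one _ (hN1 j)
  have hn1 : (1 : ℝ) ≤ n := by exact_mod_cast hn
  have hn0 : (0 : ℝ) < n := by linarith
  have hM1 : (1 : ℝ) ≤ M := by exact_mod_cast hM
  choose μ hμ1 hμ2 hμ3 using fun j => (hw.isAverage j).exists_measure _ (hN1 j)
  set ρ := (logWeight 2)⁻¹ with hρ
  have hρ0 : 0 < ρ := inv_pos.2 (one_pos.trans one_lt_logWeight_two)
  have hρ1 : ρ ≤ 1 := inv_le_one_of_one_le₀ one_lt_logWeight_two.le
  have hfM := one_le_logWeight hM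
  set β := (logWeight M)⁻¹ with hβ
  have hβ0 : 0 < β := inv_pos.2 (by linarith)
  have hβ1 : β ≤ 1 := inv_le_one_of_one_le₀ hfM
  set y := ∑ j ∈ Finset.range n, w j with hy
  set ν : Finset ℕ+ → ℝ := fun A => ∑ j ∈ Finset.range n, μ j A with hν
  have hν0 : ∀ A, 0 ≤ ν A := fun A => Finset.sum_nonneg fun j _ => (hμ1 j A).1
  -- As for two scales: families of fewer than `M` sets improve `ρ ^ k` and worsen the constant,
  -- whereas families of at least `M` sets give the main term `β * ν A` directly.
  have key : ∀ k : ℕ, ∀ A, tsirelsonNorm schlumprechtData (restrict A y)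
      ≤ (β + ρ ^ k) * ν A + 3 * (k + 1) * M ^ k := by
    intro k
    induction k with
    | zero =>
      intro A
      have h1 : tsirelsonNorm schlumprechtData (restrict A y) ≤ ν A := by
        rw [hy, restrict_sum]
        exact (tsirelsonNorm_sum_le _ _ _).trans (Finset.sum_le_sum fun j _ => hμ2 j A)
      have h2 := mul_nonneg hβ0.le (hν0 A)
      simp only [pow_zero, Nat.cast_zero]
      linarith
    | succ k ih =>
      intro A
      have hA := hν0 A
      have hMk : 1 ≤ (M : ℝ) ^ (k + 1) := one_le_pow₀ hM1
      have hconst : 3 ≤ 3 * ((k + 1 : ℕ) + 1) * (M : ℝ) ^ (k + 1) := by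
        have : (1 : ℝ) ≤ ((k + 1 : ℕ) : ℝ) + 1 := by
          have : (0 : ℝ) ≤ ((k + 1 : ℕ) : ℝ) := Nat.cast_nonneg _
          linarith
        nlinarith
      have hρk : 0 ≤ ρ ^ (k + 1) * ν A := by positivity
      have hβν : 0 ≤ β * ν A := by positivity
      refine tsirelsonNorm_le_of _ (fun i => ?_) fun m E hE hm => ?_
      · have h1 : |restrict A y i| ≤ 1 := by
          rw [restrict_apply]
          split_ifs
          · exact abs_sum_apply_le (hw.successive hb) _ zero_le_one (fun i _ k =>
              (abs_le_tsirelsonNorm schlumprechtData _ k).trans (hw1 i)) i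
          · rw [abs_zero]; exact zero_le_one
        linarith
      have hm2 : 2 ≤ m := hm
      have hw1' : 1 ≤ logWeight m := one_le_logWeight (one_le_two.trans hm2)
      have hw0 : 0 < logWeight m := one_pos.trans_le hw1'
      rw [schlumprecht_weight, one_div]
      rcases lt_or_ge m M with hmM | hMm
      · have hwρ : (logWeight m)⁻¹ ≤ ρ :=
          inv_anti₀ (one_pos.trans one_lt_logWeight_two) (logWeight_mono hm2)
        have hmM' : (m : ℝ) ≤ M := by exact_mod_cast hmM.le
        -- Each of the `n` averages has at least `n * M` summands, so cutting it into fewer than `M`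
        -- pieces costs at most `1 / n`.
        have hνsum : ∑ i, ν (E i ∩ A) ≤ ν A + 1 := by
          rw [hν]
          dsimp only
          rw [Finset.sum_comm]
          calc _ ≤ ∑ j ∈ Finset.range n, (μ j A + 1 / n) := by
                refine Finset.sum_le_sum fun j _ => (hμ3 j A m E hE).trans ?_
                refine add_le_add le_rfl ?_
                rw [div_le_div_iff₀ (by exact_mod_cast hN1 j) hn0, one_mul]
                have h1 : ((n * M : ℕ) : ℝ) ≤ N j := by exact_mod_cast hn₀.trans (hw.le_N j)
                push_cast at h1
                nlinarith
            _ = _ := by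
                rw [Finset.sum_add_distrib, Finset.sum_const, Finset.card_range, nsmul_eq_mul,
                  mul_one_div_cancel hn0.ne']
        have hcoef : 0 ≤ β + ρ ^ k := by positivity
        have hρk1 : ρ ^ k ≤ 1 := pow_le_one₀ hρ0.le hρ1
        have h1 : ∑ i, tsirelsonNorm schlumprechtData (restrict (E i) (restrict A y))
            ≤ (β + ρ ^ k) * ν A + 2 + M * (3 * (k + 1) * M ^ k) := by
          calc _ ≤ ∑ i, ((β + ρ ^ k) * ν (E i ∩ A) + 3 * (k + 1) * M ^ k) := by
                refine Finset.sum_le_sum fun i _ => ?_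
                rw [restrict_restrict]
                exact ih _
            _ = (β + ρ ^ k) * ∑ i, ν (E i ∩ A) + m * (3 * (k + 1) * M ^ k) := by
                rw [Finset.sum_add_distrib, Finset.mul_sum, Finset.sum_const, Finset.card_univ,
                  Fintype.card_fin, nsmul_eq_mul]
            _ ≤ (β + ρ ^ k) * (ν A + 1) + M * (3 * (k + 1) * M ^ k) := by gcongr
            _ ≤ _ := by linarith
        have h3 : 0 ≤ 2 + (M : ℝ) * (3 * (k + 1) * M ^ k) := by positivity
        calc (logWeight m)⁻¹ * ∑ i, tsirelsonNorm schlumprechtData (restrict (E i) (restrict A y))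
            ≤ ρ * ((β + ρ ^ k) * ν A + 2 + M * (3 * (k + 1) * M ^ k)) :=
              mul_le_mul hwρ h1 (Finset.sum_nonneg fun i _ => tsirelsonNorm_nonneg _ _) hρ0.le
          _ = ρ * (β * ν A) + ρ ^ (k + 1) * ν A + ρ * (2 + M * (3 * (k + 1) * M ^ k)) := by ring
          _ ≤ 1 * (β * ν A) + ρ ^ (k + 1) * ν A + 1 * (2 + M * (3 * (k + 1) * M ^ k)) := by
              gcongr
          _ = (β + ρ ^ (k + 1)) * ν A + 2 + 3 * (k + 1) * M ^ (k + 1) := by ring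
          _ ≤ _ := by
              push_cast
              nlinarith
      · have hinv : (logWeight m)⁻¹ ≤ β := inv_anti₀ (by linarith) (logWeight_mono hMm)
        have hyA : restrict A y = ∑ j ∈ Finset.range n, restrict A (w j) := restrict_sum _ _ _
        rw [hyA]
        refine (mul_le_mul_of_nonneg_left (sum_family_sum_le _ _ _ _)
          (inv_nonneg.2 hw0.le)).trans ?_
        rw [Finset.mul_sum]
        -- The bound `q` serves averages on both sides of the exceptional one: `1 / n` for those
        -- whose `ℓ₁` norm is beaten by the weight, and `β * (μ j A + 1 / n)` for those that are
        -- almost additive. Summation gives `β * ν A` plus at most 3.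
        refine (sum_le_of_forall_pair (q := fun j => 1 / n + β * (μ j A + 1 / n))
          (fun j => by
            have := (hμ1 j A).1
            positivity)
          (fun j => (schlumprechtNorm_family_le hm2 hE _).trans
            ((tsirelsonNorm_restrict_le _ _ _).trans (hw1 j))) fun i j hij => ?_).trans ?_
        -- If the weight is below `n * B i`, then `m < 2 ^ (n * B i)`, and the growth of `N` makes
        -- `w j` long compared with `m`. Otherwise the weight is at least `n` times the `ℓ₁` norm of
        -- `w i`, which is at most `B i`.
        · rcases lt_or_ge (logWeight m) ((n * B i : ℕ) : ℝ) with hlt | hge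
          · right
            rw [logWeight_lt_iff] at hlt
            have h1 : n * 2 ^ (n * B i) ≤ N j := hw.N_growth i j hij
            have h2 : n * m ≤ N j := (Nat.mul_le_mul_left n (by omega)).trans h1
            have h3 : ∑ r, tsirelsonNorm schlumprechtData (restrict (E r) (restrict A (w j)))
                ≤ μ j A + 1 / n := by
              calc _ ≤ ∑ r, μ j (E r ∩ A) := by
                    refine Finset.sum_le_sum fun r _ => ?_
                    rw [restrict_restrict]
                    exact hμ2 j _
                _ ≤ μ j A + m / N j := hμ3 j A m E hE
                _ ≤ _ := by
                    refine add_le_add le_rfl ?_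
                    rw [div_le_div_iff₀ (by exact_mod_cast hN1 j) hn0, one_mul, mul_comm]
                    exact_mod_cast h2
            have h4 := mul_le_mul hinv h3
              (Finset.sum_nonneg fun i _ => tsirelsonNorm_nonneg _ _) hβ0.le
            have h5 : (0 : ℝ) ≤ 1 / n := by positivity
            linarith
          · left
            have h1 : ellOne (restrict A (w i)) ≤ B i := by
              have h2 : (restrict A (w i)).support.card ≤ B i := by
                rw [← Finset.card_map ⟨fun k : ℕ+ => (k : ℕ), PNat.coe_injective⟩]
                refine (Finset.card_le_card (t := Finset.Icc 1 (B i)) fun k hk => ?_).trans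
                  (by simp)
                obtain ⟨l, hl, rfl⟩ := Finset.mem_map.1 hk
                have hl' : l ∈ (w i).support := Finsupp.mem_support_iff.2 fun h0 =>
                  Finsupp.mem_support_iff.1 hl (by rw [restrict_apply, h0, ite_self])
                exact Finset.mem_Icc.2 ⟨l.pos, hw.support_le i l hl'⟩
              refine (Finset.sum_le_card_nsmul _ _ 1 fun l _ => ?_).trans ?_
              · exact (abs_le_tsirelsonNorm schlumprechtData _ l).trans
                  ((tsirelsonNorm_restrict_le _ _ _).trans (hw1 i))
              · rw [nsmul_eq_mul, mul_one]
                exact_mod_cast h2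
            have h2 := (sum_tsirelsonNorm_restrict_le_ellOne schlumprechtData E hE (restrict A (w i))).trans h1
            have h3 : (logWeight m)⁻¹ * ∑ r, tsirelsonNorm schlumprechtData
                (restrict (E r) (restrict A (w i))) ≤ 1 / n := by
              rw [inv_mul_le_iff₀ hw0, mul_one_div, le_div_iff₀ hn0]
              push_cast at hge
              nlinarith
            have h4 : 0 ≤ β * (μ i A + 1 / n) := by
              have := (hμ1 i A).1
              positivity
            linarith
        · rw [Finset.sum_add_distrib, ← Finset.mul_sum, Finset.sum_add_distrib, Finset.sum_const,
            Finset.card_range, nsmul_eq_mul, mul_one_div_cancel hn0.ne']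
          have h1 : β * (ν A + 1) ≤ β * ν A + 1 := by linarith
          linarith
  have h1 := key d y.support
  rw [restrict_eq_self subset_rfl] at h1
  refine h1.trans (add_le_add (mul_le_mul_of_nonneg_left ?_ (by positivity)) le_rfl)
  rw [hν]
  refine (Finset.sum_le_card_nsmul _ _ 1 fun j _ => (hμ1 j _).2).trans ?_
  rw [Finset.card_range, nsmul_eq_mul, mul_one]

end UpperEstimates

/-! ### Values of the indices -/

section Indices

theorem schreier_zero (c : LimitApproximation) : schreier c 0 = schreierZero :=
  Ordinal.limitRecOn_zero ..

theorem schreier_two (c : LimitApproximation) :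
    schreier c 2 = compFamily schreierOne schreierOne := by
  have h := Ordinal.limitRecOn_add_one (motive := fun _ => Set (Finset ℕ+)) 1 schreierZero
    (fun _ S => compFamily schreierOne S)
    (fun ξ _ S => {E | ∃ n : ℕ+, (∀ m ∈ E, n ≤ m) ∧ ∃ h : c.seq ξ n < ξ, E ∈ S (c.seq ξ n) h})
  rw [one_add_one_eq_two] at h
  exact h.trans (congrArg (compFamily schreierOne) (schreier_one c))

theorem schreierZero_subset : schreierZero ⊆ schreierOne := by
  rintro E (rfl | ⟨n, rfl⟩) m hm
  · simp at hm
  · rw [Finset.card_singleton]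
    exact m.pos

theorem leastCountable_eq_two {P : Ordinal.{0} → Prop} (h0 : ¬ P 0) (h1 : ¬ P 1) (h2 : P 2) :
    leastCountable P = 2 := by
  have h2ω : (2 : Ordinal.{0}) < ω₁ := by
    have := (Ordinal.natCast_lt_omega0 2).trans Ordinal.omega0_lt_omega_one
    exact_mod_cast this
  rw [leastCountable, if_pos ⟨2, h2ω, h2⟩]
  refine le_antisymm (csInf_le' ⟨h2ω, h2⟩) (le_csInf ⟨2, h2ω, h2⟩ ?_)
  rintro ξ ⟨-, hξ⟩
  by_contra hlt
  rw [not_le, ← one_add_one_eq_two, ← Order.succ_eq_add_one, Order.lt_succ_iff] at hlt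
  rcases hlt.lt_or_eq with h | h
  · rw [Order.lt_one_iff] at h
    exact h0 (h ▸ hξ)
  · exact h1 (h ▸ hξ)

theorem not_distortable_tsirelson {F : Set (Finset ℕ+)} (hF : F ⊆ schreierOne) {t : ℝ}
    (ht : 1 < t) : ¬ Distortable basisT F t :=
  not_distortable_of_ellOneSpreading tsirelsonData (by norm_num) successive_unitVectors
    tsirelson_ellOneSpreading hF ht

theorem not_distortable_schlumprecht {F : Set (Finset ℕ+)} (hF : F ⊆ schreierOne) {t : ℝ}
    (ht : 1 < t) : ¬ Distortable basisS F t := by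
  obtain ⟨x, hx, hS⟩ := schlumprecht_ellOneSpreading
  exact not_distortable_of_ellOneSpreading schlumprechtData (by norm_num) hx hS hF ht

theorem distortable_tsirelson {t : ℝ} (ht1 : 1 < t) (ht2 : t < 2) :
    Distortable basisT (compFamily schreierOne schreierOne) t := by
  obtain ⟨ε, hε0, hε1, hεt⟩ : ∃ ε : ℝ, 0 < ε ∧ ε < 1 ∧ t / 2 * (1 + ε) < (1 - ε) ^ 2 := by
    -- With `t = 2 - 16 * ε` the claim reads `1 - 7 * ε - 8 * ε ^ 2 < 1 - 2 * ε + ε ^ 2`.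
    refine ⟨(2 - t) / 16, by linarith, by linarith, ?_⟩
    nlinarith [sq_nonneg (2 - t)]
  have hgap : 0 < (1 - ε) ^ 2 - t / 2 * (1 + ε) := by linarith
  obtain ⟨n, hn, hn1⟩ := (((tendsto_natCast_atTop_atTop (R := ℝ)).eventually_gt_atTop
    (3 / 2 * t * (1 + ε) / ((1 - ε) ^ 2 - t / 2 * (1 + ε)))).and
    (Filter.eventually_ge_atTop 1)).exists
  rw [div_lt_iff₀ hgap] at hn
  have hn0 : (0 : ℝ) < n := by exact_mod_cast hn1
  -- Taking `K = n` makes the bound on the sum equal to `n / 2 + 3 / 2`; the choice of `n` lets the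
  -- gap absorb the `3 / 2`.
  refine distortable_of_rapidlyIncreasing tsirelsonData (n₀ := n + ⌈n / ε⌉₊)
    (Φ := fun B => n * B) hn1 (Nat.le_add_right _ _) hε0 hε1 ?_
    (fun b hb hb1 => hasAverages_tsirelson hb hb1 hε0 hε1)
    (fun b N L s B w hb hw => tsirelsonNorm_rapidlyIncreasing_le hn1 (by omega) hb hw)
    ?_ (by linarith)
  · have h1 := Nat.le_ceil (n / ε)
    rw [div_le_iff₀ hε0] at h1
    push_cast
    nlinarith
  · have h1 : (n : ℝ) * (1 / 2 * (1 + 1 / n)) = n / 2 + 1 / 2 := by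
      field_simp
    rw [h1]
    nlinarith

theorem arbitrarilyDistortable_schlumprecht :
    ArbitrarilyDistortable basisS (compFamily schreierOne schreierOne) := by
  intro t ht
  -- With `ε = 1 / 2` the requirement is `t * (3 / 2) * β < n / 4`. The two small coefficients, each
  -- below `1 / (24 * t)`, use at most `n / 8`. The remaining constant depends only on `M` and `d`,
  -- and `n`, chosen last, keeps it below `n / 8`.
  have hδ : 0 < 1 / (24 * t) := by positivity
  obtain ⟨M, hM, hM1⟩ := ((tendsto_logWeight.inv_tendsto_atTop.eventually_lt_const hδ).and
    (Filter.eventually_ge_atTop 1)).exists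
  obtain ⟨d, hd⟩ := exists_pow_lt_of_lt_one hδ (inv_lt_one_of_one_lt₀ one_lt_logWeight_two)
  simp only [Pi.inv_apply] at hM
  obtain ⟨n, hn, hn1⟩ := (((tendsto_natCast_atTop_atTop (R := ℝ)).eventually_gt_atTop
    (8 * (t * (3 / 2) * (3 * (d + 1) * M ^ d)))).and (Filter.eventually_ge_atTop 1)).exists
  have hn0 : (0 : ℝ) < n := by exact_mod_cast hn1
  refine distortable_of_rapidlyIncreasing schlumprechtData (n₀ := n * M + 2 * n)
    (Φ := fun B => n * 2 ^ (n * B)) (ε := 1 / 2) hn1 (by omega) (by norm_num) (by norm_num) ?_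
    (fun b hb hb1 => hasAverages_schlumprecht hb hb1 (by norm_num) (by norm_num))
    (fun b N L s B w hb hw => schlumprechtNorm_rapidlyIncreasing_le (M := M) (d := d) hn1 hM1
      (Nat.le_add_right _ _) hb hw)
    ?_ (by linarith)
  · push_cast
    have : (0 : ℝ) ≤ n * M := by positivity
    linarith
  · have h1 : ((logWeight M)⁻¹ + (logWeight 2)⁻¹ ^ d) * n ≤ 2 * (1 / (24 * t)) * n :=
      mul_le_mul_of_nonneg_right (by linarith) hn0.le
    have h2 : t * (3 / 2) * (2 * (1 / (24 * t)) * n) = n / 8 := by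
      field_simp
      norm_num
    have h3 := mul_le_mul_of_nonneg_left h1 (by positivity : 0 ≤ t * (3 / 2))
    linarith

end Indices

end DistortionIndex

theorem mainTheorem8 (c : DistortionIndex.LimitApproximation) :
    DistortionIndex.indexAD c DistortionIndex.basisS = 2 ∧
    ∀ t : ℝ, 1 < t → t < 2 → DistortionIndex.indexD c t DistortionIndex.basisT = 2 := by
  open DistortionIndex in
  refine ⟨leastCountable_eq_two (fun h => ?_) (fun h => ?_) ?_, fun t ht1 ht2 =>
    leastCountable_eq_two ?_ ?_ ?_⟩
  -- Arbitrary distortability is refuted at the single value `t = 2`; any `t > 1` would serve.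
  · exact not_distortable_schlumprecht
      ((schreier_zero c).symm ▸ schreierZero_subset) one_lt_two (h 2 one_le_two)
  · exact not_distortable_schlumprecht (schreier_one c).subset one_lt_two (h 2 one_le_two)
  · rw [schreier_two]
    exact arbitrarilyDistortable_schlumprecht
  · exact not_distortable_tsirelson ((schreier_zero c).symm ▸ schreierZero_subset) ht1
  · exact not_distortable_tsirelson (schreier_one c).subset ht1
  · rw [schreier_two]
    exact distortable_tsirelson ht1 ht2
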